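/- Let $(M,g,J)$ be a connected smooth almost Hermitian manifold of real dimension $2m$ with $m>2$: $g$ is a smooth Riemannian metric and $J$ is a smooth almost complex structure ($J^2=-\mathrm{id}$) with $g(JX,JY)=g(X,Y)$. Let $\nabla$ be the Levi-Civita connection of $g$, let $R(X,Y,Z,U)=g(\nabla_X\nabla_YZ-\nabla_Y\nabla_XZ-\nabla_{[X,Y]}Z,\,U)$ be its curvature tensor, and let $K(\alpha)=\dfrac{R(x,y,y,x)}{g(x,x)g(y,y)-g(x,y)^2}$ be the sectional curvature of a plane $\alpha\subset T_pM$ with basis $x,y$. A plane $\alpha\subset T_pM$ is called holomorphic if $J\alpha=\alpha$, and antiholomorphic if $\alpha\perp J\alpha$. Suppose that $M$ is an $AH_3$-manifold, that is, $$R(X,Y,Z,U)=R(JX,JY,JZ,JU)$$ for all $p\in M$ and all $X,Y,Z,U\in T_pM$, and that $M$ has pointwise constant antiholomorphic sectional curvature, that is, there is a function $\nu:M\to\mathbb R$ such that $K(\alpha)=\nu(p)$ for every $p\in M$ and every antiholomorphic plane $\alpha\subset T_pM$. Then at least one of the following holds: 1. $M$ is a real space form: there is a constant $c$ such that $K(\alpha)=c$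 for every plane $\alpha$ tangent to $M$; 2. $M$ is a complex space form: $\nabla J=0$ (that is, $M$ is a Kähler manifold), and there is a constant $c$ such that $K(\alpha)=c$ for every holomorphic plane $\alpha$ tangent to $M$. -/

import Mathlib

open Bundle Module
open scoped Manifold ContDiff

noncomputable section

/-! ### Riemannian geometry on an open set of a normed space

The metric is a function `G` from the (finite dimensional) space `V` to bilinear forms on `V`. -/

namespace LocalGeometry

variable {V : Type*} [NormedAddCommGroup V] [NormedSpace ℝ V]

/-- The Christoffel map of `G`: the vector `Γ y u v` is determined by the Koszul formula
`2 G(Γ(u, v), w) = (D_u G)(v, w) + (D_v G)(u, w) - (D_w G)(u, v)` for all `w`. -/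
def christoffel (G : V → V →L[ℝ] V →L[ℝ] ℝ) (y u v : V) : V :=
  (G y).inverse ((1 / 2 : ℝ) •
    (fderiv ℝ G y u v + fderiv ℝ G y v u - ((fderiv ℝ G y).flip u).flip v))

/-- The curvature operator `R(u, v) w = ∇_u ∇_v w - ∇_v ∇_u w` of the Levi-Civita connection
`∇_u W = D_u W + Γ(u, W)`, evaluated on the constant (hence commuting) vector fields `u, v, w`. -/
def curvature (G : V → V →L[ℝ] V →L[ℝ] ℝ) (y u v w : V) : V :=
  fderiv ℝ (fun z ↦ christoffel G z v w) y u - fderiv ℝ (fun z ↦ christoffel G z u w) y v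
    + christoffel G y u (christoffel G y v w) - christoffel G y v (christoffel G y u w)

/-- The covariant derivative `(∇_u A) v = ∇_u (A v) - A (∇_u v)` of a field `A` of endomorphisms,
evaluated on the constant vector field `v`. -/
def covDerivEnd (G : V → V →L[ℝ] V →L[ℝ] ℝ) (A : V → V →L[ℝ] V) (y u v : V) : V :=
  fderiv ℝ A y u v + christoffel G y u (A y v) - A y (christoffel G y u v)

end LocalGeometry

/-! ### Almost Hermitian manifolds -/

/-- A smooth almost Hermitian structure on a manifold `M` modelled on `V`: a smooth Riemannian
metric `g` and a smooth almost complex structure `J` which preserves `g`. -/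
structure AlmostHermitianStructure (V : Type*) [NormedAddCommGroup V] [NormedSpace ℝ V]
    (M : Type*) [TopologicalSpace M] [ChartedSpace V M] [IsManifold 𝓘(ℝ, V) ∞ M] where
  /-- the metric tensor -/
  g : ContMDiffRiemannianMetric 𝓘(ℝ, V) ∞ V (fun p : M ↦ TangentSpace 𝓘(ℝ, V) p)
  /-- the almost complex structure -/
  J : (p : M) → TangentSpace 𝓘(ℝ, V) p →L[ℝ] TangentSpace 𝓘(ℝ, V) p
  contMDiff_J : ContMDiff 𝓘(ℝ, V) (𝓘(ℝ, V).prod 𝓘(ℝ, V →L[ℝ] V)) ∞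
    (fun p ↦ TotalSpace.mk' (V →L[ℝ] V)
      (E := fun p : M ↦ TangentSpace 𝓘(ℝ, V) p →L[ℝ] TangentSpace 𝓘(ℝ, V) p) p (J p))
  J_J : ∀ (p : M) (x : TangentSpace 𝓘(ℝ, V) p), J p (J p x) = -x
  g_J_J : ∀ (p : M) (x y : TangentSpace 𝓘(ℝ, V) p),
    g.inner p (J p x) (J p y) = g.inner p x y

namespace AlmostHermitianStructure

variable {V : Type*} [NormedAddCommGroup V] [NormedSpace ℝ V]
  {M : Type*} [TopologicalSpace M] [ChartedSpace V M] [IsManifold 𝓘(ℝ, V) ∞ M]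
  (h : AlmostHermitianStructure V M)

/-- For `q` in the source of the chart at `p`, the isomorphism from `V` to `T_q M` given by the
differential of the inverse of that chart. -/
def chartFrame (p q : M) : V →L[ℝ] TangentSpace 𝓘(ℝ, V) q :=
  (trivializationAt V (TangentSpace 𝓘(ℝ, V) : M → Type _) p).symmL ℝ q

/-- For `q` in the source of the chart at `p`, the isomorphism from `T_q M` to `V` given by the
differential of that chart. -/
def chartCoframe (p q : M) : TangentSpace 𝓘(ℝ, V) q →L[ℝ] V :=
  (trivializationAt V (TangentSpace 𝓘(ℝ, V) : M → Type _) p).continuousLinearMapAt ℝ q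

/-- The metric, read in the chart at `p`. -/
def metricInChart (p : M) (y : V) : V →L[ℝ] V →L[ℝ] ℝ :=
  let q : M := (extChartAt 𝓘(ℝ, V) p).symm y
  (ContinuousLinearMap.precomp ℝ (chartFrame p q)) ∘L h.g.inner q ∘L chartFrame p q

/-- The almost complex structure, read in the chart at `p`. -/
def complexInChart (p : M) (y : V) : V →L[ℝ] V :=
  let q : M := (extChartAt 𝓘(ℝ, V) p).symm y
  chartCoframe p q ∘L h.J q ∘L chartFrame p q

/-- The curvature tensor `R(x, y, z, u) = g(R(x, y) z, u)` at `p`, computed in the chart at `p`.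
Recall that `T_p M` is by definition `V`, a vector being identified with its components in the
chart at `p`. -/
def R (p : M) (x y z u : TangentSpace 𝓘(ℝ, V) p) : ℝ :=
  h.g.inner p (LocalGeometry.curvature (V := V) (h.metricInChart p) (extChartAt 𝓘(ℝ, V) p p) x y z) u

/-- The covariant derivative `(∇_x J) y` at `p` with respect to the Levi-Civita connection,
computed in the chart at `p`. -/
def nablaJ (p : M) (x y : TangentSpace 𝓘(ℝ, V) p) : TangentSpace 𝓘(ℝ, V) p :=
  LocalGeometry.covDerivEnd (V := V) (h.metricInChart p) (h.complexInChart p)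
    (extChartAt 𝓘(ℝ, V) p p) x y

/-- The curvature of the plane spanned by the linearly independent vectors `x` and `y`. -/
def sectionalCurvature (p : M) (x y : TangentSpace 𝓘(ℝ, V) p) : ℝ :=
  h.R p x y y x / (h.g.inner p x x * h.g.inner p y y - h.g.inner p x y ^ 2)

/-- The plane `α` in `T_p M` has curvature `c`. -/
def HasPlaneCurvature (p : M) (α : Submodule ℝ (TangentSpace 𝓘(ℝ, V) p)) (c : ℝ) : Prop :=
  ∀ x ∈ α, ∀ y ∈ α, LinearIndependent ℝ ![x, y] → h.sectionalCurvature p x y = c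

/-- `α` is a holomorphic plane: a plane with `J α = α`. -/
def IsHolomorphicPlane (p : M) (α : Submodule ℝ (TangentSpace 𝓘(ℝ, V) p)) : Prop :=
  finrank ℝ α = 2 ∧ α.map (h.J p).toLinearMap = α

/-- `α` is an antiholomorphic plane: a plane orthogonal to `J α`. -/
def IsAntiholomorphicPlane (p : M) (α : Submodule ℝ (TangentSpace 𝓘(ℝ, V) p)) : Prop :=
  finrank ℝ α = 2 ∧ ∀ x ∈ α, ∀ y ∈ α, h.g.inner p x (h.J p y) = 0

/-- `M` is an `AH₃`-manifold: `R(X, Y, Z, U) = R(JX, JY, JZ, JU)`. -/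
def IsAH3 : Prop :=
  ∀ (p : M) (x y z u : TangentSpace 𝓘(ℝ, V) p),
    h.R p x y z u = h.R p (h.J p x) (h.J p y) (h.J p z) (h.J p u)

/-- `M` has pointwise constant antiholomorphic sectional curvature. -/
def HasPointwiseConstantAntiholomorphicCurvature : Prop :=
  ∃ ν : M → ℝ, ∀ (p : M) (α : Submodule ℝ (TangentSpace 𝓘(ℝ, V) p)),
    h.IsAntiholomorphicPlane p α → h.HasPlaneCurvature p α (ν p)

/-- `M` is a Kähler manifold: `∇J = 0`. -/
def IsKaehler : Prop :=
  ∀ (p : M) (x y : TangentSpace 𝓘(ℝ, V) p), h.nablaJ p x y = 0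

/-- `M` is a real space form: it has constant sectional curvature. -/
def IsRealSpaceForm : Prop :=
  ∃ c : ℝ, ∀ (p : M) (α : Submodule ℝ (TangentSpace 𝓘(ℝ, V) p)),
    finrank ℝ α = 2 → h.HasPlaneCurvature p α c

/-- `M` is a complex space form: a Kähler manifold of constant holomorphic sectional curvature. -/
def IsComplexSpaceForm : Prop :=
  h.IsKaehler ∧ ∃ c : ℝ, ∀ (p : M) (α : Submodule ℝ (TangentSpace 𝓘(ℝ, V) p)),
    h.IsHolomorphicPlane p α → h.HasPlaneCurvature p α c

end AlmostHermitianStructure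

end

/-!
# Almost Hermitian manifolds of pointwise constant antiholomorphic sectional curvature

Let `F(x, y) = g(x, J y)` be the fundamental form, `π₁` the curvature tensor of a space of constant
curvature `1` (`constCurv`) and `ψ(F, Φ)` the curvature tensor built from two `2`-forms
(`twoFormCurv`), whose sectional curvatures are `6 F(x, y) Φ(x, y)`.

*Algebra.* At a point, `R - ν π₁` vanishes on antiholomorphic planes, that is on all pairs with
`F(x, y) = 0`. Hence its sectional curvature is divisible by `F(x, y)`, and there is a `J`-invariant
`2`-form `Φ` with `R = ν π₁ + ψ(F, Φ)` (`exists_secondForm`). The aim is to show that `Φ = c F` with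
constant `c` and `ν`.

*First order.* `Φ` is diagonal in a unitary basis. The second Bianchi identity for
`ν π₁ + ψ(F, Φ)` is a linear system in `dν`, `∇F` and `∇Φ` (`IsBianchiSystem`). If all eigenvalues
of `Φ` are equal, that is `Φ = c F`, it gives `dν = 0`, `dc = 0` and `c ∇F = 0`
(`IsBianchiSystem.proportional`). Otherwise it gives `dF = 0` (`IsBianchiSystem.S_cyclic`), and if
moreover `∇F ≠ 0`, then all eigenvalues but one coincide and `∇F` pairs the exceptional complex line
with its orthogonal complement (`IsBianchiSystem.exists_exceptional_line`).

*Second order.* On the open set where `Φ` is not a multiple of `F`, the form `dF` vanishes, so that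
the cyclic sums of `∇²F` vanish as well. The Ricci identity expresses the antisymmetric part of
`∇²F` by the curvature, and one contraction yields `q_a + q_b = ν` for the eigenvalues of `Φ` on two
orthogonal lines, provided that some components of `∇²F` vanish
(`LocalGeometry.IsTwoFormModel.add_eigenvalues_eq`). If `∇F = 0` on the open set, this is clear, and
`q_a + q_b = ν` for all pairs of lines makes all eigenvalues equal. If `∇F ≠ 0` at a point, the
`2`-forms `∇_w F` span two dimensions there and at most two at all nearby points. The derivative of
a vanishing `3 × 3` minor shows that the components needed vanish for a suitable vector `a`
orthogonal to the exceptional line. This gives `2 r = ν = r + q` for the multiple eigenvalue `r` and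
the exceptional eigenvalue `q`, a contradiction. So the open set is empty
(`LocalGeometry.IsTwoFormModel.isProportional`).

All this is carried out on a ball in `V` with a variable metric. Covariant derivatives along lines
are computed as derivatives at `0` of expressions in vector fields with vanishing covariant
derivative at the origin of the line (`LocalGeometry.parallelJet`), which makes the metric behave
like a constant.

*Globalization.* Curvature tensors read in different charts agree, because the transition maps are
local isometries (`LocalGeometry.IsLocalIsometry.map_curvature`). So the constants `ν` and `c` found
in the charts are locally constant on `M`, hence constant. If `c = 0`, the sectional curvature is
`ν`; otherwise `∇J = 0` and the holomorphic sectional curvature is `ν + 6 c`.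
-/

section

set_option maxSynthPendingDepth 3
set_option synthInstance.maxHeartbeats 100000

/-! ### Algebraic curvature tensors on a Hermitian vector space -/

section Algebra

variable {V : Type*} [NormedAddCommGroup V] [NormedSpace ℝ V]

/-- `(g, J)` is a Hermitian structure on `V`: `g` is a scalar product and `J` is a `g`-orthogonal
complex structure. -/
structure IsHermitianPair (g : V →L[ℝ] V →L[ℝ] ℝ) (J : V →L[ℝ] V) : Prop where
  symm : ∀ x y, g x y = g y x
  pos : ∀ x, x ≠ 0 → 0 < g x x
  J_J : ∀ x, J (J x) = -x
  g_J_J : ∀ x y, g (J x) (J y) = g x y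

namespace IsHermitianPair

variable {g : V →L[ℝ] V →L[ℝ] ℝ} {J : V →L[ℝ] V} (hg : IsHermitianPair g J)
include hg

theorem g_J_left (x y : V) : g (J x) y = -g x (J y) := by
  have := hg.g_J_J x (J y)
  rw [hg.J_J, map_neg] at this
  linarith

theorem g_J_self (x : V) : g x (J x) = 0 := by
  have := hg.g_J_left x x
  have := hg.symm x (J x)
  linarith

theorem eq_zero_of_g_self {x : V} (h : g x x = 0) : x = 0 := by
  by_contra hx
  exact (hg.pos x hx).ne' h

end IsHermitianPair

/-- An algebraic curvature tensor: a quadrilinear form with the symmetries of the curvature of a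
Riemannian metric. Linearity in the first argument implies linearity in the others. -/
structure IsCurvatureLike (R : V → V → V → V → ℝ) : Prop where
  add_left : ∀ x x' y z u, R (x + x') y z u = R x y z u + R x' y z u
  smul_left : ∀ (c : ℝ) x y z u, R (c • x) y z u = c * R x y z u
  skew : ∀ x y z u, R x y z u = -R y x z u
  skew' : ∀ x y z u, R x y z u = -R x y u z
  bianchi : ∀ x y z u, R x y z u + R y z x u + R z x y u = 0

namespace IsCurvatureLike

variable {R T : V → V → V → V → ℝ}

theorem pair_symm (h : IsCurvatureLike R) (x y z u : V) : R x y z u = R z u x y := by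
  have b1 := h.bianchi x y z u
  have b2 := h.bianchi y z u x
  have b3 := h.bianchi z u x y
  have b4 := h.bianchi u x y z
  have := h.skew x y z u
  have := h.skew' x y z u
  have := h.skew' y x z u
  have := h.skew y z x u
  have := h.skew' y z x u
  have := h.skew' z y x u
  have := h.skew z x y u
  have := h.skew' z x y u
  have := h.skew' x z y u
  have := h.skew z u x y
  have := h.skew' z u x y
  have := h.skew' u z x y
  have := h.skew u x y z
  have := h.skew' u x y z
  have := h.skew' x u y z
  have := h.skew u y z x
  have := h.skew' u y z x
  have := h.skew' y u z x
  have := h.skew y u x z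
  have := h.skew' y u x z
  linarith

theorem add_two (h : IsCurvatureLike R) (x y y' z u : V) :
    R x (y + y') z u = R x y z u + R x y' z u := by
  rw [h.skew, h.add_left, h.skew y, h.skew y']
  ring

theorem smul_two (h : IsCurvatureLike R) (c : ℝ) (x y z u : V) :
    R x (c • y) z u = c * R x y z u := by
  rw [h.skew, h.smul_left, h.skew y]
  ring

theorem add_three (h : IsCurvatureLike R) (x y z z' u : V) :
    R x y (z + z') u = R x y z u + R x y z' u := by
  rw [h.pair_symm, h.add_left, h.pair_symm z, h.pair_symm z']

theorem smul_three (h : IsCurvatureLike R) (c : ℝ) (x y z u : V) :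
    R x y (c • z) u = c * R x y z u := by
  rw [h.pair_symm, h.smul_left, h.pair_symm z]

theorem add_four (h : IsCurvatureLike R) (x y z u u' : V) :
    R x y z (u + u') = R x y z u + R x y z u' := by
  rw [h.skew', h.add_three, h.skew' x y u, h.skew' x y u']
  ring

theorem smul_four (h : IsCurvatureLike R) (c : ℝ) (x y z u : V) :
    R x y z (c • u) = c * R x y z u := by
  rw [h.skew', h.smul_three, h.skew' x y u]
  ring

theorem self_left (h : IsCurvatureLike R) (x z u : V) : R x x z u = 0 := by
  have := h.skew x x z u
  linarith

/-- `R(x, y, z, x)` is symmetric in `y` and `z`. -/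
theorem swap_mid (h : IsCurvatureLike R) (x y z : V) : R x y z x = R x z y x := by
  rw [h.pair_symm, h.skew, h.skew']
  ring

theorem sub (hR : IsCurvatureLike R) (hT : IsCurvatureLike T) :
    IsCurvatureLike (fun x y z u ↦ R x y z u - T x y z u) where
  add_left x x' y z u := by rw [hR.add_left, hT.add_left]; ring
  smul_left c x y z u := by rw [hR.smul_left, hT.smul_left]; ring
  skew x y z u := by rw [hR.skew, hT.skew]; ring
  skew' x y z u := by rw [hR.skew', hT.skew']; ring
  bianchi x y z u := by linarith [hR.bianchi x y z u, hT.bianchi x y z u]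

/-- An algebraic curvature tensor is determined by its sectional curvatures. -/
theorem eq_zero_of_sectional (h : IsCurvatureLike R) (h0 : ∀ x y, R x y y x = 0) (x y z u : V) :
    R x y z u = 0 := by
  have h1 : ∀ x y z, R x y z x = 0 := fun x y z ↦ by
    have h2 := h0 x (y + z)
    rw [h.add_two, h.add_three, h.add_three, h0, h0, h.swap_mid x z y] at h2
    linarith
  have h2 : ∀ x y z u, R x y z u = -R u y z x := fun x y z u ↦ by
    have h3 := h1 (x + u) y z
    rw [h.add_left, h.add_four, h.add_four, h1, h1] at h3
    linarith
  -- `R` is skew in all pairs of arguments, so that the first Bianchi identity reads `3 R = 0`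
  have e1 : R y z x u = R x y z u := by
    rw [h.skew y z x u, h2 z y x u, h.skew' u y x z, h2 u y z x]
    ring
  have e2 : R z x y u = R x y z u := by
    rw [h2 z x y u, h.skew' u x y z, h2 u x z y, h.skew y x z u]
    ring
  linarith [h.bianchi x y z u]

end IsCurvatureLike

/-- The curvature tensor `π₁` of a space of constant sectional curvature `1`. -/
noncomputable def constCurv (g : V →L[ℝ] V →L[ℝ] ℝ) (x y z u : V) : ℝ :=
  g x u * g y z - g x z * g y u

/-- The curvature tensor associated with a pair of `2`-forms. Its sectional curvatures are
`6 F(x, y) Φ(x, y)`. -/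
noncomputable def twoFormCurv (F Φ : V → V → ℝ) (x y z u : V) : ℝ :=
  F x u * Φ y z - F x z * Φ y u - 2 * F x y * Φ z u
    + F y z * Φ x u - F y u * Φ x z - 2 * F z u * Φ x y

/-- The fundamental `2`-form `F(x, y) = g(x, J y)`. -/
noncomputable def fundForm (g : V →L[ℝ] V →L[ℝ] ℝ) (J : V →L[ℝ] V) : V →L[ℝ] V →L[ℝ] ℝ :=
  (ContinuousLinearMap.precomp ℝ J) ∘L g

@[simp]
theorem fundForm_apply (g : V →L[ℝ] V →L[ℝ] ℝ) (J : V →L[ℝ] V) (x y : V) :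
    fundForm g J x y = g x (J y) := rfl

theorem IsHermitianPair.fundForm_skew {g : V →L[ℝ] V →L[ℝ] ℝ} {J : V →L[ℝ] V}
    (hg : IsHermitianPair g J) (x y : V) : fundForm g J x y = -fundForm g J y x := by
  rw [fundForm_apply, fundForm_apply, hg.symm y, hg.g_J_left]
  ring

theorem isCurvatureLike_constCurv {g : V →L[ℝ] V →L[ℝ] ℝ} (hs : ∀ x y, g x y = g y x) (ν : ℝ) :
    IsCurvatureLike (fun x y z u ↦ ν * constCurv g x y z u) where
  add_left x x' y z u := by simp [constCurv]; ring
  smul_left c x y z u := by simp [constCurv]; ring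
  skew x y z u := by simp [constCurv]; ring
  skew' x y z u := by simp [constCurv]; ring
  bianchi x y z u := by simp [constCurv, hs z, hs y x]; ring

theorem isCurvatureLike_twoFormCurv {F Φ : V →L[ℝ] V →L[ℝ] ℝ} (hF : ∀ x y, F x y = -F y x)
    (hΦ : ∀ x y, Φ x y = -Φ y x) :
    IsCurvatureLike (twoFormCurv (fun x y ↦ F x y) fun x y ↦ Φ x y) where
  add_left x x' y z u := by simp [twoFormCurv]; ring
  smul_left c x y z u := by simp [twoFormCurv]; ring
  skew x y z u := by simp only [twoFormCurv, hF y x, hΦ y x]; ring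
  skew' x y z u := by simp only [twoFormCurv, hF u z, hΦ u z]; ring
  bianchi x y z u := by
    simp only [twoFormCurv, hF y x, hΦ y x, hF z x, hΦ z x, hF z y, hΦ z y]; ring

section Structure

variable {g : V →L[ℝ] V →L[ℝ] ℝ} {J : V →L[ℝ] V} {R : V → V → V → V → ℝ}

/-- The value at `(x, z)` of the `2`-form `Φ` with `R = ν π₁ + ψ(F, Φ)`, recovered from the
components `R(x, J x, J x, x)` and `R(x, J x, z, x)`. It is `0` for `x = 0`. -/
noncomputable def secondForm (g : V →L[ℝ] V →L[ℝ] ℝ) (J : V →L[ℝ] V) (R : V → V → V → V → ℝ)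
    (ν : ℝ) (x z : V) : ℝ :=
  -(g x (J z) * ((R x (J x) (J x) x - ν * constCurv g x (J x) (J x) x) / (6 * g x x))
    + (R x (J x) z x - ν * constCurv g x (J x) z x) / 3) / g x x

theorem secondForm_linear_right (hR : IsCurvatureLike R) (ν : ℝ) (x z z' : V) (c : ℝ) :
    secondForm g J R ν x (z + z') = secondForm g J R ν x z + secondForm g J R ν x z' ∧
    secondForm g J R ν x (c • z) = c * secondForm g J R ν x z := by
  constructor
  · simp only [secondForm, constCurv, hR.add_three, map_add, add_div, neg_div]
    ring
  · simp only [secondForm, constCurv, hR.smul_three, map_smul, smul_eq_mul]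
    ring

/-- If the sectional curvatures `R(x, y, y, x)` vanish on all pairs with `F(x, y) = 0`, then
`R(x, y, y, x) = 6 F(x, y) Φ(x, y)`: for fixed `x` this quadratic form in `y` vanishes on the
hyperplane `F(x, y) = 0`. -/
theorem sectional_eq_of_antiholomorphic (hg : IsHermitianPair g J) (hR : IsCurvatureLike R)
    (h0 : ∀ x y, g x (J y) = 0 → R x y y x = 0) (x y : V) :
    R x y y x = 6 * g x (J y) *
      (-(g x (J y) * (R x (J x) (J x) x / (6 * g x x)) + R x (J x) y x / 3) / g x x) := by
  rcases eq_or_ne x 0 with rfl | hx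
  · have := hR.smul_left 0 0 y y 0
    simp only [zero_smul, zero_mul] at this
    simp [this]
  have hxx := (hg.pos x hx).ne'
  -- `y + c J x` lies in the hyperplane
  obtain ⟨c, hcx⟩ : ∃ c : ℝ, g x (J y) = c * g x x := ⟨g x (J y) / g x x, by field_simp⟩
  have key := h0 x (y + c • J x) (by
    rw [map_add, map_smul, hg.J_J, map_add, map_smul, map_neg, hcx, smul_eq_mul]
    ring)
  simp only [hR.add_two, hR.add_three, hR.smul_two, hR.smul_three, hR.swap_mid x y (J x)] at key
  rw [hcx]
  field_simp
  linear_combination 3 * key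

/-- If `F(x, y) ≠ 0`, this is the symmetry of `R(x, y, y, x)` in `x` and `y`. -/
theorem secondForm_skew (hg : IsHermitianPair g J) (hR : IsCurvatureLike R) {ν : ℝ}
    (h0 : ∀ x y, g x (J y) = 0 → R x y y x = ν * constCurv g x y y x) (x y : V) :
    secondForm g J R ν x y = -secondForm g J R ν y x := by
  rcases eq_or_ne x 0 with rfl | hx
  · have := (secondForm_linear_right (g := g) (J := J) hR ν y 0 0 0).2
    simp only [zero_smul, zero_mul] at this
    rw [this]
    simp [secondForm]
  rcases eq_or_ne y 0 with rfl | hy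
  · have := (secondForm_linear_right (g := g) (J := J) hR ν x 0 0 0).2
    simp only [zero_smul, zero_mul] at this
    rw [this]
    simp [secondForm]
  have hxx := (hg.pos x hx).ne'
  have hyy := (hg.pos y hy).ne'
  obtain ⟨R₀, hR₀⟩ : ∃ R₀ : V → V → V → V → ℝ,
    R₀ = fun x y z u ↦ R x y z u - ν * constCurv g x y z u := ⟨_, rfl⟩
  have hc : IsCurvatureLike R₀ := hR₀ ▸ hR.sub (isCurvatureLike_constCurv hg.symm ν)
  have h0' : ∀ x y, g x (J y) = 0 → R₀ x y y x = 0 := fun x y h ↦ by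
    simp [hR₀, h0 x y h]
  have hs : ∀ x z, secondForm g J R ν x z =
      -(g x (J z) * (R₀ x (J x) (J x) x / (6 * g x x)) + R₀ x (J x) z x / 3) / g x x := by
    intro x z; simp [secondForm, hR₀]
  have hF : g y (J x) = -g x (J y) := by rw [← hg.g_J_left, hg.symm]
  by_cases hxy : g x (J y) = 0
  · -- the pairs `(x + s |x|² J y, y + s |y|² J x)` are antiholomorphic for all `s`; the coefficient
    -- of `s` in their sectional curvature is the assertion
    have key : ∀ s : ℝ, R₀ (x + (s * g x x) • J y) (y + (s * g y y) • J x)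
        (y + (s * g y y) • J x) (x + (s * g x x) • J y) = 0 := by
      intro s
      apply h0'
      simp only [map_add, map_smul, hg.J_J, map_neg, add_apply,
        smul_apply, smul_eq_mul, hg.g_J_J, hg.g_J_left, hxy,
        hF]
      ring
    have k1 := key 1
    have k2 := key (-1)
    have k3 := key 2
    have k4 := key (-2)
    simp only [hc.add_left, hc.add_two, hc.add_three, hc.add_four, hc.smul_left, hc.smul_two,
      hc.smul_three, hc.smul_four] at k1 k2 k3 k4
    have e1 : R₀ x y y (J y) = R₀ y (J y) x y := hc.pair_symm _ _ _ _
    have e2 : R₀ (J y) y y x = R₀ y (J y) x y := by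
      rw [hc.skew, hc.skew']; ring
    have e3 := hc.swap_mid x y (J x)
    have key2 : g x x * R₀ y (J y) x y + g y y * R₀ x (J x) y x = 0 := by
      rw [e1, e2, e3] at k1 k2 k3 k4
      linarith
    rw [hs, hs, hxy, hF, hxy]
    simp only [zero_mul, neg_zero, zero_add]
    field_simp
    linear_combination -key2
  · have k1 := sectional_eq_of_antiholomorphic hg hc h0' x y
    have k2 := sectional_eq_of_antiholomorphic hg hc h0' y x
    rw [← hs] at k1 k2
    have k3 : R₀ x y y x = R₀ y x x y := by rw [hc.pair_symm]
    rw [k1, k2, hF] at k3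
    apply mul_left_cancel₀ hxy
    linarith

theorem secondForm_J_J (hg : IsHermitianPair g J)
    (hJ : ∀ x y z u, R (J x) (J y) (J z) (J u) = R x y z u) (ν : ℝ) (x y : V) :
    secondForm g J R ν (J x) (J y) = secondForm g J R ν x y := by
  have h1 : ∀ a b, g (J a) (J b) = g a b := hg.g_J_J
  unfold secondForm constCurv
  rw [hJ x (J x) y x, hJ x (J x) (J x) x]
  simp only [h1]

/-- An algebraic curvature tensor with constant antiholomorphic sectional curvature `ν` is of the
form `ν π₁ + ψ(F, Φ)` for a `2`-form `Φ`. -/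
theorem exists_secondForm [FiniteDimensional ℝ V] (hg : IsHermitianPair g J)
    (hR : IsCurvatureLike R) {ν : ℝ}
    (hJ : ∀ x y z u, R (J x) (J y) (J z) (J u) = R x y z u)
    (h0 : ∀ x y, g x (J y) = 0 → R x y y x = ν * constCurv g x y y x) :
    ∃ Φ : V →L[ℝ] V →L[ℝ] ℝ, (∀ x y, Φ x y = secondForm g J R ν x y) ∧
      (∀ x y, Φ x y = -Φ y x) ∧ (∀ x y, Φ (J x) (J y) = Φ x y) ∧
      ∀ x y z u, R x y z u = ν * constCurv g x y z u +
        twoFormCurv (fun x y ↦ fundForm g J x y) (fun x y ↦ Φ x y) x y z u := by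
  have hadd := fun x z z' ↦ (secondForm_linear_right (g := g) (J := J) hR ν x z z' 0).1
  have hsmul := fun c x z ↦ (secondForm_linear_right (g := g) (J := J) hR ν x z z c).2
  have hskew := secondForm_skew hg hR h0
  let B : V →ₗ[ℝ] V →ₗ[ℝ] ℝ := LinearMap.mk₂ ℝ (secondForm g J R ν)
    (fun x x' y ↦ by rw [hskew, hadd, hskew x, hskew x']; ring)
    (fun c x y ↦ by rw [hskew, hsmul, hskew x, smul_eq_mul]; ring)
    hadd (fun c x y ↦ hsmul c x y)
  let Φ : V →L[ℝ] V →L[ℝ] ℝ :=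
    LinearMap.toContinuousLinearMap (LinearMap.toContinuousLinearMap.toLinearMap ∘ₗ B)
  have hΦ : ∀ x y, Φ x y = secondForm g J R ν x y := fun x y ↦ rfl
  have hΦs : ∀ x y, Φ x y = -Φ y x := hskew
  refine ⟨Φ, hΦ, hΦs, fun x y ↦ ?_, fun x y z u ↦ ?_⟩
  · rw [hΦ, hΦ, secondForm_J_J hg hJ]
  · have hc := hR.sub (isCurvatureLike_constCurv hg.symm ν)
    have hT := isCurvatureLike_twoFormCurv hg.fundForm_skew hΦs
    -- both sides have the same sectional curvatures
    have := (hc.sub hT).eq_zero_of_sectional (fun x y ↦ by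
      have h1 := sectional_eq_of_antiholomorphic hg hc
        (fun x y h ↦ by simp [h0 x y h]) x y
      have h2 : twoFormCurv (fun x y ↦ fundForm g J x y) (fun x y ↦ Φ x y) x y y x
          = 6 * g x (J y) * Φ x y := by
        have h3 : ∀ z, fundForm g J z z = 0 := hg.g_J_self
        simp only [twoFormCurv, hg.fundForm_skew y x, hΦs y x, h3]
        rw [fundForm_apply]
        ring
      rw [h1, h2, hΦ, secondForm]
      ring) x y z u
    linarith

end Structure

end Algebra

/-! ### Simultaneous diagonalization of two `2`-forms -/

/-- A `J`-invariant `2`-form `Φ` on a Hermitian vector space is diagonal in a unitary basis: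
`V` is a complex inner product space, on which `Φ` is the imaginary part of a Hermitian form. -/
theorem exists_unitary_eigenbasis {V : Type*} [AddCommGroup V] [Module ℝ V]
    [FiniteDimensional ℝ V] (g : V →ₗ[ℝ] V →ₗ[ℝ] ℝ) (J : V →ₗ[ℝ] V)
    (hsymm : ∀ x y, g x y = g y x) (hpos : ∀ x, x ≠ 0 → 0 < g x x) (hJ : ∀ x, J (J x) = -x)
    (hgJ : ∀ x y, g (J x) (J y) = g x y) (Φ : V →ₗ[ℝ] V →ₗ[ℝ] ℝ) (hΦ : ∀ x y, Φ x y = -Φ y x)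
    (hΦJ : ∀ x y, Φ (J x) (J y) = Φ x y) :
    ∃ (n : ℕ) (e : Fin n → V) (q : Fin n → ℝ), finrank ℝ V = 2 * n ∧
      (∀ i, g (e i) (e i) = 1) ∧ (∀ i j, i ≠ j → g (e i) (e j) = 0 ∧ g (e i) (J (e j)) = 0) ∧
      (∀ i v, Φ (e i) v = q i * g (e i) (J v)) ∧
      ∀ v, v = ∑ i, (g (e i) v • e i + g (J (e i)) v • J (e i)) := by
  have hJl : ∀ x y, g (J x) y = -g x (J y) := fun x y ↦ by
    have := hgJ x (J y)
    rw [hJ, map_neg] at this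
    linarith
  have hJJ : J * J = -1 := by ext x; simp [hJ]
  -- `J` turns `V` into a complex vector space
  let φ : ℂ →ₐ[ℝ] Module.End ℝ V := Complex.lift ⟨J, hJJ⟩
  let : Module ℂ V := Module.compHom V φ.toRingHom
  have hsmul : ∀ (z : ℂ) (v : V), z • v = z.re • v + z.im • J v := fun z v ↦ by
    change φ z v = _
    simp [φ, Complex.liftAux_apply, Module.algebraMap_end_apply]
  have : IsScalarTower ℝ ℂ V := ⟨fun r z v ↦ by
    rw [hsmul, hsmul]; simp [mul_smul]⟩
  have : FiniteDimensional ℂ V := Module.Finite.of_restrictScalars_finite ℝ ℂ V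
  let core : InnerProductSpace.Core ℂ V :=
    { inner := fun x y ↦ ⟨g x y, -g x (J y)⟩
      conj_inner_symm := fun x y ↦ by
        apply Complex.ext
        · simp [hsymm x y]
        · simp only [Complex.conj_im, neg_neg]
          rw [← hJl, hsymm]
      re_inner_nonneg := fun x ↦ by
        rcases eq_or_ne x 0 with rfl | hx
        · simp
        · exact (hpos x hx).le
      add_left := fun x y z ↦ by
        apply Complex.ext <;> simp
        ring
      smul_left := fun x y r ↦ by
        apply Complex.ext
        · simp [hsmul, hJl]
          ring
        · simp [hsmul, hJl, hJ]
          ring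
      definite := fun x hx ↦ by
        by_contra h
        have := congrArg Complex.re hx
        exact (hpos x h).ne' this }
  let : NormedAddCommGroup V := core.toNormedAddCommGroup
  let : InnerProductSpace ℂ V := InnerProductSpace.ofCore core.toCore
  have hinner : ∀ x y : V, inner ℂ x y = (⟨g x y, -g x (J y)⟩ : ℂ) := fun x y ↦ rfl
  -- the endomorphism `A` with `g(A x, y) = Φ(y, J x)` is Hermitian
  have hnd : LinearMap.BilinForm.Nondegenerate g := by
    constructor
    · intro x hx
      by_contra h
      exact (hpos x h).ne' (hx x)
    · intro x hx
      by_contra h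
      exact (hpos x h).ne' (hx x)
  let A₀ : V →ₗ[ℝ] V := LinearMap.BilinForm.symmCompOfNondegenerate (-(Φ.compl₂ J)) g hnd
  have hA₀ : ∀ x y, g (A₀ x) y = -Φ x (J y) := fun x y ↦
    LinearMap.BilinForm.symmCompOfNondegenerate_left_apply _ hnd y x
  have hAJ : ∀ x, A₀ (J x) = J (A₀ x) := fun x ↦ by
    have h : ∀ y, g (A₀ (J x) - J (A₀ x)) y = 0 := fun y ↦ by
      rw [map_sub, LinearMap.sub_apply, hA₀, hJl, hA₀, hΦJ, hJ, map_neg]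
      ring
    by_contra hne
    exact (hpos _ (sub_ne_zero.mpr hne)).ne' (h _)
  have hAs : ∀ x y, g (A₀ x) y = g x (A₀ y) := fun x y ↦ by
    rw [hA₀, hsymm, hA₀, ← hΦJ x, hJ, map_neg, hΦ (J x)]
    ring
  let A : V →ₗ[ℂ] V :=
    { toFun := A₀
      map_add' := A₀.map_add
      map_smul' := fun z x ↦ by
        simp only [hsmul, map_add, map_smul, hAJ, RingHom.id_apply] }
  have hA : A.IsSymmetric := fun x y ↦ by
    change inner ℂ (A₀ x) y = inner ℂ x (A₀ y)
    rw [hinner, hinner, hAs, hAs, hAJ]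
  let b := hA.eigenvectorBasis rfl
  have hb : ∀ i j, inner ℂ (b i) (b j) = if i = j then (1 : ℂ) else 0 :=
    orthonormal_iff_ite.mp b.orthonormal
  refine ⟨finrank ℂ V, fun i ↦ b i, hA.eigenvalues rfl, ?_, fun i ↦ ?_, fun i j hij ↦ ?_,
    fun i v ↦ ?_, fun v ↦ ?_⟩
  · rw [← Module.finrank_mul_finrank ℝ ℂ V, Complex.finrank_real_complex]
  · have := congrArg Complex.re (hb i i)
    rw [hinner] at this
    simpa using this
  · have := hb i j
    rw [hinner, if_neg hij] at this
    have h1 := congrArg Complex.re this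
    have h2 := congrArg Complex.im this
    exact ⟨by simpa using h1, by simpa using h2⟩
  · have h1 : A₀ (b i) = (hA.eigenvalues rfl i : ℂ) • b i := hA.apply_eigenvectorBasis rfl i
    have h2 := hA₀ (b i) (J v)
    rw [h1, hsmul, hJ, map_neg] at h2
    simp only [Complex.ofReal_re, Complex.ofReal_im, zero_smul, add_zero, map_smul,
      LinearMap.smul_apply, smul_eq_mul, neg_neg] at h2
    exact h2.symm
  · conv_lhs => rw [← b.sum_repr' v]
    refine Finset.sum_congr rfl fun i _ ↦ ?_
    rw [hinner, hsmul, hJl]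

/-- A unitary basis of `V` in which the `2`-form `Φ` is diagonal, `q i` being its eigenvalues
relative to the fundamental form. -/
structure IsUnitaryEigenbasis {V : Type*} [NormedAddCommGroup V] [NormedSpace ℝ V]
    (g : V →L[ℝ] V →L[ℝ] ℝ) (J : V →L[ℝ] V) (Φ : V →L[ℝ] V →L[ℝ] ℝ) {n : ℕ} (e : Fin n → V)
    (q : Fin n → ℝ) : Prop where
  norm : ∀ i, g (e i) (e i) = 1
  orth : ∀ i j, i ≠ j → g (e i) (e j) = 0
  orth_J : ∀ i j, i ≠ j → g (e i) (J (e j)) = 0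
  eig : ∀ i v, Φ (e i) v = q i * g (e i) (J v)
  expand : ∀ v, v = ∑ i, (g (e i) v • e i + g (J (e i)) v • J (e i))

theorem IsHermitianPair.exists_unitaryEigenbasis {V : Type*} [NormedAddCommGroup V]
    [NormedSpace ℝ V] [FiniteDimensional ℝ V] {g : V →L[ℝ] V →L[ℝ] ℝ} {J : V →L[ℝ] V}
    (hg : IsHermitianPair g J) {n : ℕ} (hn : finrank ℝ V = 2 * n) {Φ : V →L[ℝ] V →L[ℝ] ℝ}
    (hΦ : ∀ x y, Φ x y = -Φ y x) (hΦJ : ∀ x y, Φ (J x) (J y) = Φ x y) :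
    ∃ (e : Fin n → V) (q : Fin n → ℝ), IsUnitaryEigenbasis g J Φ e q := by
  obtain ⟨n', e, q, h0, h1, h2, h3, h4⟩ := exists_unitary_eigenbasis
    (ContinuousLinearMap.coeLM ℝ ∘ₗ g.toLinearMap) J.toLinearMap hg.symm hg.pos hg.J_J hg.g_J_J
    (ContinuousLinearMap.coeLM ℝ ∘ₗ Φ.toLinearMap) hΦ hΦJ
  obtain rfl : n' = n := by omega
  exact ⟨e, q, h1, fun i j h ↦ (h2 i j h).1, fun i j h ↦ (h2 i j h).2, h3, h4⟩

/-! ### The second Bianchi identity for curvature tensors of the form `ν π₁ + ψ(F, Φ)` -/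

section FirstOrder

set_option linter.unusedSimpArgs false

variable {V : Type*} [NormedAddCommGroup V] [NormedSpace ℝ V]

/-- `x` is a unit eigenvector of the `2`-form `Φ` relative to the fundamental form, with
eigenvalue `q`. -/
structure IsUnitEigenvector (g : V →L[ℝ] V →L[ℝ] ℝ) (J : V →L[ℝ] V) (Φ : V →L[ℝ] V →L[ℝ] ℝ)
    (x : V) (q : ℝ) : Prop where
  norm : g x x = 1
  eig : ∀ v, Φ x v = q * g x (J v)

/-- `x` is orthogonal to the complex line through `y`. -/
def IsComplexOrthogonal (g : V →L[ℝ] V →L[ℝ] ℝ) (J : V →L[ℝ] V) (x y : V) : Prop :=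
  g x y = 0 ∧ g x (J y) = 0

/-- The conditions imposed at a point on the covariant derivatives `S = ∇F`, `P = ∇Φ` and
`n = dν` by the second Bianchi identity for `ν π₁ + ψ(F, Φ)`, by `J² = -1` and by the
`J`-invariance of `Φ`. -/
structure IsBianchiSystem (g : V →L[ℝ] V →L[ℝ] ℝ) (J : V →L[ℝ] V) (Φ : V →L[ℝ] V →L[ℝ] ℝ)
    (S P : V →ₗ[ℝ] V →ₗ[ℝ] V →ₗ[ℝ] ℝ) (n : V →ₗ[ℝ] ℝ) : Prop where
  herm : IsHermitianPair g J
  Φ_skew : ∀ x y, Φ x y = -Φ y x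
  Φ_J : ∀ x y, Φ (J x) (J y) = Φ x y
  S_skew : ∀ w x y, S w x y = -S w y x
  P_skew : ∀ w x y, P w x y = -P w y x
  S_J : ∀ w x y, S w (J x) (J y) = -S w x y
  P_J : ∃ N : V → V → V, (∀ w x y, S w x y = g x (N w y)) ∧
    ∀ w x y, P w (J x) (J y) = P w x y - (Φ (N w x) (J y) + Φ (J x) (N w y))
  bianchi : ∀ w x y z u,
    (n w * constCurv g x y z u + twoFormCurv (fun a b ↦ S w a b) (fun a b ↦ Φ a b) x y z u
      + twoFormCurv (fun a b ↦ fundForm g J a b) (fun a b ↦ P w a b) x y z u)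
    + (n x * constCurv g y w z u + twoFormCurv (fun a b ↦ S x a b) (fun a b ↦ Φ a b) y w z u
      + twoFormCurv (fun a b ↦ fundForm g J a b) (fun a b ↦ P x a b) y w z u)
    + (n y * constCurv g w x z u + twoFormCurv (fun a b ↦ S y a b) (fun a b ↦ Φ a b) w x z u
      + twoFormCurv (fun a b ↦ fundForm g J a b) (fun a b ↦ P y a b) w x z u) = 0

section Eigen

variable {g : V →L[ℝ] V →L[ℝ] ℝ} {J : V →L[ℝ] V} {Φ : V →L[ℝ] V →L[ℝ] ℝ} {x y : V} {q : ℝ}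

theorem IsUnitEigenvector.J_apply (hg : IsHermitianPair g J) (hΦJ : ∀ x y, Φ (J x) (J y) = Φ x y)
    (hx : IsUnitEigenvector g J Φ x q) : IsUnitEigenvector g J Φ (J x) q where
  norm := by rw [hg.g_J_J, hx.norm]
  eig v := by
    have : v = J (-J v) := by rw [map_neg, hg.J_J, neg_neg]
    conv_lhs => rw [this, hΦJ, hx.eig]
    rw [map_neg, hg.J_J, neg_neg, hg.g_J_J]

theorem IsComplexOrthogonal.symm (hg : IsHermitianPair g J) (h : IsComplexOrthogonal g J x y) :
    IsComplexOrthogonal g J y x :=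
  ⟨by rw [hg.symm, h.1], by rw [hg.symm, hg.g_J_left, h.2, neg_zero]⟩

theorem IsComplexOrthogonal.J_right (hg : IsHermitianPair g J)
    (h : IsComplexOrthogonal g J x y) : IsComplexOrthogonal g J x (J y) :=
  ⟨h.2, by rw [hg.J_J, map_neg, h.1, neg_zero]⟩

theorem IsComplexOrthogonal.J_left (hg : IsHermitianPair g J)
    (h : IsComplexOrthogonal g J x y) : IsComplexOrthogonal g J (J x) y :=
  ((h.symm hg).J_right hg).symm hg

end Eigen

namespace IsBianchiSystem

variable {g : V →L[ℝ] V →L[ℝ] ℝ} {J : V →L[ℝ] V} {Φ : V →L[ℝ] V →L[ℝ] ℝ}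
  {S P : V →ₗ[ℝ] V →ₗ[ℝ] V →ₗ[ℝ] ℝ} {n : V →ₗ[ℝ] ℝ} (h : IsBianchiSystem g J Φ S P n)
  {x y z u : V} {qx qy qz qu : ℝ}
include h

theorem S_self (w x : V) : S w x x = 0 := by
  have := h.S_skew w x x
  linarith

theorem P_self (w x : V) : P w x x = 0 := by
  have := h.P_skew w x x
  linarith

theorem S_J_left (w x y : V) : S w (J x) y = S w x (J y) := by
  have := h.S_J w x (J y)
  rw [h.herm.J_J, map_neg] at this
  linarith

theorem S_J_self (w x : V) : S w x (J x) = 0 := by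
  have h1 := h.S_J_left w x x
  have h2 := h.S_skew w x (J x)
  linarith

theorem P_J_of_eigenvector (hx : IsUnitEigenvector g J Φ x qx)
    (hy : IsUnitEigenvector g J Φ y qy) (w : V) :
    P w (J x) (J y) = P w x y - (qx + qy) * S w x y := by
  obtain ⟨N, hN, hP⟩ := h.P_J
  have h1 := (hx.J_apply h.herm h.Φ_J).eig (N w y)
  have h2 := (hy.J_apply h.herm h.Φ_J).eig (N w x)
  rw [h.herm.g_J_J, ← hN] at h1 h2
  rw [hP, h.Φ_skew _ (J y), h1, h2, h.S_skew w y x]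
  ring

/-! The components of the second Bianchi identity along unit eigenvectors in pairwise orthogonal
complex lines. Most of them give the value at one of the eigenvalues of an affine function
`t ↦ t S + P`, whose slope is a component of `∇F`. -/

theorem three_lines (hx : IsUnitEigenvector g J Φ x qx) (hy : IsUnitEigenvector g J Φ y qy)
    (hz : IsUnitEigenvector g J Φ z qz) (hxy : IsComplexOrthogonal g J x y)
    (hxz : IsComplexOrthogonal g J x z) (hyz : IsComplexOrthogonal g J y z) :
    qx * S x y z + P x y z = 3 * (qx * S y x z + P y x z) := by
  have key := h.bianchi x (J x) y x z
  have hJx := hx.J_apply h.herm h.Φ_J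
  have hJy := hy.J_apply h.herm h.Φ_J
  have hJz := hz.J_apply h.herm h.Φ_J
  have hyx := hxy.symm h.herm
  have hzx := hxz.symm h.herm
  have hzy := hyz.symm h.herm
  simp only [twoFormCurv, constCurv, fundForm_apply, hx.eig, hJx.eig, hy.eig, hJy.eig, hz.eig,
    hJz.eig, h.herm.g_J_left, h.herm.g_J_J, h.herm.J_J, h.herm.g_J_self, hx.norm, hy.norm,
    hz.norm, hxy.1, hxy.2, hxz.1, hxz.2, hyz.1, hyz.2, hyx.1, hyx.2, hzx.1, hzx.2, hzy.1, hzy.2,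
    map_neg, h.S_self, h.P_self, h.S_J_self] at key
  have := h.S_skew x z y
  have := h.S_skew y z x
  have := h.P_skew x z y
  have := h.P_skew y z x
  linear_combination -key

theorem four_lines (hx : IsUnitEigenvector g J Φ x qx) (hy : IsUnitEigenvector g J Φ y qy)
    (hz : IsUnitEigenvector g J Φ z qz) (hxy : IsComplexOrthogonal g J x y)
    (hxz : IsComplexOrthogonal g J x z) (hyz : IsComplexOrthogonal g J y z)
    (hu : IsUnitEigenvector g J Φ u qu) (hux : IsComplexOrthogonal g J u x)
    (huy : IsComplexOrthogonal g J u y) (huz : IsComplexOrthogonal g J u z) :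
    qu * S x y z + P x y z = 0 := by
  have key := h.bianchi u (J u) x y z
  have hJu := hu.J_apply h.herm h.Φ_J
  have hxu := hux.symm h.herm
  have hyu := huy.symm h.herm
  have hzu := huz.symm h.herm
  have hJx := hx.J_apply h.herm h.Φ_J
  have hJy := hy.J_apply h.herm h.Φ_J
  have hJz := hz.J_apply h.herm h.Φ_J
  have hyx := hxy.symm h.herm
  have hzx := hxz.symm h.herm
  have hzy := hyz.symm h.herm
  simp only [twoFormCurv, constCurv, fundForm_apply, hx.eig, hJx.eig, hy.eig, hJy.eig, hz.eig,
    hJz.eig, h.herm.g_J_left, h.herm.g_J_J, h.herm.J_J, h.herm.g_J_self, hx.norm, hy.norm,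
    hz.norm, hu.norm, hu.eig, hJu.eig, hux.1, hux.2,
    huy.1, huy.2, huz.1, huz.2, hxu.1, hxu.2, hyu.1, hyu.2, hzu.1, hzu.2, hxy.1, hxy.2, hxz.1,
    hxz.2, hyz.1, hyz.2, hyx.1, hyx.2, hzx.1, hzx.2, hzy.1, hzy.2,
    map_neg, h.S_self, h.P_self, h.S_J_self] at key
  linear_combination key / 2

theorem dν_eq_zero (hx : IsUnitEigenvector g J Φ x qx) (hy : IsUnitEigenvector g J Φ y qy)
    (hz : IsUnitEigenvector g J Φ z qz) (hxy : IsComplexOrthogonal g J x y)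
    (hxz : IsComplexOrthogonal g J x z) (hyz : IsComplexOrthogonal g J y z) :
    n z = 0 := by
  have key := h.bianchi x y z x y
  have hJx := hx.J_apply h.herm h.Φ_J
  have hJy := hy.J_apply h.herm h.Φ_J
  have hJz := hz.J_apply h.herm h.Φ_J
  have hyx := hxy.symm h.herm
  have hzx := hxz.symm h.herm
  have hzy := hyz.symm h.herm
  simp only [twoFormCurv, constCurv, fundForm_apply, hx.eig, hJx.eig, hy.eig, hJy.eig, hz.eig,
    hJz.eig, h.herm.g_J_left, h.herm.g_J_J, h.herm.J_J, h.herm.g_J_self, hx.norm, hy.norm,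
    hz.norm, hxy.1, hxy.2, hxz.1, hxz.2, hyz.1, hyz.2, hyx.1, hyx.2, hzx.1, hzx.2, hzy.1, hzy.2,
    map_neg, h.S_self, h.P_self, h.S_J_self] at key
  linear_combination -key

theorem diagonal_third_line (hx : IsUnitEigenvector g J Φ x qx) (hy : IsUnitEigenvector g J Φ y qy)
    (hz : IsUnitEigenvector g J Φ z qz) (hxy : IsComplexOrthogonal g J x y)
    (hxz : IsComplexOrthogonal g J x z) (hyz : IsComplexOrthogonal g J y z) :
    qz * S x y x + P x y x = 0 := by
  have key := h.bianchi x z y x (J z)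
  have hJx := hx.J_apply h.herm h.Φ_J
  have hJy := hy.J_apply h.herm h.Φ_J
  have hJz := hz.J_apply h.herm h.Φ_J
  have hyx := hxy.symm h.herm
  have hzx := hxz.symm h.herm
  have hzy := hyz.symm h.herm
  simp only [twoFormCurv, constCurv, fundForm_apply, hx.eig, hJx.eig, hy.eig, hJy.eig, hz.eig,
    hJz.eig, h.herm.g_J_left, h.herm.g_J_J, h.herm.J_J, h.herm.g_J_self, hx.norm, hy.norm,
    hz.norm, hxy.1, hxy.2, hxz.1, hxz.2, hyz.1, hyz.2, hyx.1, hyx.2, hzx.1, hzx.2, hzy.1, hzy.2,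
    map_neg, h.S_self, h.P_self, h.S_J_self] at key
  linear_combination -key

theorem diagonal_second_line (hx : IsUnitEigenvector g J Φ x qx) (hy : IsUnitEigenvector g J Φ y qy)
    (hz : IsUnitEigenvector g J Φ z qz) (hxy : IsComplexOrthogonal g J x y)
    (hxz : IsComplexOrthogonal g J x z) (hyz : IsComplexOrthogonal g J y z) :
    qy * S x y x + P x y x = 0 := by
  have key := h.bianchi x y (J y) x y
  have hJx := hx.J_apply h.herm h.Φ_J
  have hJy := hy.J_apply h.herm h.Φ_J
  have hJz := hz.J_apply h.herm h.Φ_J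
  have hyx := hxy.symm h.herm
  have hzx := hxz.symm h.herm
  have hzy := hyz.symm h.herm
  simp only [twoFormCurv, constCurv, fundForm_apply, hx.eig, hJx.eig, hy.eig, hJy.eig, hz.eig,
    hJz.eig, h.herm.g_J_left, h.herm.g_J_J, h.herm.J_J, h.herm.g_J_self, hx.norm, hy.norm,
    hz.norm, hxy.1, hxy.2, hxz.1, hxz.2, hyz.1, hyz.2, hyx.1, hyx.2, hzx.1, hzx.2, hzy.1, hzy.2,
    map_neg, h.S_self, h.P_self, h.S_J_self] at key
  have h1 := h.S_skew x x y
  have h2 := h.P_skew x x y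
  have h3 := h.dν_eq_zero hx hz hJy hxz (hxy.J_right h.herm) ((hyz.J_left h.herm).symm h.herm)
  linear_combination (key - 2 * qy * h1 - 2 * h2 + h3) / (-3)

theorem skew_third_line (hx : IsUnitEigenvector g J Φ x qx) (hy : IsUnitEigenvector g J Φ y qy)
    (hz : IsUnitEigenvector g J Φ z qz) (hxy : IsComplexOrthogonal g J x y)
    (hxz : IsComplexOrthogonal g J x z) (hyz : IsComplexOrthogonal g J y z) :
    qz * (S x (J x) y - S (J x) x y) + (P x (J x) y - P (J x) x y)
      = -(P y x (J x) + P y z (J z)) := by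
  have key := h.bianchi x (J x) y z (J z)
  have hJx := hx.J_apply h.herm h.Φ_J
  have hJy := hy.J_apply h.herm h.Φ_J
  have hJz := hz.J_apply h.herm h.Φ_J
  have hyx := hxy.symm h.herm
  have hzx := hxz.symm h.herm
  have hzy := hyz.symm h.herm
  simp only [twoFormCurv, constCurv, fundForm_apply, hx.eig, hJx.eig, hy.eig, hJy.eig, hz.eig,
    hJz.eig, h.herm.g_J_left, h.herm.g_J_J, h.herm.J_J, h.herm.g_J_self, hx.norm, hy.norm,
    hz.norm, hxy.1, hxy.2, hxz.1, hxz.2, hyz.1, hyz.2, hyx.1, hyx.2, hzx.1, hzx.2, hzy.1, hzy.2,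
    map_neg, h.S_self, h.P_self, h.S_J_self] at key
  have h1 := h.S_skew (J x) y x
  have h2 := h.P_skew (J x) y x
  linear_combination key / 2 - qz * h1 - h2

theorem skew_first_line (hx : IsUnitEigenvector g J Φ x qx) (hy : IsUnitEigenvector g J Φ y qy)
    (hz : IsUnitEigenvector g J Φ z qz) (hxy : IsComplexOrthogonal g J x y)
    (hxz : IsComplexOrthogonal g J x z) (hyz : IsComplexOrthogonal g J y z) :
    qx * (S x (J x) y - S (J x) x y) + (P x (J x) y - P (J x) x y) = -2 * P y x (J x) := by
  have key := h.bianchi x (J x) y x (J x)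
  have hJx := hx.J_apply h.herm h.Φ_J
  have hJy := hy.J_apply h.herm h.Φ_J
  have hJz := hz.J_apply h.herm h.Φ_J
  have hyx := hxy.symm h.herm
  have hzx := hxz.symm h.herm
  have hzy := hyz.symm h.herm
  simp only [twoFormCurv, constCurv, fundForm_apply, hx.eig, hJx.eig, hy.eig, hJy.eig, hz.eig,
    hJz.eig, h.herm.g_J_left, h.herm.g_J_J, h.herm.J_J, h.herm.g_J_self, hx.norm, hy.norm,
    hz.norm, hxy.1, hxy.2, hxz.1, hxz.2, hyz.1, hyz.2, hyx.1, hyx.2, hzx.1, hzx.2, hzy.1, hzy.2,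
    map_neg, h.S_self, h.P_self, h.S_J_self] at key
  have h1 := h.S_skew (J x) y x
  have h2 := h.P_skew (J x) y x
  have h3 := h.S_skew x y (J x)
  have h4 := h.P_skew x y (J x)
  have h5 := h.S_skew y (J x) x
  have h6 := h.P_skew y (J x) x
  have h7 := h.S_J_self y x
  have h8 := h.dν_eq_zero hx hz hy hxz hxy (hyz.symm h.herm)
  linear_combination (key - 3 * qx * h1 - 3 * h2 + qx * h3 + h4 + qx * h5 + h6 - qx * h7 + h8) / 3

theorem skew_second_line (hx : IsUnitEigenvector g J Φ x qx) (hy : IsUnitEigenvector g J Φ y qy)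
    (hz : IsUnitEigenvector g J Φ z qz) (hxy : IsComplexOrthogonal g J x y)
    (hxz : IsComplexOrthogonal g J x z) (hyz : IsComplexOrthogonal g J y z) :
    3 * (qy * (S x (J x) y - S (J x) x y) + (P x (J x) y - P (J x) x y))
      = -2 * (P y x (J x) + P y y (J y)) := by
  have key := h.bianchi x (J x) y y (J y)
  have hJx := hx.J_apply h.herm h.Φ_J
  have hJy := hy.J_apply h.herm h.Φ_J
  have hJz := hz.J_apply h.herm h.Φ_J
  have hyx := hxy.symm h.herm
  have hzx := hxz.symm h.herm
  have hzy := hyz.symm h.herm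
  simp only [twoFormCurv, constCurv, fundForm_apply, hx.eig, hJx.eig, hy.eig, hJy.eig, hz.eig,
    hJz.eig, h.herm.g_J_left, h.herm.g_J_J, h.herm.J_J, h.herm.g_J_self, hx.norm, hy.norm,
    hz.norm, hxy.1, hxy.2, hxz.1, hxz.2, hyz.1, hyz.2, hyx.1, hyx.2, hzx.1, hzx.2, hzy.1, hzy.2,
    map_neg, h.S_self, h.P_self, h.S_J_self] at key
  have h1 := h.S_skew (J x) y x
  have h2 := h.P_skew (J x) y x
  linear_combination key - 2 * qy * h1 - 2 * h2

end IsBianchiSystem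

end FirstOrder

section FirstOrder

variable {V : Type*} [NormedAddCommGroup V] [NormedSpace ℝ V]

/-! ### Consequences for the covariant derivative of the fundamental form -/

namespace IsBianchiSystem

variable {g : V →L[ℝ] V →L[ℝ] ℝ} {J : V →L[ℝ] V} {Φ : V →L[ℝ] V →L[ℝ] ℝ}
  {S P : V →ₗ[ℝ] V →ₗ[ℝ] V →ₗ[ℝ] ℝ} {n : V →ₗ[ℝ] ℝ} (h : IsBianchiSystem g J Φ S P n)
  {x y z u : V} {qx qy qz qu : ℝ}
include h

/-- The six equations which `three_lines` gives for the orderings of three vectors, as equations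
for the values at `qx`, `qy`, `qz` of the affine functions `t ↦ t S + P`. -/
theorem three_lines_all (hx : IsUnitEigenvector g J Φ x qx) (hy : IsUnitEigenvector g J Φ y qy)
    (hz : IsUnitEigenvector g J Φ z qz) (hxy : IsComplexOrthogonal g J x y)
    (hxz : IsComplexOrthogonal g J x z) (hyz : IsComplexOrthogonal g J y z) :
    (qx * S x y z + P x y z = -3 * (qx * S y z x + P y z x) ∧
      qx * S x y z + P x y z = -3 * (qx * S z x y + P z x y)) ∧
    (qy * S y z x + P y z x = -3 * (qy * S z x y + P z x y) ∧
      qy * S y z x + P y z x = -3 * (qy * S x y z + P x y z)) ∧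
    (qz * S z x y + P z x y = -3 * (qz * S x y z + P x y z) ∧
      qz * S z x y + P z x y = -3 * (qz * S y z x + P y z x)) := by
  have hyx := hxy.symm h.herm
  have hzx := hxz.symm h.herm
  have hzy := hyz.symm h.herm
  have e1 := h.three_lines hx hy hz hxy hxz hyz
  have e2 := h.three_lines hx hz hy hxz hxy hzy
  have e3 := h.three_lines hy hz hx hyz hyx hzx
  have e4 := h.three_lines hy hx hz hyx hyz hxz
  have e5 := h.three_lines hz hx hy hzx hzy hxy
  have e6 := h.three_lines hz hy hx hzy hzx hyx
  have s1 := h.S_skew x z y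
  have s2 := h.S_skew y x z
  have s3 := h.S_skew z y x
  have p1 := h.P_skew x z y
  have p2 := h.P_skew y x z
  have p3 := h.P_skew z y x
  refine ⟨⟨?_, ?_⟩, ⟨?_, ?_⟩, ⟨?_, ?_⟩⟩
  · linear_combination e1 + 3 * qx * s2 + 3 * p2
  · linear_combination -e2 + qx * s1 + p1
  · linear_combination e3 + 3 * qy * s3 + 3 * p3
  · linear_combination -e4 + qy * s2 + p2
  · linear_combination e5 + 3 * qz * s1 + 3 * p1
  · linear_combination -e6 + qz * s3 + p3

/-- The case of two equal eigenvalues `qy = qz ≠ qx`. -/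
theorem S_eq_zero_of_two_eq (hx : IsUnitEigenvector g J Φ x qx)
    (hy : IsUnitEigenvector g J Φ y qy) (hz : IsUnitEigenvector g J Φ z qz)
    (hxy : IsComplexOrthogonal g J x y) (hxz : IsComplexOrthogonal g J x z)
    (hyz : IsComplexOrthogonal g J y z) (h1 : qy = qz) (h2 : qx ≠ qy) :
    S x y z = 0 ∧ S y z x = 0 ∧ S z x y = 0 := by
  subst h1
  have key : ∀ {x y z : V}, IsUnitEigenvector g J Φ x qx → IsUnitEigenvector g J Φ y qy →
      IsUnitEigenvector g J Φ z qy → IsComplexOrthogonal g J x y → IsComplexOrthogonal g J x z →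
      IsComplexOrthogonal g J y z →
      P x y z = -qy * S x y z ∧ P y z x = -qy * S y z x ∧ S x y z = -3 * S y z x ∧
        S z x y = S y z x := by
    intro x y z hx hy hz hxy hxz hyz
    obtain ⟨⟨a1, a2⟩, ⟨b1, b2⟩, c1, c2⟩ := h.three_lines_all hx hy hz hxy hxz hyz
    have p1 : P x y z = -qy * S x y z := by linarith
    have p2 : P y z x = -qy * S y z x := by linarith
    have p3 : P z x y = -qy * S z x y := by linarith
    rw [p1, p2] at a1
    rw [p1, p3] at a2
    refine ⟨p1, p2, ?_, ?_⟩
    · apply mul_left_cancel₀ (sub_ne_zero.mpr h2)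
      linear_combination a1
    · apply mul_left_cancel₀ (sub_ne_zero.mpr h2)
      linear_combination (a2 - a1) / 3
  obtain ⟨k1, k2, k3, k4⟩ := key hx hy hz hxy hxz hyz
  obtain ⟨k1', -, -, -⟩ := key hx (hy.J_apply h.herm h.Φ_J) (hz.J_apply h.herm h.Φ_J)
    (hxy.J_right h.herm) (hxz.J_right h.herm) ((hyz.J_right h.herm).J_left h.herm)
  obtain ⟨-, k2', -, -⟩ := key (hx.J_apply h.herm h.Φ_J) hy (hz.J_apply h.herm h.Φ_J)
    (hxy.J_left h.herm) ((hxz.J_right h.herm).J_left h.herm) (hyz.J_right h.herm)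
  rw [h.S_J, h.P_J_of_eigenvector hy hz, k1] at k1'
  rw [h.S_J, h.P_J_of_eigenvector hz hx, k2] at k2'
  have m1 : qy * S y z x = 0 := by rw [k3] at k1'; linarith
  have m2 : qx * S y z x = 0 := by linarith
  have m3 : S y z x = 0 := by
    apply mul_left_cancel₀ (sub_ne_zero.mpr h2)
    linear_combination m2 - m1
  exact ⟨by rw [k3, m3, mul_zero], m3, by rw [k4, m3]⟩

/-- `∇F` vanishes on unit eigenvectors in three different lines, unless the eigenvalues vanish. -/
theorem S_three_lines (hx : IsUnitEigenvector g J Φ x qx)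
    (hy : IsUnitEigenvector g J Φ y qy) (hz : IsUnitEigenvector g J Φ z qz)
    (hxy : IsComplexOrthogonal g J x y) (hxz : IsComplexOrthogonal g J x z)
    (hyz : IsComplexOrthogonal g J y z)
    (hne : qx ≠ 0 ∨ qy ≠ 0 ∨ qz ≠ 0 ∨ ∃ u qu, qu ≠ 0 ∧ IsUnitEigenvector g J Φ u qu ∧
      IsComplexOrthogonal g J u x ∧ IsComplexOrthogonal g J u y ∧ IsComplexOrthogonal g J u z) :
    S x y z = 0 := by
  have hyx := hxy.symm h.herm
  have hzx := hxz.symm h.herm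
  have hzy := hyz.symm h.herm
  by_cases h1 : qy = qz
  · by_cases h2 : qx = qy
    · subst h2 h1
      have key : ∀ {x y z : V}, IsUnitEigenvector g J Φ x qx → IsUnitEigenvector g J Φ y qx →
          IsUnitEigenvector g J Φ z qx → IsComplexOrthogonal g J x y →
          IsComplexOrthogonal g J x z → IsComplexOrthogonal g J y z →
          P x y z = -qx * S x y z := by
        intro x y z hx hy hz hxy hxz hyz
        obtain ⟨⟨a1, a2⟩, ⟨b1, b2⟩, c1, c2⟩ := h.three_lines_all hx hy hz hxy hxz hyz
        linarith
      have k1 := key hx hy hz hxy hxz hyz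
      have k2 := key hx (hy.J_apply h.herm h.Φ_J) (hz.J_apply h.herm h.Φ_J)
        (hxy.J_right h.herm) (hxz.J_right h.herm) ((hyz.J_right h.herm).J_left h.herm)
      rw [h.S_J, h.P_J_of_eigenvector hy hz, k1] at k2
      have k3 : qx * S x y z = 0 := by linarith
      rcases hne with h0 | h0 | h0 | ⟨u, qu, h0, hu, hux, huy, huz⟩
      · exact (mul_eq_zero.mp k3).resolve_left h0
      · exact (mul_eq_zero.mp k3).resolve_left h0
      · exact (mul_eq_zero.mp k3).resolve_left h0
      · have k4 := h.four_lines hx hy hz hxy hxz hyz hu hux huy huz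
        have k5 : qu * S x y z = 0 := by rw [k1] at k4; linarith
        exact (mul_eq_zero.mp k5).resolve_left h0
    · exact (h.S_eq_zero_of_two_eq hx hy hz hxy hxz hyz h1 h2).1
  · by_cases h2 : qz = qx
    · exact (h.S_eq_zero_of_two_eq hy hz hx hyz hyx hzx h2 h1).2.2
    · by_cases h3 : qx = qy
      · exact (h.S_eq_zero_of_two_eq hz hx hy hzx hzy hxy h3 h2).2.1
      · -- each of the three affine functions is minus their sum, as it is so at two points
        obtain ⟨⟨a1, a2⟩, ⟨b1, b2⟩, c1, c2⟩ := h.three_lines_all hx hy hz hxy hxz hyz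
        have e1 : 2 * S x y z + S y z x + S z x y = 0 := by
          apply mul_left_cancel₀ (sub_ne_zero.mpr h1)
          linarith
        have e2 : S x y z + 2 * S y z x + S z x y = 0 := by
          apply mul_left_cancel₀ (sub_ne_zero.mpr h2)
          linarith
        have e3 : S x y z + S y z x + 2 * S z x y = 0 := by
          apply mul_left_cancel₀ (sub_ne_zero.mpr h3)
          linarith
        linarith

/-- `∇F` vanishes on the lines of `x` and `y` if the eigenvalue of `y` differs from that of some
third line. -/
theorem S_two_lines (hx : IsUnitEigenvector g J Φ x qx)
    (hy : IsUnitEigenvector g J Φ y qy) (hz : IsUnitEigenvector g J Φ z qz)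
    (hxy : IsComplexOrthogonal g J x y) (hxz : IsComplexOrthogonal g J x z)
    (hyz : IsComplexOrthogonal g J y z) (hne : qz ≠ qy) : S x x y = 0 ∧ S x (J x) y = 0 := by
  have key : ∀ {y}, IsUnitEigenvector g J Φ y qy → IsComplexOrthogonal g J x y →
      IsComplexOrthogonal g J y z → S x x y = 0 := by
    intro y hy hxy hyz
    have e1 := h.diagonal_third_line hx hy hz hxy hxz hyz
    have e2 := h.diagonal_second_line hx hy hz hxy hxz hyz
    rw [h.S_skew]
    have : S x y x = 0 := by
      apply mul_left_cancel₀ (sub_ne_zero.mpr hne)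
      linear_combination e1 - e2
    rw [this, neg_zero]
  refine ⟨key hy hxy hyz, ?_⟩
  rw [h.S_J_left]
  exact key (hy.J_apply h.herm h.Φ_J) (hxy.J_right h.herm) (hyz.J_left h.herm)

/-- If all lines but that of `x` have the same eigenvalue, then `∇F` is symmetric in its first two
arguments on the lines of `x` and `y`. -/
theorem S_two_lines_symm (hx : IsUnitEigenvector g J Φ x qx)
    (hy : IsUnitEigenvector g J Φ y qy) (hz : IsUnitEigenvector g J Φ z qz)
    (hxy : IsComplexOrthogonal g J x y) (hxz : IsComplexOrthogonal g J x z)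
    (hyz : IsComplexOrthogonal g J y z) (h1 : qz = qy) (h2 : qx ≠ qy) :
    S x (J x) y = S (J x) x y := by
  have hzx := hxz.symm h.herm
  have hzy := hyz.symm h.herm
  have hyx := hxy.symm h.herm
  have hJz := hz.J_apply h.herm h.Φ_J
  have k1 := (h.S_two_lines hz hy hx hzy hzx hyx h2).2
  have k2 := (h.S_two_lines hJz hy hx (hzy.J_left h.herm) (hzx.J_left h.herm) hyx h2).2
  rw [h.herm.J_J, map_neg, LinearMap.neg_apply] at k2
  have e1 := h.skew_third_line hz hy hx hzy hzx hyx
  have e2 := h.skew_first_line hz hy hx hzy hzx hyx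
  have e3 := h.skew_third_line hx hy hz hxy hxz hyz
  have e4 := h.skew_first_line hx hy hz hxy hxz hyz
  have k3 : S z (J z) y - S (J z) z y = 0 := by linarith
  rw [k3] at e1 e2
  apply mul_left_cancel₀ (sub_ne_zero.mpr h2)
  subst h1
  linarith

end IsBianchiSystem

namespace IsUnitaryEigenbasis

variable {g : V →L[ℝ] V →L[ℝ] ℝ} {J : V →L[ℝ] V} {Φ : V →L[ℝ] V →L[ℝ] ℝ} {m : ℕ}
  {e : Fin m → V} {q : Fin m → ℝ} (he : IsUnitaryEigenbasis g J Φ e q)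
include he

theorem isUnitEigenvector (i : Fin m) : IsUnitEigenvector g J Φ (e i) (q i) :=
  ⟨he.norm i, he.eig i⟩

theorem isComplexOrthogonal {i j : Fin m} (hij : i ≠ j) : IsComplexOrthogonal g J (e i) (e j) :=
  ⟨he.orth i j hij, he.orth_J i j hij⟩

/-- A linear form vanishes at `v` if it vanishes on the lines of the basis to which `v` is not
orthogonal. -/
theorem apply_eq_zero (hg : IsHermitianPair g J) (L : V →ₗ[ℝ] ℝ) (v : V)
    (h : ∀ i, IsComplexOrthogonal g J (e i) v ∨ (∀ x, x = e i ∨ x = J (e i) → L x = 0)) :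
    L v = 0 := by
  rw [he.expand v, map_sum]
  refine Finset.sum_eq_zero fun i _ ↦ ?_
  rcases h i with h | h
  · rw [hg.g_J_left, h.1, h.2]
    simp
  · rw [map_add, map_smul, map_smul, h _ (Or.inl rfl), h _ (Or.inr rfl)]
    simp

theorem line (hg : IsHermitianPair g J) (hΦJ : ∀ x y, Φ (J x) (J y) = Φ x y) {i : Fin m} {x : V}
    (hx : x = e i ∨ x = J (e i)) : IsUnitEigenvector g J Φ x (q i) := by
  rcases hx with rfl | rfl
  · exact he.isUnitEigenvector i
  · exact (he.isUnitEigenvector i).J_apply hg hΦJ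

theorem line_orth (hg : IsHermitianPair g J) {i j : Fin m} (hij : i ≠ j) {x y : V}
    (hx : x = e i ∨ x = J (e i)) (hy : y = e j ∨ y = J (e j)) : IsComplexOrthogonal g J x y := by
  have := he.isComplexOrthogonal hij
  rcases hx with rfl | rfl <;> rcases hy with rfl | rfl
  · exact this
  · exact this.J_right hg
  · exact this.J_left hg
  · exact (this.J_left hg).J_right hg

end IsUnitaryEigenbasis

theorem exists_third {m : ℕ} (hm : 2 < m) (i j : Fin m) : ∃ k, k ≠ i ∧ k ≠ j := by
  by_contra! h
  have : (Finset.univ : Finset (Fin m)) ⊆ {i, j} := fun k _ ↦ by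
    by_cases hk : k = i
    · simp [hk]
    · simp [h k hk]
  have h1 := Finset.card_le_card this
  have h2 := Finset.card_le_two (a := i) (b := j)
  simp at h1
  omega

namespace IsBianchiSystem

variable {g : V →L[ℝ] V →L[ℝ] ℝ} {J : V →L[ℝ] V} {Φ : V →L[ℝ] V →L[ℝ] ℝ}
  {S P : V →ₗ[ℝ] V →ₗ[ℝ] V →ₗ[ℝ] ℝ} {n : V →ₗ[ℝ] ℝ} (h : IsBianchiSystem g J Φ S P n)
  {m : ℕ} {e : Fin m → V} {q : Fin m → ℝ} (he : IsUnitaryEigenbasis g J Φ e q)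
include h he

theorem dν_apply_eq_zero (hm : 2 < m) (v : V) : n v = 0 := by
  refine he.apply_eq_zero h.herm n v fun i ↦ Or.inr fun x hx ↦ ?_
  obtain ⟨j, hj, -⟩ := exists_third hm i i
  obtain ⟨k, hk, hkj⟩ := exists_third hm i j
  exact h.dν_eq_zero (he.isUnitEigenvector j) (he.isUnitEigenvector k) (he.line h.herm h.Φ_J hx)
    (he.isComplexOrthogonal hkj.symm) (he.line_orth h.herm hj (Or.inl rfl) hx)
    (he.line_orth h.herm hk (Or.inl rfl) hx)

/-- A trilinear form vanishes at `(w, x, y)` if it does so on the lines of the basis. -/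
theorem trilinear_eq_zero (T : V →ₗ[ℝ] V →ₗ[ℝ] V →ₗ[ℝ] ℝ) (w x y : V)
    (hT : ∀ i j k, ¬IsComplexOrthogonal g J (e i) w → ¬IsComplexOrthogonal g J (e j) x →
      ¬IsComplexOrthogonal g J (e k) y → ∀ a b c, (a = e i ∨ a = J (e i)) →
      (b = e j ∨ b = J (e j)) → (c = e k ∨ c = J (e k)) → T a b c = 0) : T w x y = 0 := by
  refine he.apply_eq_zero h.herm ((T.flip x).flip y) w fun i ↦
    or_iff_not_imp_left.mpr fun hi a ha ↦ ?_
  refine he.apply_eq_zero h.herm ((T a).flip y) x fun j ↦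
    or_iff_not_imp_left.mpr fun hj b hb ↦ ?_
  exact he.apply_eq_zero h.herm (T a b) y fun k ↦
    or_iff_not_imp_left.mpr fun hk c hc ↦ hT i j k hi hj hk a b c ha hb hc

omit he in
theorem S_same_line {i : Fin m} {a b : V} (ha : a = e i ∨ a = J (e i))
    (hb : b = e i ∨ b = J (e i)) (w : V) : S w a b = 0 := by
  rcases ha with rfl | rfl <;> rcases hb with rfl | rfl
  · exact h.S_self w _
  · exact h.S_J_self w _
  · rw [h.S_skew, h.S_J_self, neg_zero]
  · exact h.S_self w _

theorem S_two_lines_basis {i k l : Fin m} (hik : i ≠ k) (hl : l ≠ i) (hlk : q l ≠ q k) {a b c : V}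
    (ha : a = e i ∨ a = J (e i)) (hb : b = e i ∨ b = J (e i)) (hc : c = e k ∨ c = J (e k)) :
    S a b c = 0 := by
  have hlk' : k ≠ l := fun h ↦ hlk (by rw [h])
  have key : ∀ {a}, a = e i ∨ a = J (e i) → S a a c = 0 ∧ S a (J a) c = 0 := fun {a} ha ↦
    h.S_two_lines (he.line h.herm h.Φ_J ha) (he.line h.herm h.Φ_J hc) (he.isUnitEigenvector l)
      (he.line_orth h.herm hik ha hc) (he.line_orth h.herm hl.symm ha (Or.inl rfl))
      (he.line_orth h.herm hlk' hc (Or.inl rfl)) hlk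
  rcases ha with rfl | rfl <;> rcases hb with rfl | rfl
  · exact (key (Or.inl rfl)).1
  · exact (key (Or.inl rfl)).2
  · have := (key (Or.inr rfl)).2
    rwa [h.herm.J_J, map_neg, LinearMap.neg_apply, neg_eq_zero] at this
  · exact (key (Or.inr rfl)).1

theorem S_three_lines_basis (hne : ∃ i j, q i ≠ q j) {i j k : Fin m} (hij : i ≠ j) (hik : i ≠ k)
    (hjk : j ≠ k) {a b c : V} (ha : a = e i ∨ a = J (e i)) (hb : b = e j ∨ b = J (e j))
    (hc : c = e k ∨ c = J (e k)) : S a b c = 0 := by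
  -- some eigenvalue does not vanish
  obtain ⟨l, hl⟩ : ∃ l, q l ≠ 0 := by
    obtain ⟨i, j, hij⟩ := hne
    by_contra! h0
    exact hij (by rw [h0, h0])
  refine h.S_three_lines (he.line h.herm h.Φ_J ha) (he.line h.herm h.Φ_J hb)
    (he.line h.herm h.Φ_J hc) (he.line_orth h.herm hij ha hb) (he.line_orth h.herm hik ha hc)
    (he.line_orth h.herm hjk hb hc) ?_
  by_cases hli : l = i
  · exact Or.inl (hli ▸ hl)
  by_cases hlj : l = j
  · exact Or.inr (Or.inl (hlj ▸ hl))
  by_cases hlk : l = k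
  · exact Or.inr (Or.inr (Or.inl (hlk ▸ hl)))
  exact Or.inr (Or.inr (Or.inr ⟨e l, q l, hl, he.isUnitEigenvector l,
    he.line_orth h.herm hli (Or.inl rfl) ha, he.line_orth h.herm hlj (Or.inl rfl) hb,
    he.line_orth h.herm hlk (Or.inl rfl) hc⟩))

/-- A nonzero component of `∇F` in the basis involves two lines only, the first of which is the
only one whose eigenvalue differs from that of the second. -/
theorem lines_of_S_ne_zero (hne : ∃ i j, q i ≠ q j) {i j k : Fin m} {a b c : V}
    (ha : a = e i ∨ a = J (e i)) (hb : b = e j ∨ b = J (e j)) (hc : c = e k ∨ c = J (e k))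
    (hS : S a b c ≠ 0) : j ≠ k ∧
      ((i = j ∧ ∀ l, l ≠ i → q l = q k) ∨ (i = k ∧ ∀ l, l ≠ i → q l = q j)) := by
  have hjk : j ≠ k := by
    rintro rfl
    exact hS (h.S_same_line hb hc a)
  refine ⟨hjk, ?_⟩
  by_cases hij : i = j
  · subst hij
    refine Or.inl ⟨rfl, fun l hl ↦ ?_⟩
    by_contra hlk
    exact hS (h.S_two_lines_basis he hjk hl hlk ha hb hc)
  · by_cases hik : i = k
    · subst hik
      refine Or.inr ⟨rfl, fun l hl ↦ ?_⟩
      by_contra hlj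
      apply hS
      rw [h.S_skew, h.S_two_lines_basis he hij hl hlj ha hc hb, neg_zero]
    · exact absurd (h.S_three_lines_basis he hne hij hik hjk ha hb hc) hS

theorem S_symm_basis (hm : 2 < m) (hne : ∃ i j, q i ≠ q j) {i k : Fin m} (hik : i ≠ k) {a b c : V}
    (ha : a = e i ∨ a = J (e i)) (hb : b = e i ∨ b = J (e i)) (hc : c = e k ∨ c = J (e k)) :
    S a b c = S b a c := by
  by_cases hl : ∃ l, l ≠ i ∧ q l ≠ q k
  · obtain ⟨l, hli, hlk⟩ := hl
    rw [h.S_two_lines_basis he hik hli hlk ha hb hc, h.S_two_lines_basis he hik hli hlk hb ha hc]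
  push Not at hl
  have hi : q i ≠ q k := by
    intro hik
    have : ∀ l, q l = q k := fun l ↦ by
      by_cases hli : l = i
      · rw [hli, hik]
      · exact hl l hli
    obtain ⟨i', j', hne⟩ := hne
    exact hne ((this i').trans (this j').symm)
  obtain ⟨l, hli, hlk⟩ := exists_third hm i k
  have key := h.S_two_lines_symm (he.isUnitEigenvector i) (he.line h.herm h.Φ_J hc)
    (he.isUnitEigenvector l) (he.line_orth h.herm hik (Or.inl rfl) hc)
    (he.isComplexOrthogonal hli.symm) (he.line_orth h.herm hlk.symm hc (Or.inl rfl)) (hl l hli) hi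
  rcases ha with rfl | rfl <;> rcases hb with rfl | rfl
  · rfl
  · exact key
  · exact key.symm
  · rfl

/-- If `Φ` is not a multiple of `F`, the second Bianchi identity implies `dF = 0`. -/
theorem S_cyclic (hm : 2 < m) (hne : ∃ i j, q i ≠ q j) (w x y : V) :
    S w x y + S x y w + S y w x = 0 := by
  let T : V →ₗ[ℝ] V →ₗ[ℝ] V →ₗ[ℝ] ℝ := S + LinearMap.mk₂ ℝ (fun w x ↦ (S x).flip w)
      (fun _ _ _ ↦ by simp) (fun _ _ _ ↦ by simp) (fun _ _ _ ↦ by ext; simp)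
      (fun _ _ _ ↦ by ext; simp)
    + LinearMap.mk₂ ℝ (fun w x ↦ (S.flip w).flip x)
      (fun _ _ _ ↦ by ext; simp) (fun _ _ _ ↦ by ext; simp) (fun _ _ _ ↦ by ext; simp)
      (fun _ _ _ ↦ by ext; simp)
  have hT : ∀ w x y, T w x y = S w x y + S x y w + S y w x := fun w x y ↦ rfl
  rw [← hT]
  refine h.trilinear_eq_zero he T w x y fun i j k _ _ _ a b c ha hb hc ↦ ?_
  rw [hT]
  by_cases hij : i = j
  · subst hij
    rw [h.S_same_line ha hb]
    by_cases hik : i = k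
    · subst hik
      rw [h.S_same_line hb hc, h.S_same_line hc ha]
      ring
    · rw [h.S_symm_basis he hm hne hik ha hb hc, h.S_skew b c a]
      ring
  by_cases hik : i = k
  · subst hik
    rw [h.S_same_line hc ha, h.S_symm_basis he hm hne hij hc ha hb, h.S_skew a b c]
    ring
  by_cases hjk : j = k
  · subst hjk
    rw [h.S_same_line hb hc, h.S_symm_basis he hm hne (Ne.symm hij) hb hc ha, h.S_skew c a b]
    ring
  rw [h.S_three_lines_basis he hne hij hik hjk ha hb hc,
    h.S_three_lines_basis he hne hjk (Ne.symm hij) (Ne.symm hik) hb hc ha,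
    h.S_three_lines_basis he hne (Ne.symm hik) (Ne.symm hjk) hij hc ha hb]
  ring

/-- If `Φ` is not a multiple of `F` and `∇F ≠ 0`, then all eigenvalues but one are equal, and
`∇F` pairs the exceptional line with its orthogonal complement. -/
theorem exists_exceptional_line (hm : 2 < m) (hne : ∃ i j, q i ≠ q j) (hS : ∃ w x y, S w x y ≠ 0) :
    ∃ i, (∀ j k, j ≠ i → k ≠ i → q j = q k) ∧ (∀ j, j ≠ i → q i ≠ q j) ∧
      (∀ w x y, IsComplexOrthogonal g J (e i) w → S w x y = 0) ∧
      (∀ w x y, IsComplexOrthogonal g J (e i) x → IsComplexOrthogonal g J (e i) y →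
        S w x y = 0) := by
  obtain ⟨i, o, hio, hq⟩ : ∃ i o, i ≠ o ∧ ∀ l, l ≠ i → q l = q o := by
    by_contra! hcon
    obtain ⟨w, x, y, hS⟩ := hS
    refine hS (h.trilinear_eq_zero he S w x y fun i j k _ _ _ a b c ha hb hc ↦ ?_)
    by_contra hne'
    obtain ⟨hjk, ⟨hij, hl⟩ | ⟨hik, hl⟩⟩ := h.lines_of_S_ne_zero he hne ha hb hc hne'
    · obtain ⟨l, h1, h2⟩ := hcon i k (hij ▸ hjk)
      exact h2 (hl l h1)
    · obtain ⟨l, h1, h2⟩ := hcon i j (hik ▸ hjk.symm)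
      exact h2 (hl l h1)
  have hqi : q i ≠ q o := by
    intro hi
    have : ∀ l, q l = q o := fun l ↦ by
      by_cases hli : l = i
      · rw [hli, hi]
      · exact hq l hli
    obtain ⟨i', j', hne⟩ := hne
    exact hne ((this i').trans (this j').symm)
  -- the first line of a nonzero component is the line `i`
  have key : ∀ i' k, i' ≠ k → (∀ l, l ≠ i' → q l = q k) → i' = i := by
    intro i' k hik hl
    by_contra hi'
    obtain ⟨l, hl1, hl2⟩ := exists_third hm i' i
    exact hqi (by rw [hl i (Ne.symm hi'), ← hl l hl1, hq l hl2])
  refine ⟨i, fun j k hj hk ↦ by rw [hq j hj, hq k hk], fun j hj ↦ by rwa [hq j hj],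
    fun w x y hw ↦ ?_, fun w x y hx hy ↦ ?_⟩
  · refine h.trilinear_eq_zero he S w x y fun i' j k hi' _ _ a b c ha hb hc ↦ ?_
    by_contra hne'
    obtain ⟨hjk, ⟨hij, hl⟩ | ⟨hik, hl⟩⟩ := h.lines_of_S_ne_zero he hne ha hb hc hne'
    · exact hi' (key i' k (hij ▸ hjk) hl ▸ hw)
    · exact hi' (key i' j (hik ▸ hjk.symm) hl ▸ hw)
  · refine h.trilinear_eq_zero he S w x y fun i' j k _ hj hk a b c ha hb hc ↦ ?_
    by_contra hne'
    obtain ⟨hjk, ⟨hij, hl⟩ | ⟨hik, hl⟩⟩ := h.lines_of_S_ne_zero he hne ha hb hc hne'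
    · exact hj (hij ▸ key i' k (hij ▸ hjk) hl ▸ hx)
    · exact hk (hik ▸ key i' j (hik ▸ hjk.symm) hl ▸ hy)

/-- If `Φ = λ F` and `∇Φ = dλ F + λ ∇F`, then `dλ = 0` and `λ ∇F = 0`. -/
theorem proportional (hm : 2 < m) {c : ℝ} {dc : V →ₗ[ℝ] ℝ} (hΦ : ∀ x y, Φ x y = c * g x (J y))
    (hP : ∀ w x y, P w x y = dc w * g x (J y) + c * S w x y) :
    (∀ v, dc v = 0) ∧ (c ≠ 0 → ∀ w x y, S w x y = 0) := by
  have hq : ∀ i x, x = e i ∨ x = J (e i) → IsUnitEigenvector g J Φ x c := fun i x hx ↦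
    ⟨(he.line h.herm h.Φ_J hx).norm, hΦ x⟩
  constructor
  · intro v
    refine he.apply_eq_zero h.herm dc v fun i ↦ Or.inr fun y hy ↦ ?_
    obtain ⟨j, hj, -⟩ := exists_third hm i i
    obtain ⟨k, hk, hkj⟩ := exists_third hm i j
    have hx := hq j (e j) (Or.inl rfl)
    have hz := hq k (e k) (Or.inl rfl)
    have hxy := he.line_orth h.herm hj (Or.inl rfl) hy
    have hyz := he.line_orth h.herm hk.symm hy (Or.inl rfl)
    have hxz := he.isComplexOrthogonal hkj.symm
    have e1 := h.skew_third_line hx (hq i y hy) hz hxy hxz hyz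
    have e2 := h.skew_second_line hx (hq i y hy) hz hxy hxz hyz
    have hJ : ∀ x : V, g x x = 1 → P y x (J x) = -dc y := fun x hx ↦ by
      rw [hP, h.herm.J_J, h.S_J_self, map_neg, hx]
      ring
    rw [hJ _ hx.norm, hJ _ hz.norm] at e1
    rw [hJ _ hx.norm, hJ _ (hq i y hy).norm] at e2
    linarith
  · intro hc w x y
    refine h.trilinear_eq_zero he S w x y fun i j k _ _ _ a b d ha hb hd ↦ ?_
    -- the components with exactly two lines
    have two : ∀ {i k : Fin m}, i ≠ k → ∀ {a b d}, (a = e i ∨ a = J (e i)) →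
        (b = e i ∨ b = J (e i)) → (d = e k ∨ d = J (e k)) → S a b d = 0 := by
      intro i k hik a b d ha hb hd
      obtain ⟨l, hli, hlk⟩ := exists_third hm i k
      have key : ∀ {a d}, (a = e i ∨ a = J (e i)) → (d = e k ∨ d = J (e k)) →
          S a a d = 0 := by
        intro a d ha hd
        have had := he.line_orth h.herm hik ha hd
        have e1 := h.diagonal_third_line (hq i a ha) (hq k d hd) (hq l (e l) (Or.inl rfl)) had
          (he.line_orth h.herm hli.symm ha (Or.inl rfl))
          (he.line_orth h.herm hlk.symm hd (Or.inl rfl))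
        rw [hP, (had.symm h.herm).2] at e1
        have : c * S a d a = 0 := by linarith
        rw [h.S_skew, (mul_eq_zero.mp this).resolve_left hc, neg_zero]
      have hJd : ∃ d', (d' = e k ∨ d' = J (e k)) ∧ (J d = d' ∨ J d = -d') := by
        rcases hd with rfl | rfl
        · exact ⟨_, Or.inr rfl, Or.inl rfl⟩
        · exact ⟨_, Or.inl rfl, Or.inr (h.herm.J_J _)⟩
      obtain ⟨d', hd', hJd⟩ := hJd
      have key2 : ∀ {a}, (a = e i ∨ a = J (e i)) → S a (J a) d = 0 := by
        intro a ha
        rw [h.S_J_left]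
        rcases hJd with hJd | hJd <;> rw [hJd]
        · exact key ha hd'
        · rw [map_neg, key ha hd', neg_zero]
      rcases ha with rfl | rfl <;> rcases hb with rfl | rfl
      · exact key (Or.inl rfl) hd
      · exact key2 (Or.inl rfl)
      · have := key2 (Or.inr rfl)
        rwa [h.herm.J_J, map_neg, LinearMap.neg_apply, neg_eq_zero] at this
      · exact key (Or.inr rfl) hd
    by_cases hjk : j = k
    · subst hjk
      exact h.S_same_line hb hd a
    by_cases hij : i = j
    · subst hij
      exact two hjk ha hb hd
    by_cases hik : i = k
    · subst hik
      rw [h.S_skew, two hij ha hd hb, neg_zero]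
    have hab := he.line_orth h.herm hij ha hb
    have had := he.line_orth h.herm hik ha hd
    have hbd := he.line_orth h.herm hjk hb hd
    have e1 := h.three_lines (hq i a ha) (hq j b hb) (hq k d hd) hab had hbd
    have e2 := h.three_lines (hq j b hb) (hq i a ha) (hq k d hd) (hab.symm h.herm) hbd had
    rw [hP, hP, hbd.2, had.2] at e1 e2
    have : c * S a b d = 0 := by linarith
    exact (mul_eq_zero.mp this).resolve_left hc

end IsBianchiSystem

end FirstOrder

/-! ### One-jets of functions of a real variable -/

section Jets

variable {E F : Type*} [NormedAddCommGroup E] [NormedSpace ℝ E] [NormedAddCommGroup F]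
  [NormedSpace ℝ F]

/-- `f` has value `a` and derivative `a'` at `0`. -/
def HasJet (f : ℝ → E) (a a' : E) : Prop :=
  f 0 = a ∧ HasDerivAt f a' 0

namespace HasJet

variable {f f₁ : ℝ → E} {a a' b b' : E}

theorem unique (h : HasJet f a a') (h₁ : HasJet f b b') : a' = b' :=
  h.2.unique h₁.2

theorem congr (h : HasJet f a a') (hf : f₁ =ᶠ[nhds 0] f) : HasJet f₁ a a' :=
  ⟨hf.eq_of_nhds.trans h.1, h.2.congr_of_eventuallyEq hf⟩

theorem const (a : E) : HasJet (fun _ ↦ a) a 0 :=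
  ⟨rfl, hasDerivAt_const 0 a⟩

theorem apply {f : ℝ → E →L[ℝ] F} {a a' : E →L[ℝ] F} {u : ℝ → E} {x x' : E} (h : HasJet f a a')
    (hu : HasJet u x x') : HasJet (fun t ↦ f t (u t)) (a x) (a' x + a x') := by
  refine ⟨by simp only [h.1, hu.1], ?_⟩
  have := h.2.clm_apply hu.2
  rwa [h.1, hu.1] at this

theorem add (h : HasJet f a a') (h₁ : HasJet f₁ b b') :
    HasJet (fun t ↦ f t + f₁ t) (a + b) (a' + b') :=
  ⟨by simp only [h.1, h₁.1], h.2.add h₁.2⟩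

theorem sub (h : HasJet f a a') (h₁ : HasJet f₁ b b') :
    HasJet (fun t ↦ f t - f₁ t) (a - b) (a' - b') :=
  ⟨by simp only [h.1, h₁.1], h.2.sub h₁.2⟩

theorem neg (h : HasJet f a a') : HasJet (fun t ↦ -f t) (-a) (-a') :=
  ⟨by simp only [h.1], h.2.neg⟩

theorem mul {f f₁ : ℝ → ℝ} {a a' b b' : ℝ} (h : HasJet f a a') (h₁ : HasJet f₁ b b') :
    HasJet (fun t ↦ f t * f₁ t) (a * b) (a' * b + a * b') := by
  refine ⟨by simp only [h.1, h₁.1], ?_⟩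
  have := h.2.mul h₁.2
  rwa [h.1, h₁.1] at this

/-- The jet of the restriction of a differentiable function to a line. -/
theorem along {T : E → F} {y : E} (hT : DifferentiableAt ℝ T y) (w : E) :
    HasJet (fun t : ℝ ↦ T (y + t • w)) (T y) (fderiv ℝ T y w) := by
  refine ⟨by simp, ?_⟩
  have h1 : HasDerivAt (fun t : ℝ ↦ y + t • w) w 0 := by
    simpa using ((hasDerivAt_id (0 : ℝ)).smul_const w).const_add y
  have h2 : HasFDerivAt T (fderiv ℝ T y) (y + (0 : ℝ) • w) := by simpa using hT.hasFDerivAt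
  exact h2.comp_hasDerivAt 0 h1

theorem affine (x v : E) : HasJet (fun t : ℝ ↦ x - t • v) x (-v) := by
  refine ⟨by simp, ?_⟩
  simpa using ((hasDerivAt_id (0 : ℝ)).smul_const v).const_sub x

end HasJet

end Jets

/-- Lines through a point of an open set stay in it for small times. -/
theorem eventually_mem_line {V : Type*} [NormedAddCommGroup V] [NormedSpace ℝ V] {Ω : Set V}
    (hΩ : IsOpen Ω) {y : V} (hy : y ∈ Ω) (w : V) : ∀ᶠ t : ℝ in nhds 0, y + t • w ∈ Ω := by
  have h1 : ContinuousAt (fun t : ℝ ↦ y + t • w) 0 := by fun_prop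
  apply h1.eventually_mem
  simpa using hΩ.mem_nhds hy

/-! ### The Levi-Civita connection of a metric on an open set -/

namespace LocalGeometry

variable {V : Type*} [NormedAddCommGroup V] [NormedSpace ℝ V]

/-- `G` is a Riemannian metric on the open set `Ω`. Five derivatives are enough for all the
identities which follow. -/
structure IsMetricOn (G : V → V →L[ℝ] V →L[ℝ] ℝ) (Ω : Set V) : Prop where
  isOpen : IsOpen Ω
  contDiffAt : ∀ y ∈ Ω, ContDiffAt ℝ 5 G y
  symm : ∀ y ∈ Ω, ∀ u v, G y u v = G y v u
  pos : ∀ y ∈ Ω, ∀ u, u ≠ 0 → 0 < G y u u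

/-- The Christoffel map as a bilinear map. -/
noncomputable def gam (G : V → V →L[ℝ] V →L[ℝ] ℝ) (y : V) : V →L[ℝ] V →L[ℝ] V :=
  (ContinuousLinearMap.compL ℝ V (V →L[ℝ] ℝ) V ((G y).inverse)) ∘L ((1 / 2 : ℝ) •
    (fderiv ℝ G y + (fderiv ℝ G y).flip
      - (ContinuousLinearMap.flipₗᵢ ℝ V V ℝ).toContinuousLinearEquiv.toContinuousLinearMap ∘L
        (fderiv ℝ G y).flip))

theorem gam_apply (G : V → V →L[ℝ] V →L[ℝ] ℝ) (y u v : V) : gam G y u v = christoffel G y u v := by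
  simp only [gam, christoffel]
  rfl

theorem contDiffAt_gam_aux {G : V → V →L[ℝ] V →L[ℝ] ℝ} {y : V} (hG : ContDiffAt ℝ 5 G y)
    (hinv : ContDiffAt ℝ 4 (fun z ↦ (G z).inverse) y) : ContDiffAt ℝ 4 (gam G) y := by
  have h1 : ContDiffAt ℝ 4 (fderiv ℝ G) y := hG.fderiv_right (by norm_num)
  have h2 : ContDiffAt ℝ 4 (fun z ↦ (fderiv ℝ G z).flip) y :=
    (ContinuousLinearMap.flipₗᵢ ℝ V V (V →L[ℝ] ℝ)).toContinuousLinearEquiv.contDiff.contDiffAt.comp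
      y h1
  refine ContDiffAt.clm_comp ?_ ?_
  · exact (ContinuousLinearMap.compL ℝ V (V →L[ℝ] ℝ) V).contDiff.contDiffAt.comp y hinv
  · exact ((h1.add h2).sub (contDiffAt_const.clm_comp h2)).const_smul _

namespace IsMetricOn

variable {G : V → V →L[ℝ] V →L[ℝ] ℝ} {Ω : Set V} (hG : IsMetricOn G Ω) {y : V} (hy : y ∈ Ω)
include hG hy

theorem eventually_mem : ∀ᶠ z in nhds y, z ∈ Ω := hG.isOpen.mem_nhds hy

theorem eq_of_forall {u v : V} (h : ∀ w, G y u w = G y v w) : u = v := by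
  by_contra hne
  have := hG.pos y hy (u - v) (sub_ne_zero.mpr hne)
  have h0 : G y (u - v) (u - v) = 0 := by
    rw [map_sub (G y), sub_apply, h, sub_self]
  exact this.ne' h0

variable [FiniteDimensional ℝ V]

theorem exists_equiv : ∃ e : V ≃L[ℝ] (V →L[ℝ] ℝ), (e : V →L[ℝ] V →L[ℝ] ℝ) = G y := by
  have hinj : Function.Injective (G y : V →ₗ[ℝ] V →L[ℝ] ℝ) := fun u v h ↦
    hG.eq_of_forall hy fun w ↦ by
      have : G y u = G y v := h
      rw [this]
  have hdim : finrank ℝ V = finrank ℝ (V →L[ℝ] ℝ) := by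
    rw [← (LinearMap.toContinuousLinearMap : (V →ₗ[ℝ] ℝ) ≃ₗ[ℝ] V →L[ℝ] ℝ).finrank_eq]
    exact Subspace.dual_finrank_eq.symm
  refine ⟨(LinearEquiv.ofInjectiveOfFinrankEq _ hinj hdim).toContinuousLinearEquiv, ?_⟩
  ext u v
  rfl

theorem apply_inverse (φ : V →L[ℝ] ℝ) : G y ((G y).inverse φ) = φ := by
  obtain ⟨e, he⟩ := hG.exists_equiv hy
  rw [← he, ContinuousLinearMap.inverse_equiv]
  simp

theorem koszul (u v w : V) : G y (gam G y u v) w = 1 / 2 *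
    (fderiv ℝ G y u v w + fderiv ℝ G y v u w - fderiv ℝ G y w u v) := by
  rw [gam_apply, christoffel, hG.apply_inverse hy]
  simp

theorem contDiffAt_gam : ContDiffAt ℝ 4 (gam G) y := by
  obtain ⟨e, he⟩ := hG.exists_equiv hy
  refine contDiffAt_gam_aux (hG.contDiffAt y hy) ?_
  have h1 : ContDiffAt ℝ 4 ContinuousLinearMap.inverse (G y) := he ▸ contDiffAt_map_inverse e
  exact h1.comp y ((hG.contDiffAt y hy).of_le (by norm_num))

omit [FiniteDimensional ℝ V] in
theorem differentiableAt : DifferentiableAt ℝ G y :=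
  (hG.contDiffAt y hy).differentiableAt (by norm_num)

theorem differentiableAt_gam : DifferentiableAt ℝ (gam G) y :=
  (hG.contDiffAt_gam hy).differentiableAt (by norm_num)

theorem differentiableAt_fderiv_gam : DifferentiableAt ℝ (fderiv ℝ (gam G)) y :=
  ((hG.contDiffAt_gam hy).fderiv_right (m := 3) (by norm_num)).differentiableAt (by norm_num)

omit [FiniteDimensional ℝ V] in
theorem fderiv_symm (w u v : V) : fderiv ℝ G y w u v = fderiv ℝ G y w v u := by
  have h1 := ((HasJet.along (hG.differentiableAt hy) w).apply (.const u)).apply (.const v)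
  have h2 := ((HasJet.along (hG.differentiableAt hy) w).apply (.const v)).apply (.const u)
  have h3 := h2.congr (f₁ := fun t : ℝ ↦ G (y + t • w) u v) (by
    filter_upwards [eventually_mem_line hG.isOpen hy w] with t ht
    exact hG.symm _ ht u v)
  simpa using h1.unique h3

theorem gam_symm (u v : V) : gam G y u v = gam G y v u :=
  hG.eq_of_forall hy fun w ↦ by
    rw [hG.koszul hy, hG.koszul hy, hG.fderiv_symm hy w u v]
    ring

theorem compat (w u v : V) :
    fderiv ℝ G y w u v = G y (gam G y w u) v + G y u (gam G y w v) := by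
  rw [hG.symm y hy u, hG.koszul hy, hG.koszul hy, hG.fderiv_symm hy w v u,
    hG.fderiv_symm hy u w v, hG.fderiv_symm hy v w u]
  ring

theorem fderiv_gam_symm (w u v : V) :
    fderiv ℝ (gam G) y w u v = fderiv ℝ (gam G) y w v u := by
  have h1 := ((HasJet.along (hG.differentiableAt_gam hy) w).apply (.const u)).apply (.const v)
  have h2 := ((HasJet.along (hG.differentiableAt_gam hy) w).apply (.const v)).apply (.const u)
  have h3 := h2.congr (f₁ := fun t : ℝ ↦ gam G (y + t • w) u v) (by
    filter_upwards [eventually_mem_line hG.isOpen hy w] with t ht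
    exact hG.gam_symm ht u v)
  simpa using h1.unique h3

theorem curvature_eq (u v w : V) : curvature G y u v w =
    fderiv ℝ (gam G) y u v w - fderiv ℝ (gam G) y v u w
      + gam G y u (gam G y v w) - gam G y v (gam G y u w) := by
  have key : ∀ u v w : V,
      fderiv ℝ (fun z ↦ christoffel G z v w) y u = fderiv ℝ (gam G) y u v w := by
    intro u v w
    have h1 : (fun z ↦ christoffel G z v w) = fun z ↦ gam G z v w := by
      ext z
      rw [gam_apply]
    rw [h1]
    have h2 := ((hG.differentiableAt_gam hy).hasFDerivAt.clm_apply
      (hasFDerivAt_const v y)).clm_apply (hasFDerivAt_const w y)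
    rw [h2.fderiv]
    simp
  simp only [curvature, key, gam_apply]

end IsMetricOn

end LocalGeometry

/-! ### The identities of Bianchi and Ricci -/

namespace LocalGeometry

variable {V : Type*} [NormedAddCommGroup V] [NormedSpace ℝ V]

/-- The curvature tensor `R(x, v, z, u) = G(R(x, v) z, u)`. -/
noncomputable def curvatureForm (G : V → V →L[ℝ] V →L[ℝ] ℝ) (y x v z u : V) : ℝ :=
  G y (curvature G y x v z) u

/-- The jet at `0` of the vector field along the line `t ↦ y + t w` with value `x` at `y` and
vanishing covariant derivative at `y`. -/
noncomputable def parallelJet (G : V → V →L[ℝ] V →L[ℝ] ℝ) (y w x : V) (t : ℝ) : V :=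
  x - t • gam G y w x

theorem hasJet_parallelJet (G : V → V →L[ℝ] V →L[ℝ] ℝ) (y w x : V) :
    HasJet (parallelJet G y w x) x (-gam G y w x) :=
  .affine _ _

/-- The covariant derivative `∇_w` of the part `(x, v, z) ↦ DΓ(x)(v, z) + Γ(x, Γ(v, z))` of the
curvature operator. -/
noncomputable def covDerivHalfCurvature (G : V → V →L[ℝ] V →L[ℝ] ℝ) (y w x v z : V) : V :=
  fderiv ℝ (fderiv ℝ (gam G)) y w x v z - fderiv ℝ (gam G) y (gam G y w x) v z
    - fderiv ℝ (gam G) y x (gam G y w v) z - fderiv ℝ (gam G) y x v (gam G y w z)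
    + fderiv ℝ (gam G) y w x (gam G y v z) - gam G y (gam G y w x) (gam G y v z)
    + gam G y x (fderiv ℝ (gam G) y w v z - gam G y (gam G y w v) z - gam G y v (gam G y w z))
    + gam G y w (fderiv ℝ (gam G) y x v z + gam G y x (gam G y v z))

/-- The covariant derivative of a field of endomorphisms, as a bilinear map. -/
noncomputable def covDerivEndL (G : V → V →L[ℝ] V →L[ℝ] ℝ) (J : V → V →L[ℝ] V) (y : V) :
    V →ₗ[ℝ] V →ₗ[ℝ] V :=
  LinearMap.mk₂ ℝ (covDerivEnd G J y)
    (fun _ _ _ ↦ by simp only [covDerivEnd, ← gam_apply, map_add, add_apply]; abel)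
    (fun _ _ _ ↦ by simp only [covDerivEnd, ← gam_apply, map_smul, smul_apply, smul_sub, smul_add])
    (fun _ _ _ ↦ by simp only [covDerivEnd, ← gam_apply, map_add]; abel)
    (fun _ _ _ ↦ by simp only [covDerivEnd, ← gam_apply, map_smul, smul_sub, smul_add])

/-- The second covariant derivative `(∇²_{c, a} J) z`. -/
noncomputable def secondCovDerivEnd (G : V → V →L[ℝ] V →L[ℝ] ℝ) (J : V → V →L[ℝ] V)
    (y c a z : V) : V :=
  fderiv ℝ (fderiv ℝ J) y c a z - fderiv ℝ J y (gam G y c a) z - fderiv ℝ J y a (gam G y c z)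
    + (fderiv ℝ (gam G) y c a (J y z) - gam G y (gam G y c a) (J y z)
      + gam G y a (fderiv ℝ J y c z - J y (gam G y c z)))
    - (fderiv ℝ J y c (gam G y a z)
      + J y (fderiv ℝ (gam G) y c a z - gam G y (gam G y c a) z - gam G y a (gam G y c z)))
    + gam G y c (fderiv ℝ J y a z + gam G y a (J y z) - J y (gam G y a z))

namespace IsMetricOn

variable {G : V → V →L[ℝ] V →L[ℝ] ℝ} {Ω : Set V} (hG : IsMetricOn G Ω) {y : V} (hy : y ∈ Ω)
  [FiniteDimensional ℝ V]
include hG hy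

theorem isCurvatureLike : IsCurvatureLike (curvatureForm G y) where
  add_left x x' v z u := by
    simp only [curvatureForm, hG.curvature_eq hy, map_add, map_sub, add_apply, sub_apply]
    ring
  smul_left c x v z u := by
    simp only [curvatureForm, hG.curvature_eq hy, map_add, map_sub, add_apply, sub_apply, map_smul,
      smul_apply, smul_eq_mul]
    ring
  skew x v z u := by
    simp only [curvatureForm, hG.curvature_eq hy, map_add, map_sub, add_apply, sub_apply]
    ring
  skew' x v z u := by
    -- the second derivatives of the metric commute
    have key : ∀ a b : V, fderiv ℝ (fderiv ℝ G) y a b z u =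
        (G y (gam G y a (gam G y b z)) u + G y (gam G y b z) (gam G y a u))
          + G y (fderiv ℝ (gam G) y a b z) u
        + ((G y (gam G y a z) (gam G y b u) + G y z (gam G y a (gam G y b u)))
          + G y z (fderiv ℝ (gam G) y a b u)) := by
      intro a b
      have hd : DifferentiableAt ℝ (fderiv ℝ G) y :=
        ((hG.contDiffAt y hy).fderiv_right (m := 4) (by norm_num)).differentiableAt (by norm_num)
      have h1 := (((HasJet.along hd a).apply (.const b)).apply (.const z)).apply (.const u)
      have hg := HasJet.along (hG.differentiableAt hy) a
      have hc := (HasJet.along (hG.differentiableAt_gam hy) a).apply (.const b)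
      have h2 := ((hg.apply (hc.apply (.const z))).apply (.const u)).add
        ((hg.apply (.const z)).apply (hc.apply (.const u)))
      have h3 := h1.unique (h2.congr (by
        filter_upwards [eventually_mem_line hG.isOpen hy a] with t ht
        exact hG.compat ht b z u))
      simp only [map_zero, add_zero, add_apply, hG.compat hy] at h3
      rw [h3]
    have hs : fderiv ℝ (fderiv ℝ G) y x v z u = fderiv ℝ (fderiv ℝ G) y v x z u := by
      have := (hG.contDiffAt y hy).isSymmSndFDerivAt (by simp; norm_num)
      rw [this.eq]
    rw [key, key] at hs
    simp only [curvatureForm, hG.curvature_eq hy, map_add, map_sub, add_apply, sub_apply]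
    simp only [hG.symm y hy _ z] at hs ⊢
    linarith
  bianchi x v z u := by
    simp only [curvatureForm, hG.curvature_eq hy, map_add, map_sub, add_apply, sub_apply]
    rw [hG.gam_symm hy z x, hG.gam_symm hy z v, hG.gam_symm hy v x,
      hG.fderiv_gam_symm hy z x v, hG.fderiv_gam_symm hy x z v, hG.fderiv_gam_symm hy v z x]
    ring

/-- Differentiation of `G(A, X)` along a line: the metric is parallel. -/
theorem hasJet_metric {w x a a' : V} {A : ℝ → V} (hA : HasJet A a a') :
    HasJet (fun t : ℝ ↦ G (y + t • w) (A t) (parallelJet G y w x t)) (G y a x)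
      (G y (a' + gam G y w a) x) := by
  have h1 := ((HasJet.along (hG.differentiableAt hy) w).apply hA).apply (hasJet_parallelJet G y w x)
  convert h1 using 1
  simp only [add_apply, hG.compat hy, map_neg, map_add]
  ring

theorem hasJet_metric_parallel (w x z : V) :
    HasJet (fun t : ℝ ↦ G (y + t • w) (parallelJet G y w x t) (parallelJet G y w z t)) (G y x z)
      0 := by
  convert hG.hasJet_metric hy (x := z) (hasJet_parallelJet G y w x) using 1
  simp

/-- The covariant derivative of the curvature tensor. -/
theorem hasJet_curvatureForm (w x v z u : V) :
    HasJet (fun t : ℝ ↦ curvatureForm G (y + t • w) (parallelJet G y w x t)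
      (parallelJet G y w v t) (parallelJet G y w z t) (parallelJet G y w u t))
      (curvatureForm G y x v z u)
      (G y (covDerivHalfCurvature G y w x v z - covDerivHalfCurvature G y w v x z) u) := by
  have hc := HasJet.along (hG.differentiableAt_gam hy) w
  have hd := HasJet.along (hG.differentiableAt_fderiv_gam hy) w
  have hX := fun x ↦ hasJet_parallelJet G y w x
  have hhalf := fun x v ↦ (((hd.apply (hX x)).apply (hX v)).apply (hX z)).add
    ((hc.apply (hX x)).apply ((hc.apply (hX v)).apply (hX z)))
  have h1 := hG.hasJet_metric hy (w := w) (x := u) ((hhalf x v).sub (hhalf v x))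
  have h2 := h1.congr (f₁ := fun t : ℝ ↦ curvatureForm G (y + t • w) (parallelJet G y w x t)
      (parallelJet G y w v t) (parallelJet G y w z t) (parallelJet G y w u t)) (by
    filter_upwards [eventually_mem_line hG.isOpen hy w] with t ht
    rw [curvatureForm, hG.curvature_eq ht]
    congr 2
    abel)
  convert h2 using 1
  · rw [curvatureForm, hG.curvature_eq hy]
    congr 2
    abel
  · congr 2
    simp only [covDerivHalfCurvature, map_add, map_sub, map_neg, add_apply, neg_apply]
    abel

/-- The second Bianchi identity. -/
theorem second_bianchi (w x v z u : V) :
    G y (covDerivHalfCurvature G y w x v z - covDerivHalfCurvature G y w v x z) u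
    + G y (covDerivHalfCurvature G y x v w z - covDerivHalfCurvature G y x w v z) u
    + G y (covDerivHalfCurvature G y v w x z - covDerivHalfCurvature G y v x w z) u = 0 := by
  have hs : ∀ a b : V, fderiv ℝ (fderiv ℝ (gam G)) y a b = fderiv ℝ (fderiv ℝ (gam G)) y b a :=
    fun a b ↦ ((hG.contDiffAt_gam hy).isSymmSndFDerivAt (by simp; norm_num)).eq a b
  rw [← add_apply, ← add_apply, ← map_add, ← map_add]
  have : ∀ a : V, a = 0 → G y a u = 0 := fun a ha ↦ by simp [ha]
  apply this
  simp only [covDerivHalfCurvature, map_add, map_sub]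
  rw [hs x w, hs v w, hs v x, hG.gam_symm hy x w, hG.gam_symm hy v w, hG.gam_symm hy v x]
  abel

variable {J : V → V →L[ℝ] V} (hJ : ContDiffAt ℝ 5 J y)
include hJ

omit hG hy [FiniteDimensional ℝ V] in
theorem hasJet_complex (w : V) {x x' : V} {X : ℝ → V} (hX : HasJet X x x') :
    HasJet (fun t : ℝ ↦ J (y + t • w) (X t)) (J y x) (fderiv ℝ J y w x + J y x') :=
  (HasJet.along (hJ.differentiableAt (by norm_num)) w).apply hX

/-- The covariant derivative of the fundamental form. -/
theorem hasJet_fundForm (w x z : V) :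
    HasJet (fun t : ℝ ↦ fundForm (G (y + t • w)) (J (y + t • w)) (parallelJet G y w x t)
      (parallelJet G y w z t)) (fundForm (G y) (J y) x z)
      (G y x (covDerivEnd G J y w z)) := by
  have h1 := hG.hasJet_metric hy (w := w) (x := x)
    (hasJet_complex hJ w (hasJet_parallelJet G y w z))
  have h2 := h1.congr (f₁ := fun t : ℝ ↦ fundForm (G (y + t • w)) (J (y + t • w))
      (parallelJet G y w x t) (parallelJet G y w z t)) (by
    filter_upwards [eventually_mem_line hG.isOpen hy w] with t ht
    exact hG.symm _ ht _ _)
  convert h2 using 1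
  · exact hG.symm y hy _ _
  · rw [hG.symm y hy]
    congr 2
    simp only [covDerivEnd, gam_apply, map_neg]
    abel

/-- The second covariant derivative of the fundamental form. -/
theorem hasJet_covDerivEnd (c a x z : V) :
    HasJet (fun t : ℝ ↦ G (y + t • c) (parallelJet G y c x t)
      (covDerivEnd G J (y + t • c) (parallelJet G y c a t) (parallelJet G y c z t)))
      (G y x (covDerivEnd G J y a z)) (G y x (secondCovDerivEnd G J y c a z)) := by
  have hX := fun x ↦ hasJet_parallelJet G y c x
  have hd : DifferentiableAt ℝ (fderiv ℝ J) y :=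
    (hJ.fderiv_right (m := 4) (by norm_num)).differentiableAt (by norm_num)
  have hΓ := HasJet.along (hG.differentiableAt_gam hy) c
  have h1 := hG.hasJet_metric hy (w := c) (x := x)
    (((((HasJet.along hd c).apply (hX a)).apply (hX z)).add
      ((hΓ.apply (hX a)).apply (hasJet_complex hJ c (hX z)))).sub
      (hasJet_complex hJ c ((hΓ.apply (hX a)).apply (hX z))))
  have h2 := h1.congr (f₁ := fun t : ℝ ↦ G (y + t • c) (parallelJet G y c x t)
      (covDerivEnd G J (y + t • c) (parallelJet G y c a t) (parallelJet G y c z t))) (by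
    filter_upwards [eventually_mem_line hG.isOpen hy c] with t ht
    rw [hG.symm _ ht]
    simp only [covDerivEnd, gam_apply])
  convert h2 using 1
  · rw [hG.symm y hy]
    simp only [covDerivEnd, gam_apply]
  · rw [hG.symm y hy]
    congr 2
    simp only [secondCovDerivEnd, map_add, map_sub, map_neg, add_apply, neg_apply]
    abel

/-- The Ricci identity for the field of endomorphisms `J`. -/
theorem ricci_identity (c a z : V) :
    secondCovDerivEnd G J y c a z - secondCovDerivEnd G J y a c z =
      curvature G y c a (J y z) - J y (curvature G y c a z) := by
  have hs : fderiv ℝ (fderiv ℝ J) y a c = fderiv ℝ (fderiv ℝ J) y c a :=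
    (hJ.isSymmSndFDerivAt (by simp; norm_num)).eq a c
  simp only [secondCovDerivEnd, hG.curvature_eq hy, map_add, map_sub]
  rw [hs, hG.gam_symm hy a c]
  abel

end IsMetricOn

end LocalGeometry

/-! ### Curvature tensors of the form `ν π₁ + ψ(F, Φ)` on an open set -/

namespace LocalGeometry

variable {V : Type*} [NormedAddCommGroup V] [NormedSpace ℝ V]

/-- An almost Hermitian structure on an open set whose curvature satisfies the `AH₃` identity and
has pointwise constant antiholomorphic sectional curvature. -/
structure IsAntiholomorphicModel (G : V → V →L[ℝ] V →L[ℝ] ℝ) (J : V → V →L[ℝ] V) (Ω : Set V) :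
    Prop where
  metric : IsMetricOn G Ω
  contDiffAt_J : ∀ y ∈ Ω, ContDiffAt ℝ 5 J y
  herm : ∀ y ∈ Ω, IsHermitianPair (G y) (J y)
  ah3 : ∀ y ∈ Ω, ∀ x v z u,
    curvatureForm G y (J y x) (J y v) (J y z) (J y u) = curvatureForm G y x v z u
  anti : ∀ y ∈ Ω, ∃ ν : ℝ, ∀ x z, G y x (J y z) = 0 →
    curvatureForm G y x z z x = ν * constCurv (G y) x z z x

/-- An almost Hermitian structure on an open set whose curvature tensor is `ν π₁ + ψ(F, Φ)`, with
a `J`-invariant `2`-form `Φ`. -/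
structure IsTwoFormModel (G : V → V →L[ℝ] V →L[ℝ] ℝ) (J : V → V →L[ℝ] V) (ν : V → ℝ)
    (Φ : V → V →L[ℝ] V →L[ℝ] ℝ) (Ω : Set V) : Prop where
  metric : IsMetricOn G Ω
  contDiffAt_J : ∀ y ∈ Ω, ContDiffAt ℝ 5 J y
  herm : ∀ y ∈ Ω, IsHermitianPair (G y) (J y)
  differentiableAt_ν : ∀ y ∈ Ω, DifferentiableAt ℝ ν y
  differentiableAt_Φ : ∀ y ∈ Ω, DifferentiableAt ℝ Φ y
  Φ_skew : ∀ y ∈ Ω, ∀ x z, Φ y x z = -Φ y z x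
  Φ_J : ∀ y ∈ Ω, ∀ x z, Φ y (J y x) (J y z) = Φ y x z
  curv : ∀ y ∈ Ω, ∀ x v z u, curvatureForm G y x v z u = ν y * constCurv (G y) x v z u +
    twoFormCurv (fun a b ↦ fundForm (G y) (J y) a b) (fun a b ↦ Φ y a b) x v z u

theorem exists_ne_zero_of_four_forms [FiniteDimensional ℝ V] (hdim : 4 < finrank ℝ V)
    (φ₁ φ₂ φ₃ φ₄ : V →L[ℝ] ℝ) :
    ∃ z, z ≠ 0 ∧ φ₁ z = 0 ∧ φ₂ z = 0 ∧ φ₃ z = 0 ∧ φ₄ z = 0 := by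
  let L : V →ₗ[ℝ] (Fin 4 → ℝ) :=
    LinearMap.pi ![φ₁.toLinearMap, φ₂.toLinearMap, φ₃.toLinearMap, φ₄.toLinearMap]
  have hker : LinearMap.ker L ≠ ⊥ := LinearMap.ker_ne_bot_of_finrank_lt (by simpa using hdim)
  obtain ⟨z, hz, hz0⟩ := (LinearMap.ker L).ne_bot_iff.mp hker
  have h := fun i ↦ congrFun (LinearMap.mem_ker.mp hz) i
  exact ⟨z, hz0, h 0, h 1, h 2, h 3⟩

theorem IsMetricOn.contDiffAt_curvatureForm [FiniteDimensional ℝ V]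
    {G : V → V →L[ℝ] V →L[ℝ] ℝ} {Ω : Set V} (hG : IsMetricOn G Ω) {y : V} (hy : y ∈ Ω)
    {a b c d : V → V} (ha : ContDiffAt ℝ 1 a y) (hb : ContDiffAt ℝ 1 b y)
    (hc : ContDiffAt ℝ 1 c y) (hd : ContDiffAt ℝ 1 d y) :
    ContDiffAt ℝ 1 (fun z ↦ curvatureForm G z (a z) (b z) (c z) (d z)) y := by
  have h1 : ContDiffAt ℝ 1 (gam G) y := (hG.contDiffAt_gam hy).of_le (by norm_num)
  have h2 : ContDiffAt ℝ 1 (fderiv ℝ (gam G)) y := (hG.contDiffAt_gam hy).fderiv_right (by norm_num)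
  have h3 : ContDiffAt ℝ 1 G y := (hG.contDiffAt y hy).of_le (by norm_num)
  have h4 : ContDiffAt ℝ 1 (fun z ↦ G z (fderiv ℝ (gam G) z (a z) (b z) (c z)
      - fderiv ℝ (gam G) z (b z) (a z) (c z) + gam G z (a z) (gam G z (b z) (c z))
      - gam G z (b z) (gam G z (a z) (c z))) (d z)) y := by
    fun_prop
  refine h4.congr_of_eventuallyEq ?_
  filter_upwards [hG.eventually_mem hy] with z hz
  rw [curvatureForm, hG.curvature_eq hz]

namespace IsAntiholomorphicModel

variable {G : V → V →L[ℝ] V →L[ℝ] ℝ} {J : V → V →L[ℝ] V} {Ω : Set V}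

/-- The function `ν` and the form `Φ` are as smooth as needed, since they are rational expressions
in the curvature, the metric and the complex structure. -/
theorem exists_twoFormModel [FiniteDimensional ℝ V] (h : IsAntiholomorphicModel G J Ω)
    (hdim : 4 < finrank ℝ V) : ∃ ν Φ, IsTwoFormModel G J ν Φ Ω := by
  have hν' : ∀ y, ∃ ν : ℝ, y ∈ Ω → ∀ x z, G y x (J y z) = 0 →
      curvatureForm G y x z z x = ν * constCurv (G y) x z z x := fun y ↦ by
    by_cases hy : y ∈ Ω
    · obtain ⟨ν, hν⟩ := h.anti y hy
      exact ⟨ν, fun _ ↦ hν⟩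
    · exact ⟨0, fun hy' ↦ absurd hy' hy⟩
  choose ν hν using hν'
  have hΦ' : ∀ y, ∃ Φ : V →L[ℝ] V →L[ℝ] ℝ, y ∈ Ω →
      (∀ x z, Φ x z = secondForm (G y) (J y) (curvatureForm G y) (ν y) x z) ∧
      (∀ x z, Φ x z = -Φ z x) ∧ (∀ x z, Φ (J y x) (J y z) = Φ x z) ∧
      ∀ x v z u, curvatureForm G y x v z u = ν y * constCurv (G y) x v z u +
        twoFormCurv (fun a b ↦ fundForm (G y) (J y) a b) (fun a b ↦ Φ a b) x v z u := fun y ↦ by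
    by_cases hy : y ∈ Ω
    · obtain ⟨Φ, hΦ⟩ := exists_secondForm (h.herm y hy) (h.metric.isCurvatureLike hy)
        (h.ah3 y hy) (hν y hy)
      exact ⟨Φ, fun _ ↦ hΦ⟩
    · exact ⟨0, fun hy' ↦ absurd hy' hy⟩
  choose Φ hΦ using hΦ'
  -- `ν` is the curvature of a plane spanned by `x` and a smooth field `z + c J x`
  have hνd : ∀ y ∈ Ω, ContDiffAt ℝ 1 ν y := by
    intro y hy
    have hg := h.herm y hy
    have : Nontrivial V := Module.nontrivial_of_finrank_pos (R := ℝ) (by omega)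
    obtain ⟨x, hx⟩ := exists_ne (0 : V)
    obtain ⟨z, hz, hz1, hz2, -, -⟩ := exists_ne_zero_of_four_forms hdim (G y x) (fundForm (G y) (J y) x)
      0 0
    rw [fundForm_apply] at hz2
    have hGy : ContDiffAt ℝ 1 G y := (h.metric.contDiffAt y hy).of_le (by norm_num)
    have hJy : ContDiffAt ℝ 1 J y := (h.contDiffAt_J y hy).of_le (by norm_num)
    have hxx : G y x x ≠ 0 := (hg.pos x hx).ne'
    let Z : V → V := fun p ↦ z + (G p x (J p z) / G p x x) • J p x
    have hZ : ContDiffAt ℝ 1 Z y := by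
      have h1 : ContDiffAt ℝ 1 (fun p ↦ G p x (J p z) / G p x x) y := by
        refine ContDiffAt.div ?_ ?_ hxx <;> fun_prop
      have h2 : ContDiffAt ℝ 1 (fun p ↦ J p x) y := by fun_prop
      exact contDiffAt_const.add (h1.smul h2)
    have hZy : Z y = z := by simp [Z, hz2]
    have hden : ContDiffAt ℝ 1 (fun p ↦ constCurv (G p) x (Z p) (Z p) x) y := by
      unfold constCurv
      fun_prop
    have hden0 : constCurv (G y) x (Z y) (Z y) x ≠ 0 := by
      rw [hZy, constCurv, hz1, zero_mul, sub_zero]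
      exact mul_ne_zero hxx (hg.pos z hz).ne'
    have hnum := h.metric.contDiffAt_curvatureForm hy (contDiffAt_const (c := x)) hZ hZ
      (contDiffAt_const (c := x))
    refine (hnum.div hden hden0).congr_of_eventuallyEq ?_
    filter_upwards [h.metric.eventually_mem hy, hden.continuousAt.eventually_ne hden0]
      with p hp hp0
    have hgp := h.herm p hp
    have hxp : G p x x ≠ 0 := (hgp.pos x hx).ne'
    change ν p = curvatureForm G p x (Z p) (Z p) x / constCurv (G p) x (Z p) (Z p) x
    rw [hν p hp x (Z p) (by
      simp only [Z, map_add, map_smul, hgp.J_J, map_neg, smul_eq_mul]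
      field_simp
      ring)]
    field_simp
  have hΦd : ContDiffOn ℝ 1 Φ Ω := by
    refine contDiffOn_clm_apply.mpr fun x ↦ contDiffOn_clm_apply.mpr fun z ↦ ?_
    intro y hy
    refine ContDiffAt.contDiffWithinAt ?_
    have hGy : ContDiffAt ℝ 1 G y := (h.metric.contDiffAt y hy).of_le (by norm_num)
    have hJy : ContDiffAt ℝ 1 J y := (h.contDiffAt_J y hy).of_le (by norm_num)
    have hνy := hνd y hy
    have key : ContDiffAt ℝ 1
        (fun p ↦ secondForm (G p) (J p) (curvatureForm G p) (ν p) x z) y := by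
      rcases eq_or_ne x 0 with rfl | hx
      · have : (fun p ↦ secondForm (G p) (J p) (curvatureForm G p) (ν p) 0 z) = fun _ ↦ 0 := by
          ext p
          simp [secondForm]
        rw [this]
        exact contDiffAt_const
      have hxx : G y x x ≠ 0 := ((h.herm y hy).pos x hx).ne'
      have hcx : ContDiffAt ℝ 1 (fun _ : V ↦ x) y := contDiffAt_const
      have hJx : ContDiffAt ℝ 1 (fun p ↦ J p x) y := by fun_prop
      have hcz : ContDiffAt ℝ 1 (fun _ : V ↦ z) y := contDiffAt_const
      have r1 := h.metric.contDiffAt_curvatureForm hy hcx hJx hJx hcx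
      have r2 := h.metric.contDiffAt_curvatureForm hy hcx hJx hcz hcx
      have hxx' : ContDiffAt ℝ 1 (fun p ↦ G p x x) y := by fun_prop
      have hFz : ContDiffAt ℝ 1 (fun p ↦ G p x (J p z)) y := by fun_prop
      have c1 : ContDiffAt ℝ 1 (fun p ↦ constCurv (G p) x (J p x) (J p x) x) y := by
        unfold constCurv
        fun_prop
      have c2 : ContDiffAt ℝ 1 (fun p ↦ constCurv (G p) x (J p x) z x) y := by
        unfold constCurv
        fun_prop
      unfold secondForm
      refine ContDiffAt.div (ContDiffAt.neg (ContDiffAt.add (hFz.mul (ContDiffAt.div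
        (r1.sub (hνy.mul c1)) (contDiffAt_const.mul hxx') (by simpa using hxx)))
        ((r2.sub (hνy.mul c2)).div_const 3))) hxx' hxx
    refine key.congr_of_eventuallyEq ?_
    filter_upwards [h.metric.eventually_mem hy] with p hp
    exact (hΦ p hp).1 x z
  refine ⟨ν, Φ, h.metric, h.contDiffAt_J, h.herm,
    fun y hy ↦ (hνd y hy).differentiableAt (by norm_num),
    fun y hy ↦ (hΦd.contDiffAt (h.metric.eventually_mem hy)).differentiableAt (by norm_num),
    fun y hy ↦ (hΦ y hy).2.1, fun y hy ↦ (hΦ y hy).2.2.1, fun y hy ↦ (hΦ y hy).2.2.2⟩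

end IsAntiholomorphicModel

end LocalGeometry

/-! ### The Bianchi system of a two-form model -/

namespace LocalGeometry

variable {V : Type*} [NormedAddCommGroup V] [NormedSpace ℝ V]

/-- The covariant derivative `(∇_w F)(x, z) = g(x, (∇_w J) z)` of the fundamental form. -/
noncomputable def covDerivForm (G : V → V →L[ℝ] V →L[ℝ] ℝ) (J : V → V →L[ℝ] V) (y : V) :
    V →ₗ[ℝ] V →ₗ[ℝ] V →ₗ[ℝ] ℝ :=
  LinearMap.mk₂ ℝ (fun w x ↦ (G y x).toLinearMap ∘ₗ covDerivEndL G J y w)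
    (fun _ _ _ ↦ by ext; simp) (fun _ _ _ ↦ by ext; simp) (fun _ _ _ ↦ by ext; simp)
    (fun _ _ _ ↦ by ext; simp)

theorem covDerivForm_apply (G : V → V →L[ℝ] V →L[ℝ] ℝ) (J : V → V →L[ℝ] V) (y w x z : V) :
    covDerivForm G J y w x z = G y x (covDerivEnd G J y w z) := rfl

/-- The covariant derivative `∇_w Φ` of a field of bilinear forms. -/
noncomputable def covDerivBilin (G Φ : V → V →L[ℝ] V →L[ℝ] ℝ) (y : V) :
    V →ₗ[ℝ] V →ₗ[ℝ] V →ₗ[ℝ] ℝ :=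
  LinearMap.mk₂ ℝ (fun w x ↦ (fderiv ℝ Φ y w x).toLinearMap - (Φ y (gam G y w x)).toLinearMap
      - (Φ y x ∘L gam G y w).toLinearMap)
    (fun _ _ _ ↦ by ext; simp; ring) (fun _ _ _ ↦ by ext; simp; ring)
    (fun _ _ _ ↦ by ext; simp; ring) (fun _ _ _ ↦ by ext; simp; ring)

theorem covDerivBilin_apply (G Φ : V → V →L[ℝ] V →L[ℝ] ℝ) (y w x z : V) :
    covDerivBilin G Φ y w x z =
      fderiv ℝ Φ y w x z - Φ y (gam G y w x) z - Φ y x (gam G y w z) := rfl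

theorem hasJet_bilin (G : V → V →L[ℝ] V →L[ℝ] ℝ) {Φ : V → V →L[ℝ] V →L[ℝ] ℝ} {y : V}
    (hΦ : DifferentiableAt ℝ Φ y) (w x z : V) :
    HasJet (fun t : ℝ ↦ Φ (y + t • w) (parallelJet G y w x t) (parallelJet G y w z t)) (Φ y x z)
      (covDerivBilin G Φ y w x z) := by
  convert ((HasJet.along hΦ w).apply (hasJet_parallelJet G y w x)).apply
    (hasJet_parallelJet G y w z) using 1
  rw [covDerivBilin_apply]
  simp only [add_apply, map_neg, neg_apply]
  ring

omit [NormedAddCommGroup V] [NormedSpace ℝ V] in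
theorem hasJet_twoFormCurv {F Φ : ℝ → V → V → ℝ} {F₀ F₁ Φ₀ Φ₁ : V → V → ℝ} {X : V → ℝ → V}
    (hF : ∀ x z, HasJet (fun t ↦ F t (X x t) (X z t)) (F₀ x z) (F₁ x z))
    (hΦ : ∀ x z, HasJet (fun t ↦ Φ t (X x t) (X z t)) (Φ₀ x z) (Φ₁ x z)) (x v z u : V) :
    HasJet (fun t ↦ twoFormCurv (F t) (Φ t) (X x t) (X v t) (X z t) (X u t))
      (twoFormCurv F₀ Φ₀ x v z u) (twoFormCurv F₁ Φ₀ x v z u + twoFormCurv F₀ Φ₁ x v z u) := by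
  have h2 : HasJet (fun _ : ℝ ↦ (2 : ℝ)) 2 0 := .const 2
  have := (((((hF x u).mul (hΦ v z)).sub ((hF x z).mul (hΦ v u))).sub
    ((h2.mul (hF x v)).mul (hΦ z u))).add ((hF v z).mul (hΦ x u))).sub ((hF v u).mul (hΦ x z))
  convert this.sub ((h2.mul (hF z u)).mul (hΦ x v)) using 1
  all_goals
    unfold twoFormCurv
    ring

namespace IsMetricOn

variable {G : V → V →L[ℝ] V →L[ℝ] ℝ} {Ω : Set V} (hG : IsMetricOn G Ω) {y : V} (hy : y ∈ Ω)
  [FiniteDimensional ℝ V]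
include hG hy

theorem hasJet_constCurv (w x v z u : V) :
    HasJet (fun t : ℝ ↦ constCurv (G (y + t • w)) (parallelJet G y w x t)
      (parallelJet G y w v t) (parallelJet G y w z t) (parallelJet G y w u t))
      (constCurv (G y) x v z u) 0 := by
  have hg := hG.hasJet_metric_parallel hy w
  convert ((hg x u).mul (hg v z)).sub ((hg x z).mul (hg v u)) using 1
  · rfl
  · rfl
  · ring

variable {J : V → V →L[ℝ] V} (hJ : ContDiffAt ℝ 5 J y)
  (hherm : ∀ y ∈ Ω, IsHermitianPair (G y) (J y))
include hJ hherm

omit [FiniteDimensional ℝ V] in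
theorem covDerivEnd_J (w x : V) :
    covDerivEnd G J y w (J y x) = -J y (covDerivEnd G J y w x) := by
  have h1 := hasJet_complex hJ w (hasJet_complex hJ w (HasJet.const x))
  have h2 := (HasJet.const x).neg.unique (h1.congr (by
    filter_upwards [eventually_mem_line hG.isOpen hy w] with t ht
    exact ((hherm _ ht).J_J x).symm))
  have hJJ := (hherm y hy).J_J
  simp only [covDerivEnd, ← gam_apply, map_add, map_sub, hJJ, map_zero, add_zero, neg_zero,
    map_neg] at h2 ⊢
  rw [eq_neg_iff_add_eq_zero]
  refine Eq.trans ?_ h2.symm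
  abel

theorem covDerivForm_skew (w x z : V) :
    covDerivForm G J y w x z = -covDerivForm G J y w z x := by
  have h1 := hG.hasJet_fundForm hy hJ w x z
  have h2 := (hG.hasJet_fundForm hy hJ w z x).neg
  exact h1.unique (h2.congr (by
    filter_upwards [eventually_mem_line hG.isOpen hy w] with t ht
    exact (hherm _ ht).fundForm_skew _ _))

omit [FiniteDimensional ℝ V] in
theorem covDerivForm_J_J (w x z : V) :
    covDerivForm G J y w (J y x) (J y z) = -covDerivForm G J y w x z := by
  rw [covDerivForm_apply, hG.covDerivEnd_J hy hJ hherm, map_neg, (hherm y hy).g_J_J,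
    covDerivForm_apply]

end IsMetricOn

namespace IsTwoFormModel

variable {G : V → V →L[ℝ] V →L[ℝ] ℝ} {J : V → V →L[ℝ] V} {ν : V → ℝ}
  {Φ : V → V →L[ℝ] V →L[ℝ] ℝ} {Ω : Set V} (h : IsTwoFormModel G J ν Φ Ω)
  [FiniteDimensional ℝ V] {y : V} (hy : y ∈ Ω)
include h hy

/-- The covariant derivative of the curvature tensor `ν π₁ + ψ(F, Φ)`. -/
theorem covDeriv_curvature (w x v z u : V) :
    G y (covDerivHalfCurvature G y w x v z - covDerivHalfCurvature G y w v x z) u =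
      fderiv ℝ ν y w * constCurv (G y) x v z u
      + twoFormCurv (fun a b ↦ covDerivForm G J y w a b) (fun a b ↦ Φ y a b) x v z u
      + twoFormCurv (fun a b ↦ fundForm (G y) (J y) a b)
          (fun a b ↦ covDerivBilin G Φ y w a b) x v z u := by
  have h1 := h.metric.hasJet_curvatureForm hy w x v z u
  have h2 := ((HasJet.along (h.differentiableAt_ν y hy) w).mul
    (h.metric.hasJet_constCurv hy w x v z u)).add (hasJet_twoFormCurv
      (F := fun t a b ↦ fundForm (G (y + t • w)) (J (y + t • w)) a b)
      (Φ := fun t a b ↦ Φ (y + t • w) a b)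
      (h.metric.hasJet_fundForm hy (h.contDiffAt_J y hy) w)
      (hasJet_bilin G (h.differentiableAt_Φ y hy) w) x v z u)
  have h3 := h1.unique (h2.congr (by
    filter_upwards [eventually_mem_line h.metric.isOpen hy w] with t ht
    exact h.curv _ ht _ _ _ _))
  rw [h3]
  simp only [covDerivForm_apply]
  ring

/-- Each of the conditions is the derivative of an identity which holds on the open set. -/
theorem isBianchiSystem : IsBianchiSystem (G y) (J y) (Φ y) (covDerivForm G J y)
    (covDerivBilin G Φ y) (fderiv ℝ ν y).toLinearMap where
  herm := h.herm y hy
  Φ_skew := h.Φ_skew y hy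
  Φ_J := h.Φ_J y hy
  S_skew := h.metric.covDerivForm_skew hy (h.contDiffAt_J y hy) h.herm
  P_skew w x z := by
    have h1 := hasJet_bilin G (h.differentiableAt_Φ y hy) w x z
    have h2 := (hasJet_bilin G (h.differentiableAt_Φ y hy) w z x).neg
    exact h1.unique (h2.congr (by
      filter_upwards [eventually_mem_line h.metric.isOpen hy w] with t ht
      exact h.Φ_skew _ ht _ _))
  S_J := h.metric.covDerivForm_J_J hy (h.contDiffAt_J y hy) h.herm
  P_J := by
    refine ⟨covDerivEnd G J y, covDerivForm_apply G J y, fun w x z ↦ ?_⟩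
    have hX := fun x ↦ IsMetricOn.hasJet_complex (h.contDiffAt_J y hy) w
      (hasJet_parallelJet G y w x)
    have h1 := ((HasJet.along (h.differentiableAt_Φ y hy) w).apply (hX x)).apply (hX z)
    have h2 := (hasJet_bilin G (h.differentiableAt_Φ y hy) w x z).unique (h1.congr (by
      filter_upwards [eventually_mem_line h.metric.isOpen hy w] with t ht
      exact (h.Φ_J _ ht _ _).symm))
    rw [h2, covDerivBilin_apply]
    simp only [covDerivEnd, ← gam_apply, map_add, map_sub, map_neg, add_apply, sub_apply, neg_apply]
    ring
  bianchi w x v z u := by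
    have h1 := h.metric.second_bianchi hy w x v z u
    rw [h.covDeriv_curvature hy, h.covDeriv_curvature hy, h.covDeriv_curvature hy] at h1
    exact h1

end IsTwoFormModel

end LocalGeometry

/-! ### The second form is a multiple of the fundamental form -/

section Pointwise

variable {V : Type*} [NormedAddCommGroup V] [NormedSpace ℝ V]
  {g : V →L[ℝ] V →L[ℝ] ℝ} {J : V →L[ℝ] V} {Φ : V →L[ℝ] V →L[ℝ] ℝ}

/-- A linear form vanishes if it does so on a complex line and on its orthogonal complement. -/
theorem IsHermitianPair.apply_eq_zero_of_line (hg : IsHermitianPair g J) {e : V} (he : g e e = 1)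
    (L : V →ₗ[ℝ] ℝ) (h1 : L e = 0) (h2 : L (J e) = 0)
    (h3 : ∀ v, IsComplexOrthogonal g J e v → L v = 0) (v : V) : L v = 0 := by
  have h4 := h3 (v - g e v • e - g (J e) v • J e)
    ⟨by simp [he, hg.g_J_self], by simp [he, hg.J_J, hg.g_J_left, hg.g_J_self]⟩
  simpa [h1, h2] using h4

theorem IsHermitianPair.exists_unit_of_four_forms [FiniteDimensional ℝ V]
    (hg : IsHermitianPair g J) (hdim : 4 < finrank ℝ V) (φ₁ φ₂ φ₃ φ₄ : V →L[ℝ] ℝ) :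
    ∃ z, g z z = 1 ∧ φ₁ z = 0 ∧ φ₂ z = 0 ∧ φ₃ z = 0 ∧ φ₄ z = 0 := by
  obtain ⟨z, hz, h1, h2, h3, h4⟩ := LocalGeometry.exists_ne_zero_of_four_forms hdim φ₁ φ₂ φ₃ φ₄
  have hpos := hg.pos z hz
  refine ⟨(√(g z z))⁻¹ • z, ?_, by simp [h1], by simp [h2], by simp [h3], by simp [h4]⟩
  have hs := Real.mul_self_sqrt hpos.le
  have hs0 : √(g z z) ≠ 0 := (Real.sqrt_pos.mpr hpos).ne'
  simp only [map_smul, smul_apply, smul_eq_mul]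
  field_simp
  rw [pow_two, hs]

/-- A vector orthogonal to all the lines whose eigenvalue differs from `r` is an eigenvector. -/
theorem IsUnitaryEigenbasis.apply_eq_of_orthogonal {m : ℕ} {e : Fin m → V} {q : Fin m → ℝ}
    (he : IsUnitaryEigenbasis g J Φ e q) (hg : IsHermitianPair g J)
    (hΦJ : ∀ x y, Φ (J x) (J y) = Φ x y) {r : ℝ} {a : V}
    (ha : ∀ i, IsComplexOrthogonal g J (e i) a ∨ q i = r) (v : V) :
    Φ a v = r * g a (J v) := by
  have := he.apply_eq_zero hg ((Φ.flip v).toLinearMap - r • (g.flip (J v)).toLinearMap) a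
    fun i ↦ (ha i).imp_right fun hi x hx ↦ by
      have := (he.line hg hΦJ hx).eig v
      rw [hi] at this
      simp [this]
  simpa [sub_eq_zero] using this

/-- The contraction of the Ricci identity for `F` which is used below, evaluated for the curvature
tensor `ν π₁ + ψ(F, Φ)`. -/
theorem sum_curvature_eigenvectors (hg : IsHermitianPair g J)
    (hΦJ : ∀ x y, Φ (J x) (J y) = Φ x y) {R : V → V → V → V → ℝ} {ν : ℝ}
    (hR : ∀ x v z u, R x v z u = ν * constCurv g x v z u +
      twoFormCurv (fun a b ↦ fundForm g J a b) (fun a b ↦ Φ a b) x v z u) {a b : V} {qa qb : ℝ}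
    (ha : IsUnitEigenvector g J Φ a qa) (hb : IsUnitEigenvector g J Φ b qb)
    (hab : IsComplexOrthogonal g J a b) :
    R a b (J a) (J b) - R a b a b + R a (J b) (J b) a + R a (J b) b (J a)
      = 2 * (ν - (qa + qb)) := by
  have hJa := ha.J_apply hg hΦJ
  have hJb := hb.J_apply hg hΦJ
  have hba := hab.symm hg
  simp only [hR, constCurv, twoFormCurv, fundForm_apply, ha.eig, hb.eig, hJa.eig, hJb.eig,
    hg.J_J, hg.g_J_left, hg.g_J_self, hab.1, hab.2, hba.1, hba.2, ha.norm, hb.norm, map_neg]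
  ring

end Pointwise

namespace IsBianchiSystem

variable {V : Type*} [NormedAddCommGroup V] [NormedSpace ℝ V]
  {g : V →L[ℝ] V →L[ℝ] ℝ} {J : V →L[ℝ] V} {Φ : V →L[ℝ] V →L[ℝ] ℝ}
  {S P : V →ₗ[ℝ] V →ₗ[ℝ] V →ₗ[ℝ] ℝ} {n : V →ₗ[ℝ] ℝ} (h : IsBianchiSystem g J Φ S P n)
include h

/-- If `S` vanishes on the complement of the line of `e`, then `S` spans at most two `2`-forms. -/
theorem apply_eq_of_line {e : V} (he : g e e = 1)
    (h1 : ∀ w x y, IsComplexOrthogonal g J e w → S w x y = 0) (w x y : V) :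
    S w x y = g e w * S e x y + g (J e) w * S (J e) x y := by
  have := h.herm.apply_eq_zero_of_line he ((S.flip x).flip y - S e x y • (g e).toLinearMap
    - S (J e) x y • (g (J e)).toLinearMap) ?_ ?_ ?_ w
  · simp at this
    linarith
  · simp [he, h.herm.g_J_left, h.herm.g_J_self]
  · simp [he, h.herm.g_J_left, h.herm.g_J_self, h.herm.J_J]
  · intro v hv
    simp [hv.1, hv.2, h1 v x y hv, h.herm.g_J_left]

/-! The structure of `S` when it pairs the line of a unit vector `e` with its orthogonal complement
and its cyclic sums vanish: it is determined by the linear form `S(e, e, ·)`. -/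

section Line

variable {e : V} (he : g e e = 1) (hcyc : ∀ w x y, S w x y + S x y w + S y w x = 0)
  (h1 : ∀ w x y, IsComplexOrthogonal g J e w → S w x y = 0)
  (h2 : ∀ w x y, IsComplexOrthogonal g J e x → IsComplexOrthogonal g J e y → S w x y = 0)
include hcyc

theorem line_J_left (z : V) : S (J e) e z = S e e (J z) := by
  have h3 := hcyc e (J e) z
  have h4 := h.S_J_self z e
  have h5 := h.S_J_left e e z
  have h6 := h.S_skew (J e) z e
  linarith

theorem line_J_J (z : V) : S (J e) (J e) z = -S e e z := by
  rw [h.S_J_left, h.line_J_left hcyc, h.herm.J_J, map_neg]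

include he h1 h2

theorem apply_eq_zero_of_line_form {a : V} (ha : IsComplexOrthogonal g J e a)
    (hα : S e e a = 0) (hαJ : S e e (J a) = 0) (w z : V) : S w a z = 0 := by
  rw [h.apply_eq_of_line he h1]
  have key : ∀ w, S w a e = 0 → S w a (J e) = 0 → S w a z = 0 := fun w h3 h4 ↦
    h.herm.apply_eq_zero_of_line he (S w a) h3 h4 (fun v hv ↦ h2 w a v ha hv) z
  rw [key e (by rw [h.S_skew, hα, neg_zero]) (by rw [h.S_skew, h.S_J_left, hαJ, neg_zero]),
    key (J e) (by rw [h.S_skew, h.line_J_left hcyc, hαJ, neg_zero])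
      (by rw [h.S_skew, h.line_J_J hcyc, hα, neg_zero, neg_zero])]
  ring

theorem exists_line_form_ne_zero (hS : ∃ w x y, S w x y ≠ 0) : ∃ z, S e e z ≠ 0 := by
  by_contra! hα
  obtain ⟨w, x, y, hS⟩ := hS
  apply hS
  have key : ∀ w, (∀ z, S w e z = 0) → (∀ z, S w (J e) z = 0) → S w x y = 0 := fun w h3 h4 ↦
    h.herm.apply_eq_zero_of_line he ((S w).flip y) (h3 y) (h4 y) (fun v hv ↦
      h.herm.apply_eq_zero_of_line he (S w v) (by rw [h.S_skew, h3, neg_zero])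
        (by rw [h.S_skew, h4, neg_zero]) (fun u hu ↦ h2 w v u hv hu) y) x
  rw [h.apply_eq_of_line he h1, key e hα (fun z ↦ by rw [h.S_J_left, hα]),
    key (J e) (fun z ↦ by rw [h.line_J_left hcyc, hα])
      (fun z ↦ by rw [h.line_J_J hcyc, hα, neg_zero])]
  ring

end Line

end IsBianchiSystem

namespace LocalGeometry

variable {V : Type*} [NormedAddCommGroup V] [NormedSpace ℝ V]

/-- The determinant of a `3 × 3` matrix given by its rows. -/
def det₃ (a b c : Fin 3 → ℝ) : ℝ :=
  a 0 * (b 1 * c 2 - b 2 * c 1) - a 1 * (b 0 * c 2 - b 2 * c 0) + a 2 * (b 0 * c 1 - b 1 * c 0)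

/-- A `3 × 3` matrix depends on a parameter and is singular throughout. If its last row and its last
column vanish at `0` and the complementary minor does not, then the derivative of the corner entry
vanishes. -/
theorem derivative_eq_zero_of_rank_two {s : Fin 3 → Fin 3 → ℝ → ℝ} {s₀ s₁ : Fin 3 → Fin 3 → ℝ}
    (hs : ∀ i j, HasJet (s i j) (s₀ i j) (s₁ i j))
    (hdet : ∀ᶠ t in nhds 0, det₃ (fun j ↦ s 0 j t) (fun j ↦ s 1 j t) (fun j ↦ s 2 j t) = 0)
    (hrow : ∀ j, s₀ 2 j = 0) (hcol : ∀ i, s₀ i 2 = 0)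
    (hmin : s₀ 0 0 * s₀ 1 1 - s₀ 0 1 * s₀ 1 0 ≠ 0) : s₁ 2 2 = 0 := by
  have h1 := (((hs 0 0).mul (((hs 1 1).mul (hs 2 2)).sub ((hs 1 2).mul (hs 2 1)))).sub
    ((hs 0 1).mul (((hs 1 0).mul (hs 2 2)).sub ((hs 1 2).mul (hs 2 0))))).add
    ((hs 0 2).mul (((hs 1 0).mul (hs 2 1)).sub ((hs 1 1).mul (hs 2 0))))
  have h2 := h1.unique ((HasJet.const (0 : ℝ)).congr hdet)
  simp only [hrow, hcol] at h2
  have h3 : (s₀ 0 0 * s₀ 1 1 - s₀ 0 1 * s₀ 1 0) * s₁ 2 2 = 0 := by linarith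
  exact (mul_eq_zero.mp h3).resolve_left hmin

end LocalGeometry

namespace LocalGeometry

variable {V : Type*} [NormedAddCommGroup V] [NormedSpace ℝ V]

theorem IsMetricOn.mono {G : V → V →L[ℝ] V →L[ℝ] ℝ} {Ω U : Set V} (hG : IsMetricOn G Ω)
    (hU : IsOpen U) (hUΩ : U ⊆ Ω) : IsMetricOn G U :=
  ⟨hU, fun y hy ↦ hG.contDiffAt y (hUΩ hy), fun y hy ↦ hG.symm y (hUΩ hy),
    fun y hy ↦ hG.pos y (hUΩ hy)⟩

/-- `Φ` is a multiple of the fundamental form at `y`. -/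
def IsProportional (G : V → V →L[ℝ] V →L[ℝ] ℝ) (J : V → V →L[ℝ] V)
    (Φ : V → V →L[ℝ] V →L[ℝ] ℝ) (y : V) : Prop :=
  ∃ c : ℝ, ∀ x z, Φ y x z = c * G y x (J y z)

namespace IsTwoFormModel

variable {G : V → V →L[ℝ] V →L[ℝ] ℝ} {J : V → V →L[ℝ] V} {ν : V → ℝ}
  {Φ : V → V →L[ℝ] V →L[ℝ] ℝ} {Ω : Set V} (h : IsTwoFormModel G J ν Φ Ω)
include h

theorem mono {U : Set V} (hU : IsOpen U) (hUΩ : U ⊆ Ω) : IsTwoFormModel G J ν Φ U :=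
  ⟨h.metric.mono hU hUΩ, fun y hy ↦ h.contDiffAt_J y (hUΩ hy), fun y hy ↦ h.herm y (hUΩ hy),
    fun y hy ↦ h.differentiableAt_ν y (hUΩ hy), fun y hy ↦ h.differentiableAt_Φ y (hUΩ hy),
    fun y hy ↦ h.Φ_skew y (hUΩ hy), fun y hy ↦ h.Φ_J y (hUΩ hy), fun y hy ↦ h.curv y (hUΩ hy)⟩

theorem isOpen_not_isProportional : IsOpen {y ∈ Ω | ¬IsProportional G J Φ y} := by
  rw [isOpen_iff_mem_nhds]
  rintro y ⟨hy, hne⟩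
  -- a `2 × 2` minor of `(F, Φ)` does not vanish
  obtain ⟨a, b, c, d, hm⟩ : ∃ a b c d, Φ y a b * G y c (J y d) ≠ Φ y c d * G y a (J y b) := by
    by_contra! hcon
    apply hne
    by_cases h0 : ∃ c : V, c ≠ 0
    · obtain ⟨c, hc⟩ := h0
      have hcc := (h.herm y hy).pos c hc
      refine ⟨-(Φ y c (J y c) / G y c c), fun x z ↦ ?_⟩
      have := hcon x z c (J y c)
      rw [(h.herm y hy).J_J, map_neg] at this
      field_simp
      linarith
    · push Not at h0
      exact ⟨0, fun x z ↦ by simp [h0 x]⟩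
  have hG := (h.metric.differentiableAt hy).continuousAt
  have hJ := ((h.contDiffAt_J y hy).differentiableAt (by norm_num)).continuousAt
  have hΦ := (h.differentiableAt_Φ y hy).continuousAt
  have hc : ContinuousAt (fun y ↦ Φ y a b * G y c (J y d) - Φ y c d * G y a (J y b)) y := by
    fun_prop
  filter_upwards [h.metric.eventually_mem hy, hc.eventually_ne (sub_ne_zero.mpr hm)] with p hp hp0
  refine ⟨hp, fun ⟨l, hl⟩ ↦ hp0 ?_⟩
  rw [hl, hl]
  ring

variable [FiniteDimensional ℝ V] {y : V} (hy : y ∈ Ω)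

/-- The jet of `S_a(x, z)` along a line, for parallel jets of `a`, `x` and `z`. -/
theorem hasJet_covDerivForm (hy : y ∈ Ω) (c a x z : V) :
    HasJet (fun t : ℝ ↦ covDerivForm G J (y + t • c) (parallelJet G y c a t)
      (parallelJet G y c x t) (parallelJet G y c z t)) (covDerivForm G J y a x z)
      (G y x (secondCovDerivEnd G J y c a z)) :=
  h.metric.hasJet_covDerivEnd hy (h.contDiffAt_J y hy) c a x z

include hy

/-- If `dF = 0`, the eigenvalues of `Φ` on two orthogonal complex lines add up to `ν` as soon as
three components of `∇²F` vanish. -/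
theorem add_eigenvalues_eq
    (hcyc : ∀ p ∈ Ω, ∀ w x z, covDerivForm G J p w x z + covDerivForm G J p x z w
      + covDerivForm G J p z w x = 0) {a b : V} {qa qb : ℝ}
    (ha : IsUnitEigenvector (G y) (J y) (Φ y) a qa) (hb : IsUnitEigenvector (G y) (J y) (Φ y) b qb)
    (hab : IsComplexOrthogonal (G y) (J y) a b)
    (h1 : ∀ c, G y (J y b) (secondCovDerivEnd G J y c a a) = 0)
    (h2 : ∀ c, G y a (secondCovDerivEnd G J y c a b) = 0)
    (h3 : ∀ c, G y b (secondCovDerivEnd G J y c a (J y b)) = 0) : qa + qb = ν y := by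
  have hg := h.herm y hy
  have hc := ((h.hasJet_covDerivForm hy a b (J y b) a).add
    (h.hasJet_covDerivForm hy a (J y b) a b)).add (h.hasJet_covDerivForm hy a a b (J y b))
  have hc0 := hc.unique ((HasJet.const (0 : ℝ)).congr (by
    filter_upwards [eventually_mem_line h.metric.isOpen hy a] with t ht
    exact hcyc _ ht _ _ _))
  have hric : ∀ c a x z, G y x (secondCovDerivEnd G J y c a z) =
      G y x (secondCovDerivEnd G J y a c z) + curvatureForm G y c a (J y z) x
        + curvatureForm G y c a z (J y x) := by
    intro c a x z
    have := congrArg (G y x) (h.metric.ricci_identity hy (h.contDiffAt_J y hy) c a z)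
    have h4 := hg.g_J_left x (curvature G y c a z)
    simp only [map_sub] at this
    rw [curvatureForm, curvatureForm, hg.symm _ x, hg.symm _ (J y x)]
    linarith
  have hsum := sum_curvature_eigenvectors hg (h.Φ_J y hy) (h.curv y hy) ha hb hab
  have e1 := hric a b (J y b) a
  have e2 := hric a (J y b) a b
  rw [h1] at e1
  rw [h2] at e2
  have e4 := (h.metric.isCurvatureLike hy).smul_four (-1) a b a b
  rw [hg.J_J] at e1
  rw [neg_one_smul] at e4
  rw [h3, e1, e2, e4] at hc0
  linarith

/-- The second form is a multiple of the fundamental form. -/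
theorem isProportional {m : ℕ} (hm : 2 < m) (hdim : finrank ℝ V = 2 * m) :
    IsProportional G J Φ y := by
  by_contra hyp
  -- the open set on which `Φ` is not a multiple of `F`
  let U := {y ∈ Ω | ¬IsProportional G J Φ y}
  have hU : IsTwoFormModel G J ν Φ U := h.mono h.isOpen_not_isProportional fun _ hy ↦ hy.1
  have hne : ∀ p ∈ U, ∃ (e : Fin m → V) (q : Fin m → ℝ),
      IsUnitaryEigenbasis (G p) (J p) (Φ p) e q ∧ ∃ i j, q i ≠ q j := by
    intro p hp
    have hg := hU.herm p hp
    obtain ⟨e, q, he⟩ := hg.exists_unitaryEigenbasis hdim (hU.Φ_skew p hp) (hU.Φ_J p hp)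
    refine ⟨e, q, he, ?_⟩
    by_contra! hq
    let i₀ : Fin m := ⟨0, by omega⟩
    exact hp.2 ⟨q i₀, fun x z ↦ he.apply_eq_of_orthogonal hg (hU.Φ_J p hp)
      (fun i ↦ Or.inr (hq i i₀)) z⟩
  have hcyc : ∀ p ∈ U, ∀ w x z, covDerivForm G J p w x z + covDerivForm G J p x z w
      + covDerivForm G J p z w x = 0 := by
    intro p hp
    obtain ⟨e, q, he, hq⟩ := hne p hp
    exact (hU.isBianchiSystem hp).S_cyclic he hm hq
  -- at every point, the forms `S_w` span at most two dimensions
  have hrank : ∀ p ∈ U, ∀ w₀ w₁ w₂ x₀ x₁ x₂ z₀ z₁ z₂, det₃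
      ![covDerivForm G J p w₀ x₀ z₀, covDerivForm G J p w₀ x₁ z₁, covDerivForm G J p w₀ x₂ z₂]
      ![covDerivForm G J p w₁ x₀ z₀, covDerivForm G J p w₁ x₁ z₁, covDerivForm G J p w₁ x₂ z₂]
      ![covDerivForm G J p w₂ x₀ z₀, covDerivForm G J p w₂ x₁ z₁, covDerivForm G J p w₂ x₂ z₂]
      = 0 := by
    intro p hp w₀ w₁ w₂ x₀ x₁ x₂ z₀ z₁ z₂
    obtain ⟨e, q, he, hq⟩ := hne p hp
    have hB := hU.isBianchiSystem hp
    by_cases hS : ∃ w x z, covDerivForm G J p w x z ≠ 0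
    · obtain ⟨i, -, -, h1, -⟩ := hB.exists_exceptional_line he hm hq hS
      have key := hB.apply_eq_of_line (he.norm i) h1
      simp only [det₃, Matrix.cons_val]
      rw [key w₀, key w₀, key w₀, key w₁, key w₁, key w₁, key w₂, key w₂, key w₂]
      ring
    · push Not at hS
      simp [det₃, hS]
  by_cases hS0 : ∀ p ∈ U, ∀ w x z, covDerivForm G J p w x z = 0
  · -- `∇F = 0` implies `∇²F = 0`
    obtain ⟨e, q, he, i, j, hij⟩ := hne y ⟨hy, hyp⟩
    have hT : ∀ c a x z, G y x (secondCovDerivEnd G J y c a z) = 0 := fun c a x z ↦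
      (h.hasJet_covDerivForm hy c a x z).unique ((HasJet.const (0 : ℝ)).congr (by
        filter_upwards [eventually_mem_line hU.metric.isOpen ⟨hy, hyp⟩ c] with t ht
        exact hS0 _ ht _ _ _))
    have hadd : ∀ i j, i ≠ j → q i + q j = ν y := fun i j hij ↦
      hU.add_eigenvalues_eq ⟨hy, hyp⟩ hcyc (he.isUnitEigenvector i) (he.isUnitEigenvector j)
        (he.isComplexOrthogonal hij) (fun _ ↦ hT _ _ _ _) (fun _ ↦ hT _ _ _ _)
        (fun _ ↦ hT _ _ _ _)
    obtain ⟨k, hki, hkj⟩ := exists_third hm i j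
    apply hij
    linarith [hadd k i hki, hadd k j hkj]
  · push Not at hS0
    obtain ⟨p, hp, hS⟩ := hS0
    obtain ⟨ε, q, hε, hq⟩ := hne p hp
    have hB := hU.isBianchiSystem hp
    have hg := hU.herm p hp
    obtain ⟨i, hr, hqi, h1, h2⟩ := hB.exists_exceptional_line hε hm hq hS
    obtain ⟨k, hki, -⟩ := exists_third hm i i
    let e := ε i
    have he : G p e e = 1 := hε.norm i
    obtain ⟨y₀, hy₀⟩ := hB.exists_line_form_ne_zero he (hcyc p hp) h1 h2 hS
    let S := covDerivForm G J p
    have hdim4 : 4 < finrank ℝ V := by omega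
    let α : V →L[ℝ] ℝ := LinearMap.toContinuousLinearMap (S e e)
    -- a unit vector `a` with `S_a = 0` and `S_w(a, ·) = 0`
    -- the four linear conditions have a common solution, as `dim V ≥ 6`
    obtain ⟨a, ha, ha1, ha2, hα, hαJ⟩ := hg.exists_unit_of_four_forms hdim4 (G p e)
      (fundForm (G p) (J p) e) α (α ∘L J p)
    have hea : IsComplexOrthogonal (G p) (J p) e a := ⟨ha1, ha2⟩
    have hSa := hB.apply_eq_zero_of_line_form he (hcyc p hp) h1 h2 hea hα hαJ
    -- the matrix `S_w(x_l, z_l)` with the rows `e`, `J e`, `a` and the columns `(e, y₀)`, `(J e, y₀)`,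
    -- `(x, z)`, transported along a line, stays singular
    have hTa : ∀ x z, (∀ w, S w x z = 0) → ∀ c, G p x (secondCovDerivEnd G J p c a z) = 0 := by
      intro x z hxz c
      refine derivative_eq_zero_of_rank_two
        (s := fun k l t ↦ covDerivForm G J (p + t • c) (parallelJet G p c (![e, J p e, a] k) t)
          (parallelJet G p c (![e, J p e, x] l) t) (parallelJet G p c (![y₀, y₀, z] l) t))
        (s₀ := fun k l ↦ S (![e, J p e, a] k) (![e, J p e, x] l) (![y₀, y₀, z] l))
        (s₁ := fun k l ↦ G p (![e, J p e, x] l)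
          (secondCovDerivEnd G J p c (![e, J p e, a] k) (![y₀, y₀, z] l)))
        (fun k l ↦ h.hasJet_covDerivForm hp.1 _ _ _ _) ?_ (fun l ↦ h1 a _ _ hea)
        (fun k ↦ hxz _) ?_
      · filter_upwards [eventually_mem_line hU.metric.isOpen hp c] with t ht
        exact hrank _ ht _ _ _ _ _ _ _ _ _
      · have e1 := hB.S_J_left e e y₀
        have e2 := hB.line_J_left (hcyc p hp) (e := e) y₀
        have e3 := hB.line_J_J (hcyc p hp) (e := e) y₀
        change S e e y₀ * S (J p e) (J p e) y₀ - S e (J p e) y₀ * S (J p e) e y₀ ≠ 0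
        have hpos : 0 < S e e y₀ ^ 2 := by positivity
        simp only [S] at hpos ⊢
        rw [e1, e2, e3]
        -- up to sign, the minor is the sum of the squares of `S(e, e, y₀)` and `S(e, e, J y₀)`
        nlinarith [sq_nonneg (covDerivForm G J p e e (J p y₀))]
    have haeig : IsUnitEigenvector (G p) (J p) (Φ p) a (q k) :=
      ⟨ha, hε.apply_eq_of_orthogonal hg (hU.Φ_J p hp) fun l ↦ by
        by_cases hl : l = i
        · exact Or.inl (hl ▸ hea)
        · exact Or.inr (hr l k hl hki)⟩
    have hadd : ∀ {b qb}, IsUnitEigenvector (G p) (J p) (Φ p) b qb →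
        IsComplexOrthogonal (G p) (J p) a b → q k + qb = ν p := fun hb hab ↦
      hU.add_eigenvalues_eq hp hcyc haeig hb hab
        (hTa _ _ fun w ↦ by rw [hB.S_skew, hSa, neg_zero]) (hTa _ _ fun w ↦ hSa w _)
        (hTa _ _ fun w ↦ hB.S_J_self w _)
    -- a second line orthogonal to the exceptional one
    obtain ⟨b, hb, hb1, hb2, hb3, hb4⟩ := hg.exists_unit_of_four_forms hdim4 (G p e)
      (fundForm (G p) (J p) e) (G p a) (fundForm (G p) (J p) a)
    have hbeig : IsUnitEigenvector (G p) (J p) (Φ p) b (q k) :=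
      ⟨hb, hε.apply_eq_of_orthogonal hg (hU.Φ_J p hp) fun l ↦ by
        by_cases hl : l = i
        · exact Or.inl (hl ▸ ⟨hb1, hb2⟩)
        · exact Or.inr (hr l k hl hki)⟩
    have e1 := hadd hbeig ⟨hb3, hb4⟩
    have e2 := hadd (hε.isUnitEigenvector i) (hea.symm hg)
    exact hqi k hki (by linarith)

end IsTwoFormModel

end LocalGeometry

/-! ### The local theorem -/

namespace LocalGeometry

variable {V : Type*} [NormedAddCommGroup V] [NormedSpace ℝ V] [FiniteDimensional ℝ V]
  {G : V → V →L[ℝ] V →L[ℝ] ℝ} {J : V → V →L[ℝ] V} {Ω : Set V}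

/-- The curvature of an antiholomorphic model is that of a real space form or of a complex space
form, and in the second case the complex structure is parallel. -/
theorem IsAntiholomorphicModel.exists_const (h : IsAntiholomorphicModel G J Ω) {m : ℕ} (hm : 2 < m)
    (hdim : finrank ℝ V = 2 * m) (hΩ : IsPreconnected Ω) : ∃ ν c : ℝ, ∀ y ∈ Ω,
      (∀ x v z u, curvatureForm G y x v z u = ν * constCurv (G y) x v z u +
        c * twoFormCurv (fun a b ↦ fundForm (G y) (J y) a b) (fun a b ↦ fundForm (G y) (J y) a b)
          x v z u) ∧
      (c ≠ 0 → ∀ w x, covDerivEnd G J y w x = 0) := by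
  obtain ⟨ν, Φ, hM⟩ := h.exists_twoFormModel (by omega)
  have : Nontrivial V := Module.nontrivial_of_finrank_pos (R := ℝ) (by omega)
  obtain ⟨x₀, hx₀⟩ := exists_ne (0 : V)
  -- the factor `c` in `Φ = c F`, read off from the pair `(x₀, J x₀)`
  let c : V → ℝ := fun y ↦ -(Φ y x₀ (J y x₀) / G y x₀ x₀)
  have hc : ∀ y ∈ Ω, ∀ x z, Φ y x z = c y * G y x (J y z) := by
    intro y hy
    obtain ⟨c', hc'⟩ := hM.isProportional hy hm hdim
    have h0 := ((h.herm y hy).pos x₀ hx₀).ne'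
    have : c y = c' := by
      simp only [c]
      rw [hc', (h.herm y hy).J_J, map_neg]
      field_simp
    rwa [this]
  have hcd : ∀ y ∈ Ω, DifferentiableAt ℝ c y := by
    intro y hy
    have hG := h.metric.differentiableAt hy
    have hJ := (h.contDiffAt_J y hy).differentiableAt (by norm_num)
    have hΦ := hM.differentiableAt_Φ y hy
    have h0 := ((h.herm y hy).pos x₀ hx₀).ne'
    have h1 : DifferentiableAt ℝ (fun y ↦ Φ y x₀ (J y x₀)) y := by fun_prop
    have h2 : DifferentiableAt ℝ (fun y ↦ G y x₀ x₀) y := by fun_prop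
    simp only [c, div_eq_mul_inv]
    exact (h1.mul (h2.inv h0)).neg
  have key : ∀ y ∈ Ω, fderiv ℝ ν y = 0 ∧ fderiv ℝ c y = 0 ∧
      (c y ≠ 0 → ∀ w x, covDerivEnd G J y w x = 0) := by
    intro y hy
    obtain ⟨e, q, he⟩ := (h.herm y hy).exists_unitaryEigenbasis hdim (hM.Φ_skew y hy)
      (hM.Φ_J y hy)
    have hB := hM.isBianchiSystem hy
    have hp := hB.proportional he hm (c := c y) (dc := (fderiv ℝ c y).toLinearMap) (hc y hy) (by
      intro w x z
      have h1 := hasJet_bilin G (hM.differentiableAt_Φ y hy) w x z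
      have h2 := (HasJet.along (hcd y hy) w).mul
        (h.metric.hasJet_fundForm hy (h.contDiffAt_J y hy) w x z)
      exact h1.unique (h2.congr (by
        filter_upwards [eventually_mem_line h.metric.isOpen hy w] with t ht
        exact hc _ ht _ _)))
    refine ⟨ContinuousLinearMap.ext (hB.dν_apply_eq_zero he hm), ContinuousLinearMap.ext hp.1,
      fun hc0 w x ↦ (h.herm y hy).eq_zero_of_g_self (hp.2 hc0 w _ x)⟩
  obtain ⟨ν₀, hν₀⟩ := h.metric.isOpen.exists_is_const_of_fderiv_eq_zero hΩ
    (fun y hy ↦ (hM.differentiableAt_ν y hy).differentiableWithinAt) (fun y hy ↦ (key y hy).1)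
  obtain ⟨c₀, hc₀⟩ := h.metric.isOpen.exists_is_const_of_fderiv_eq_zero hΩ
    (fun y hy ↦ (hcd y hy).differentiableWithinAt) (fun y hy ↦ (key y hy).2.1)
  refine ⟨ν₀, c₀, fun y hy ↦ ⟨fun x v z u ↦ ?_, hc₀ y hy ▸ (key y hy).2.2⟩⟩
  rw [hM.curv y hy, hν₀ y hy]
  simp only [twoFormCurv, hc y hy, hc₀ y hy, fundForm_apply]
  ring

end LocalGeometry

/-! ### Invariance of the curvature under local isometries -/

theorem HasJet.along_comp {E E' F : Type*} [NormedAddCommGroup E] [NormedSpace ℝ E]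
    [NormedAddCommGroup E'] [NormedSpace ℝ E'] [NormedAddCommGroup F] [NormedSpace ℝ F]
    {T : E' → F} {φ : E → E'} {y : E} (hT : DifferentiableAt ℝ T (φ y))
    (hφ : DifferentiableAt ℝ φ y) (w : E) :
    HasJet (fun t : ℝ ↦ T (φ (y + t • w))) (T (φ y)) (fderiv ℝ T (φ y) (fderiv ℝ φ y w)) := by
  have h := HasJet.along (hT.comp y hφ) w
  rwa [fderiv_comp y hT hφ] at h

namespace LocalGeometry

variable {V : Type*} [NormedAddCommGroup V] [NormedSpace ℝ V]

/-- `φ` is a local isometry of `(Ω', G')` to `(Ω, G)`. -/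
structure IsLocalIsometry (G' G : V → V →L[ℝ] V →L[ℝ] ℝ) (φ : V → V) (Ω' Ω : Set V) : Prop where
  source : IsMetricOn G' Ω'
  target : IsMetricOn G Ω
  contDiffAt : ∀ y ∈ Ω', ContDiffAt ℝ 5 φ y
  mapsTo : ∀ y ∈ Ω', φ y ∈ Ω
  surjective : ∀ y ∈ Ω', Function.Surjective (fderiv ℝ φ y)
  map_metric : ∀ y ∈ Ω', ∀ u v, G' y u v = G (φ y) (fderiv ℝ φ y u) (fderiv ℝ φ y v)

namespace IsLocalIsometry

variable {G' G : V → V →L[ℝ] V →L[ℝ] ℝ} {φ : V → V} {Ω' Ω : Set V}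
  (h : IsLocalIsometry G' G φ Ω' Ω) {y : V} (hy : y ∈ Ω')
include h hy

theorem differentiableAt : DifferentiableAt ℝ φ y :=
  (h.contDiffAt y hy).differentiableAt (by norm_num)

theorem contDiffAt_fderiv : ContDiffAt ℝ 4 (fderiv ℝ φ) y :=
  (h.contDiffAt y hy).fderiv_right (by norm_num)

theorem second_symm (u v : V) :
    fderiv ℝ (fderiv ℝ φ) y u v = fderiv ℝ (fderiv ℝ φ) y v u :=
  ((h.contDiffAt y hy).isSymmSndFDerivAt (by simp; norm_num)).eq u v

theorem third_symm (a u : V) : fderiv ℝ (fderiv ℝ (fderiv ℝ φ)) y a u =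
    fderiv ℝ (fderiv ℝ (fderiv ℝ φ)) y u a :=
  ((h.contDiffAt_fderiv hy).isSymmSndFDerivAt (by simp; norm_num)).eq a u

theorem hasJet_fderiv (w : V) : HasJet (fun t : ℝ ↦ fderiv ℝ φ (y + t • w)) (fderiv ℝ φ y)
    (fderiv ℝ (fderiv ℝ φ) y w) :=
  .along ((h.contDiffAt_fderiv hy).differentiableAt (by norm_num)) w

/-- The derivative of the identity `map_metric`. -/
theorem fderiv_metric (w u v : V) : fderiv ℝ G' y w u v =
    fderiv ℝ G (φ y) (fderiv ℝ φ y w) (fderiv ℝ φ y u) (fderiv ℝ φ y v)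
      + G (φ y) (fderiv ℝ (fderiv ℝ φ) y w u) (fderiv ℝ φ y v)
      + G (φ y) (fderiv ℝ φ y u) (fderiv ℝ (fderiv ℝ φ) y w v) := by
  have h1 := ((HasJet.along (h.source.differentiableAt hy) w).apply (.const u)).apply (.const v)
  have hL := fun u : V ↦ (h.hasJet_fderiv hy w).apply (.const u)
  have h2 := ((HasJet.along_comp (h.target.differentiableAt (h.mapsTo y hy))
    (h.differentiableAt hy) w).apply (hL u)).apply (hL v)
  have h3 := h1.unique (h2.congr (by
    filter_upwards [eventually_mem_line h.source.isOpen hy w] with t ht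
    exact h.map_metric _ ht u v))
  simpa [add_assoc] using h3

variable [FiniteDimensional ℝ V]

/-- The transformation law of the Christoffel map. -/
theorem map_gam (u v : V) : fderiv ℝ φ y (gam G' y u v) =
    gam G (φ y) (fderiv ℝ φ y u) (fderiv ℝ φ y v) + fderiv ℝ (fderiv ℝ φ) y u v := by
  refine h.target.eq_of_forall (h.mapsTo y hy) fun w' ↦ ?_
  obtain ⟨w, rfl⟩ := h.surjective y hy w'
  rw [← h.map_metric y hy, h.source.koszul hy, map_add, add_apply,
    h.target.koszul (h.mapsTo y hy)]
  simp only [h.fderiv_metric hy]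
  rw [h.second_symm hy v u, h.second_symm hy w u, h.second_symm hy w v,
    h.target.symm _ (h.mapsTo y hy) (fderiv ℝ φ y v) (fderiv ℝ (fderiv ℝ φ) y u w)]
  ring

/-- The derivative of the identity `map_gam`. -/
theorem map_fderiv_gam (a u v : V) : fderiv ℝ (fderiv ℝ φ) y a (gam G' y u v)
    + fderiv ℝ φ y (fderiv ℝ (gam G') y a u v) =
      fderiv ℝ (gam G) (φ y) (fderiv ℝ φ y a) (fderiv ℝ φ y u) (fderiv ℝ φ y v)
      + gam G (φ y) (fderiv ℝ (fderiv ℝ φ) y a u) (fderiv ℝ φ y v)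
      + gam G (φ y) (fderiv ℝ φ y u) (fderiv ℝ (fderiv ℝ φ) y a v)
      + fderiv ℝ (fderiv ℝ (fderiv ℝ φ)) y a u v := by
  have h1 := (h.hasJet_fderiv hy a).apply (((HasJet.along
    (h.source.differentiableAt_gam hy) a).apply (.const u)).apply (.const v))
  have hL := fun u : V ↦ (h.hasJet_fderiv hy a).apply (.const u)
  have h3 : DifferentiableAt ℝ (fderiv ℝ (fderiv ℝ φ)) y :=
    ((h.contDiffAt_fderiv hy).fderiv_right (m := 3) (by norm_num)).differentiableAt (by norm_num)
  have h2 := (((HasJet.along_comp (h.target.differentiableAt_gam (h.mapsTo y hy))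
    (h.differentiableAt hy) a).apply (hL u)).apply (hL v)).add
      (((HasJet.along h3 a).apply (.const u)).apply (.const v))
  have h4 := h1.unique (h2.congr (by
    filter_upwards [eventually_mem_line h.source.isOpen hy a] with t ht
    exact h.map_gam ht u v))
  simpa [add_assoc] using h4

/-- The terms of the transformation law with higher derivatives of `φ` are symmetric in `a` and `u`,
so that they cancel in the curvature. -/
theorem map_curvature (a u v : V) : fderiv ℝ φ y (curvature G' y a u v) =
    curvature G (φ y) (fderiv ℝ φ y a) (fderiv ℝ φ y u) (fderiv ℝ φ y v) := by
  rw [h.source.curvature_eq hy, h.target.curvature_eq (h.mapsTo y hy)]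
  have h1 := eq_sub_of_add_eq' (h.map_fderiv_gam hy a u v)
  have h2 := eq_sub_of_add_eq' (h.map_fderiv_gam hy u a v)
  simp only [map_add, map_sub, h.map_gam hy, h1, h2]
  rw [h.second_symm hy u a, h.third_symm hy u a]
  abel

theorem curvatureForm_eq (a u v w : V) : curvatureForm G' y a u v w =
    curvatureForm G (φ y) (fderiv ℝ φ y a) (fderiv ℝ φ y u) (fderiv ℝ φ y v)
      (fderiv ℝ φ y w) := by
  rw [curvatureForm, h.map_metric y hy, h.map_curvature hy, curvatureForm]

end IsLocalIsometry

end LocalGeometry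

/-! ### Almost Hermitian manifolds read in charts -/

namespace AlmostHermitianStructure

variable {V : Type*} [NormedAddCommGroup V] [NormedSpace ℝ V]
  {M : Type*} [TopologicalSpace M] [ChartedSpace V M] [IsManifold 𝓘(ℝ, V) ∞ M]
  (h : AlmostHermitianStructure V M)

theorem contDiffAt_complexInChart (p : M) :
    ContDiffAt ℝ 5 (h.complexInChart p) (extChartAt 𝓘(ℝ, V) p p) := by
  have h1 := ((contMDiffAt_hom_bundle _).mp (h.contMDiff_J p)).2
  have h2 : ContMDiffAt 𝓘(ℝ, V) 𝓘(ℝ, V) ∞ (extChartAt 𝓘(ℝ, V) p).symm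
      (extChartAt 𝓘(ℝ, V) p p) :=
    (contMDiffOn_extChartAt_symm p).contMDiffAt (extChartAt_target_mem_nhds p)
  have h3 := ContMDiffAt.comp_of_eq h1 h2 (by simp)
  exact h3.contDiffAt.of_le (by norm_cast)

theorem contDiffAt_metricInChart (p : M) :
    ContDiffAt ℝ 5 (h.metricInChart p) (extChartAt 𝓘(ℝ, V) p p) := by
  have h1 := ((contMDiffAt_hom_bundle _).mp (h.g.contMDiff p)).2
  have h2 : ContMDiffAt 𝓘(ℝ, V) 𝓘(ℝ, V) ∞ (extChartAt 𝓘(ℝ, V) p).symm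
      (extChartAt 𝓘(ℝ, V) p p) :=
    (contMDiffOn_extChartAt_symm p).contMDiffAt (extChartAt_target_mem_nhds p)
  have h3 := ContMDiffAt.comp_of_eq h1 h2 (by simp)
  have h4 := h3.contDiffAt.of_le (m := 5) (by norm_cast)
  refine h4.congr_of_eventuallyEq ?_
  filter_upwards [extChartAt_target_mem_nhds (I := 𝓘(ℝ, V)) p] with y hy
  have hq : (extChartAt 𝓘(ℝ, V) p).symm y ∈ (chartAt V p).source := by
    simpa using (extChartAt 𝓘(ℝ, V) p).map_target hy
  ext u v
  rw [Function.comp_apply, inCoordinates_apply_eq₂ hq hq (Set.mem_univ _)]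
  have ht : ∀ (q : M) (a : ℝ), (trivializationAt ℝ (fun _ : M ↦ ℝ) p).linearMapAt ℝ q a = a :=
    fun q a ↦ LinearMap.congr_fun (Bundle.Trivial.linearMapAt_trivialization ℝ M ℝ q) a
  refine Eq.trans ?_ (ht _ _).symm
  rw [← Trivialization.symmL_apply (R := ℝ) (hb := hq),
    ← Trivialization.symmL_apply (R := ℝ) (hb := hq)]
  rfl

theorem chartFrame_eq {p q : M} (hq : q ∈ (extChartAt 𝓘(ℝ, V) p).source) (v : V) :
    (chartFrame p q v : V) = tangentCoordChange 𝓘(ℝ, V) p q q v := by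
  rw [extChartAt_source] at hq
  rw [chartFrame, TangentBundle.symmL_trivializationAt_eq_core hq]
  rfl

theorem chartCoframe_eq {p q : M} (hq : q ∈ (extChartAt 𝓘(ℝ, V) p).source)
    (v : TangentSpace 𝓘(ℝ, V) q) :
    chartCoframe p q v = tangentCoordChange 𝓘(ℝ, V) q p q v := by
  rw [extChartAt_source] at hq
  rw [chartCoframe, TangentBundle.continuousLinearMapAt_trivializationAt_eq_core hq]
  rfl

theorem chartFrame_self (p : M) (v : V) : (chartFrame p p v : V) = v := by
  rw [chartFrame_eq (mem_extChartAt_source p), tangentCoordChange_self (mem_extChartAt_source p)]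

theorem chartCoframe_self (p : M) (v : TangentSpace 𝓘(ℝ, V) p) : chartCoframe p p v = v := by
  exact (chartCoframe_eq (mem_extChartAt_source p) v).trans
    (tangentCoordChange_self (mem_extChartAt_source p))

theorem chartCoframe_chartFrame {p q : M} (hq : q ∈ (extChartAt 𝓘(ℝ, V) p).source) (v : V) :
    chartCoframe p q (chartFrame p q v) = v := by
  rw [extChartAt_source] at hq
  exact (trivializationAt V (TangentSpace 𝓘(ℝ, V) : M → Type _) p).continuousLinearMapAt_symmL hq v

theorem chartFrame_chartCoframe {p q : M} (hq : q ∈ (extChartAt 𝓘(ℝ, V) p).source)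
    (v : TangentSpace 𝓘(ℝ, V) q) : chartFrame p q (chartCoframe p q v) = v := by
  rw [extChartAt_source] at hq
  exact (trivializationAt V (TangentSpace 𝓘(ℝ, V) : M → Type _) p).symmL_continuousLinearMapAt hq v

theorem chartFrame_tangentCoordChange {p q r : M} (hp : r ∈ (extChartAt 𝓘(ℝ, V) p).source)
    (hq : r ∈ (extChartAt 𝓘(ℝ, V) q).source) (v : V) :
    chartFrame q r (tangentCoordChange 𝓘(ℝ, V) p q r v) = chartFrame p r v := by
  have h1 := chartFrame_eq hq (tangentCoordChange 𝓘(ℝ, V) p q r v)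
  have h2 := chartFrame_eq hp v
  rw [tangentCoordChange_comp ⟨⟨hp, hq⟩, mem_extChartAt_source r⟩] at h1
  exact h1.trans h2.symm

theorem metricInChart_apply (p : M) (y u v : V) : h.metricInChart p y u v =
    h.g.inner ((extChartAt 𝓘(ℝ, V) p).symm y) (chartFrame p _ u) (chartFrame p _ v) := rfl

theorem chartFrame_complexInChart {p : M} {y : V} (hy : y ∈ (extChartAt 𝓘(ℝ, V) p).target)
    (v : V) : chartFrame p ((extChartAt 𝓘(ℝ, V) p).symm y) (h.complexInChart p y v) =
      h.J _ (chartFrame p _ v) :=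
  chartFrame_chartCoframe ((extChartAt 𝓘(ℝ, V) p).map_target hy) _

theorem isHermitianPair_inChart {p : M} {y : V} (hy : y ∈ (extChartAt 𝓘(ℝ, V) p).target) :
    IsHermitianPair (h.metricInChart p y) (h.complexInChart p y) where
  symm x z := h.g.symm _ _ _
  pos x hx := h.g.pos _ _ fun h0 ↦ hx (by
    exact (chartCoframe_chartFrame ((extChartAt 𝓘(ℝ, V) p).map_target hy) x).symm.trans
      ((congrArg _ h0).trans (map_zero _)))
  J_J x := by
    have h1 := h.chartFrame_complexInChart hy (h.complexInChart p y x)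
    rw [h.chartFrame_complexInChart hy x, h.J_J] at h1
    have h2 := congrArg (chartCoframe p _) h1
    have hs := (extChartAt 𝓘(ℝ, V) p).map_target hy
    rw [map_neg, chartCoframe_chartFrame hs, chartCoframe_chartFrame hs] at h2
    exact h2
  g_J_J x z := by
    rw [metricInChart_apply, h.chartFrame_complexInChart hy, h.chartFrame_complexInChart hy,
      h.g_J_J, metricInChart_apply]

/-- The metric on `T_p M`, considered as the space `V`. -/
noncomputable def metricAt (p : M) : V →L[ℝ] V →L[ℝ] ℝ :=
  h.metricInChart p (extChartAt 𝓘(ℝ, V) p p)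

/-- The complex structure on `T_p M`, considered as the space `V`. -/
noncomputable def complexAt (p : M) : V →L[ℝ] V :=
  h.complexInChart p (extChartAt 𝓘(ℝ, V) p p)

theorem isHermitianPair_at (p : M) : IsHermitianPair (h.metricAt p) (h.complexAt p) :=
  h.isHermitianPair_inChart (mem_extChartAt_target p)

theorem metricAt_apply (p : M) (u v : TangentSpace 𝓘(ℝ, V) p) :
    h.metricAt p u v = h.g.inner p u v := by
  have key : ∀ q, q = p → h.g.inner q (chartFrame p q u) (chartFrame p q v) = h.g.inner p u v := by
    rintro q rfl
    exact congrArg₂ (fun a b : TangentSpace 𝓘(ℝ, V) q ↦ h.g.inner q a b) (chartFrame_self (V := V) q u)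
      (chartFrame_self (V := V) q v)
  exact key _ (extChartAt_to_inv p)

theorem complexAt_apply (p : M) (v : TangentSpace 𝓘(ℝ, V) p) :
    h.complexAt p v = h.J p v := by
  have key : ∀ q, q = p → chartCoframe p q (h.J q (chartFrame p q v)) = h.J p v := by
    rintro q rfl
    exact (chartCoframe_self q _).trans
      (congrArg (fun a : TangentSpace 𝓘(ℝ, V) q ↦ h.J q a) (chartFrame_self (V := V) q v))
  exact key _ (extChartAt_to_inv p)

theorem R_eq (p : M) (x y z u : TangentSpace 𝓘(ℝ, V) p) : h.R p x y z u =
    LocalGeometry.curvatureForm (V := V) (h.metricInChart p) (extChartAt 𝓘(ℝ, V) p p) x y z u :=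
  (h.metricAt_apply p _ _).symm

end AlmostHermitianStructure

/-! ### Changes of charts -/

namespace AlmostHermitianStructure

variable {V : Type*} [NormedAddCommGroup V] [NormedSpace ℝ V]
  {M : Type*} [TopologicalSpace M] [ChartedSpace V M] [IsManifold 𝓘(ℝ, V) ∞ M]
  (h : AlmostHermitianStructure V M)

/-- Around each point there is a ball in its chart in which the structure is smooth enough. -/
theorem exists_ball_chart (p : M) : ∃ ε > 0,
    Metric.ball (extChartAt 𝓘(ℝ, V) p p) ε ⊆ (extChartAt 𝓘(ℝ, V) p).target ∧
    LocalGeometry.IsMetricOn (h.metricInChart p) (Metric.ball (extChartAt 𝓘(ℝ, V) p p) ε) ∧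
    ∀ y ∈ Metric.ball (extChartAt 𝓘(ℝ, V) p p) ε, ContDiffAt ℝ 5 (h.complexInChart p) y := by
  obtain ⟨ε, hε, h1⟩ := Metric.eventually_nhds_iff_ball.mp
    (((h.contDiffAt_metricInChart p).eventually (by decide)).and
    (((h.contDiffAt_complexInChart p).eventually (by decide)).and
      (extChartAt_target_mem_nhds (I := 𝓘(ℝ, V)) p)))
  have ht : Metric.ball (extChartAt 𝓘(ℝ, V) p p) ε ⊆ (extChartAt 𝓘(ℝ, V) p).target :=
    fun y hy ↦ (h1 y hy).2.2
  exact ⟨ε, hε, ht, ⟨Metric.isOpen_ball, fun y hy ↦ (h1 y hy).1,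
    fun y hy ↦ (h.isHermitianPair_inChart (ht hy)).symm,
    fun y hy ↦ (h.isHermitianPair_inChart (ht hy)).pos⟩, fun y hy ↦ (h1 y hy).2.1⟩

theorem metricInChart_eq {p q : M} (hq : q ∈ (extChartAt 𝓘(ℝ, V) p).source) (u v : V) :
    h.metricInChart p (extChartAt 𝓘(ℝ, V) p q) u v =
      h.metricAt q (tangentCoordChange 𝓘(ℝ, V) p q q u) (tangentCoordChange 𝓘(ℝ, V) p q q v) := by
  rw [metricInChart_apply, (extChartAt 𝓘(ℝ, V) p).left_inv hq, ← chartFrame_eq hq,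
    ← chartFrame_eq hq]
  exact (h.metricAt_apply q _ _).symm

theorem complexInChart_eq {p q : M} (hq : q ∈ (extChartAt 𝓘(ℝ, V) p).source) (v : V) :
    tangentCoordChange 𝓘(ℝ, V) p q q (h.complexInChart p (extChartAt 𝓘(ℝ, V) p q) v) =
      h.complexAt q (tangentCoordChange 𝓘(ℝ, V) p q q v) := by
  have h1 := h.chartFrame_complexInChart ((extChartAt 𝓘(ℝ, V) p).map_source hq) v
  rw [(extChartAt 𝓘(ℝ, V) p).left_inv hq] at h1
  rw [← chartFrame_eq hq, ← chartFrame_eq hq]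
  exact h1.trans (h.complexAt_apply q _).symm

theorem tangentCoordChange_surjective {p q r : M} (hp : r ∈ (extChartAt 𝓘(ℝ, V) p).source)
    (hq : r ∈ (extChartAt 𝓘(ℝ, V) q).source) :
    Function.Surjective (tangentCoordChange 𝓘(ℝ, V) p q r) := fun v ↦
  ⟨tangentCoordChange 𝓘(ℝ, V) q p r v, by
    rw [tangentCoordChange_comp ⟨⟨hq, hp⟩, hq⟩, tangentCoordChange_self hq]⟩

/-- Changes of charts are local isometries. -/
theorem isLocalIsometry_chartChange {p q : M} {Ω Ω' : Set V}
    (hΩ : LocalGeometry.IsMetricOn (h.metricInChart p) Ω)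
    (hΩ' : LocalGeometry.IsMetricOn (h.metricInChart q) Ω') :
    LocalGeometry.IsLocalIsometry (h.metricInChart p) (h.metricInChart q)
      (extChartAt 𝓘(ℝ, V) q ∘ (extChartAt 𝓘(ℝ, V) p).symm)
      (Ω ∩ ((extChartAt 𝓘(ℝ, V) p).target ∩ (extChartAt 𝓘(ℝ, V) p).symm ⁻¹'
        ((extChartAt 𝓘(ℝ, V) q).source ∩ extChartAt 𝓘(ℝ, V) q ⁻¹' Ω'))) Ω' := by
  have hd : ∀ y ∈ Ω ∩ ((extChartAt 𝓘(ℝ, V) p).target ∩ (extChartAt 𝓘(ℝ, V) p).symm ⁻¹'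
      ((extChartAt 𝓘(ℝ, V) q).source ∩ extChartAt 𝓘(ℝ, V) q ⁻¹' Ω')),
      fderiv ℝ (extChartAt 𝓘(ℝ, V) q ∘ (extChartAt 𝓘(ℝ, V) p).symm) y =
        tangentCoordChange 𝓘(ℝ, V) p q ((extChartAt 𝓘(ℝ, V) p).symm y) := by
    rintro y ⟨-, hy, hyq, -⟩
    rw [tangentCoordChange_def, (extChartAt 𝓘(ℝ, V) p).right_inv hy]
    simp [fderivWithin_univ]
  have hopen : IsOpen ((extChartAt 𝓘(ℝ, V) p).target ∩ (extChartAt 𝓘(ℝ, V) p).symm ⁻¹'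
      ((extChartAt 𝓘(ℝ, V) q).source ∩ extChartAt 𝓘(ℝ, V) q ⁻¹' Ω')) :=
    (continuousOn_extChartAt_symm p).isOpen_inter_preimage (isOpen_extChartAt_target p)
      ((continuousOn_extChartAt q).isOpen_inter_preimage (isOpen_extChartAt_source q) hΩ'.isOpen)
  refine ⟨hΩ.mono (hΩ.isOpen.inter hopen) Set.inter_subset_left, hΩ', fun y hy ↦ ?_,
    fun y hy ↦ hy.2.2.2, fun y hy ↦ ?_, fun y hy u v ↦ ?_⟩
  · have h1 : ContMDiffAt 𝓘(ℝ, V) 𝓘(ℝ, V) ∞ (extChartAt 𝓘(ℝ, V) p).symm y :=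
      (contMDiffOn_extChartAt_symm p).contMDiffAt ((isOpen_extChartAt_target p).mem_nhds hy.2.1)
    have h2 : ContMDiffAt 𝓘(ℝ, V) 𝓘(ℝ, V) ∞ (extChartAt 𝓘(ℝ, V) q)
        ((extChartAt 𝓘(ℝ, V) p).symm y) :=
      contMDiffAt_extChartAt' (by simpa using hy.2.2.1)
    exact (h2.comp y h1).contDiffAt.of_le (by norm_cast)
  · rw [hd y hy]
    exact tangentCoordChange_surjective ((extChartAt 𝓘(ℝ, V) p).map_target hy.2.1) hy.2.2.1
  · rw [hd y hy, metricInChart_apply, metricInChart_apply, Function.comp_apply,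
      (extChartAt 𝓘(ℝ, V) q).left_inv hy.2.2.1,
      chartFrame_tangentCoordChange ((extChartAt 𝓘(ℝ, V) p).map_target hy.2.1) hy.2.2.1,
      chartFrame_tangentCoordChange ((extChartAt 𝓘(ℝ, V) p).map_target hy.2.1) hy.2.2.1]

/-- The curvature tensor at `p`, considered as a function on the space `V`. -/
noncomputable def curvatureAt (p : M) : V → V → V → V → ℝ :=
  LocalGeometry.curvatureForm (h.metricInChart p) (extChartAt 𝓘(ℝ, V) p p)

variable [FiniteDimensional ℝ V]

/-- The curvature tensor may be computed in any chart. -/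
theorem curvatureForm_inChart_eq {p q : M} {Ω : Set V}
    (hΩ : LocalGeometry.IsMetricOn (h.metricInChart p) Ω) (hq : q ∈ (extChartAt 𝓘(ℝ, V) p).source)
    (hqΩ : extChartAt 𝓘(ℝ, V) p q ∈ Ω) (x y z u : V) :
    LocalGeometry.curvatureForm (h.metricInChart p) (extChartAt 𝓘(ℝ, V) p q) x y z u =
      h.curvatureAt q (tangentCoordChange 𝓘(ℝ, V) p q q x) (tangentCoordChange 𝓘(ℝ, V) p q q y)
        (tangentCoordChange 𝓘(ℝ, V) p q q z) (tangentCoordChange 𝓘(ℝ, V) p q q u) := by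
  obtain ⟨ε, hε, hεt, hM, -⟩ := h.exists_ball_chart q
  have h1 := (h.isLocalIsometry_chartChange hΩ hM).curvatureForm_eq
    (y := extChartAt 𝓘(ℝ, V) p q) ⟨hqΩ, (extChartAt 𝓘(ℝ, V) p).map_source hq, by
      rw [Set.mem_preimage, (extChartAt 𝓘(ℝ, V) p).left_inv hq]
      exact ⟨mem_extChartAt_source q, Metric.mem_ball_self hε⟩⟩ x y z u
  have hd : fderiv ℝ (extChartAt 𝓘(ℝ, V) q ∘ (extChartAt 𝓘(ℝ, V) p).symm)
      (extChartAt 𝓘(ℝ, V) p q) = tangentCoordChange 𝓘(ℝ, V) p q q := by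
    rw [tangentCoordChange_def]
    simp [fderivWithin_univ]
  rw [hd, Function.comp_apply, (extChartAt 𝓘(ℝ, V) p).left_inv hq] at h1
  exact h1

end AlmostHermitianStructure

/-! ### Planes and sectional curvatures -/

section Planes

variable {V : Type*} [NormedAddCommGroup V] [NormedSpace ℝ V]
  {g : V →L[ℝ] V →L[ℝ] ℝ} {J : V →L[ℝ] V}

theorem IsHermitianPair.linearIndependent_iff (hg : IsHermitianPair g J) {x y : V} :
    LinearIndependent ℝ ![x, y] ↔ constCurv g x y y x ≠ 0 := by
  rw [LinearIndependent.pair_iff]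
  constructor
  · intro hli h0
    have h1 : g (g x y • x - g x x • y) (g x y • x - g x x • y) = 0 := by
      have : g (g x y • x - g x x • y) (g x y • x - g x x • y)
          = g x x * constCurv g x y y x := by
        simp only [constCurv, map_sub, map_smul, sub_apply, smul_apply, smul_eq_mul, hg.symm y x]
        ring
      rw [this, h0, mul_zero]
    have h2 := hli (g x y) (-g x x) (by
      rw [neg_smul, ← sub_eq_add_neg]
      exact hg.eq_zero_of_g_self h1)
    have hx : x = 0 := hg.eq_zero_of_g_self (neg_eq_zero.mp h2.2)
    simpa using hli 1 0 (by simp [hx])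
  · intro h0 s t hst
    have h1 : g x (s • x + t • y) = 0 := by rw [hst, map_zero]
    have h2 : g y (s • x + t • y) = 0 := by rw [hst, map_zero]
    simp only [map_add, map_smul, smul_eq_mul, hg.symm y x] at h1 h2
    simp only [constCurv, hg.symm y x] at h0
    constructor
    · refine (mul_eq_zero.mp (?_ : s * _ = 0)).resolve_right h0
      linear_combination g y y * h1 - g x y * h2
    · refine (mul_eq_zero.mp (?_ : t * _ = 0)).resolve_right h0
      linear_combination g x x * h2 - g x y * h1

theorem IsCurvatureLike.eq_zero_of_dependent {R : V → V → V → V → ℝ} (hR : IsCurvatureLike R)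
    (hg : IsHermitianPair g J) {x y : V} (h0 : constCurv g x y y x = 0) : R x y y x = 0 := by
  by_cases hx : x = 0
  · simpa [hx] using hR.smul_left 0 x y y x
  have hxx := (hg.pos x hx).ne'
  have h1 : g x x • y = g x y • x := by
    rw [← sub_eq_zero]
    apply hg.eq_zero_of_g_self
    have : g (g x x • y - g x y • x) (g x x • y - g x y • x) = g x x * constCurv g x y y x := by
      simp only [constCurv, map_sub, map_smul, sub_apply, smul_apply, smul_eq_mul, hg.symm y x]
      ring
    rw [this, h0, mul_zero]
  have h2 := hR.smul_two (g x x) x y y x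
  rw [h1, hR.smul_two, hR.self_left, mul_zero, zero_eq_mul] at h2
  exact h2.resolve_left hxx

/-- The square of the fundamental form on a basis of a complex line. -/
theorem IsHermitianPair.sq_fundForm_of_mem_span (hg : IsHermitianPair g J) {x y : V} (hx : x ≠ 0)
    (hJ : J x ∈ Submodule.span ℝ {x, y}) : g x (J y) ^ 2 = constCurv g x y y x := by
  obtain ⟨s, t, hst⟩ := Submodule.mem_span_pair.mp hJ
  have h1 : g x (J x) = s * g x x + t * g x y := by rw [← hst]; simp
  have h2 : g (J x) y = s * g x y + t * g y y := by
    rw [← hst]; simp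
  have h3 : g (J x) (s • x + t • y) = s * g (J x) x + t * g (J x) y := by simp
  rw [hst] at h3
  have h4 := hg.g_J_left x y
  rw [hg.g_J_self] at h1
  rw [hg.g_J_J, hg.symm (J x) x, hg.g_J_self] at h3
  have hxx := (hg.pos x hx).ne'
  simp only [constCurv, hg.symm y x]
  apply mul_left_cancel₀ hxx
  rw [h4] at h2 h3
  linear_combination (-g x x * g y y + g x y ^ 2) * h3 + (-g x (J y) * g x x) * h2
    + g x (J y) * g x y * h1

theorem twoFormCurv_fundForm_self (g : V →L[ℝ] V →L[ℝ] ℝ) (J : V →L[ℝ] V)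
    (hg : IsHermitianPair g J) (x y : V) :
    twoFormCurv (fun a b ↦ fundForm g J a b) (fun a b ↦ fundForm g J a b) x y y x =
      6 * g x (J y) ^ 2 := by
  have := hg.fundForm_skew y x
  simp only [fundForm_apply] at this
  simp only [twoFormCurv, fundForm_apply, hg.g_J_self, this]
  ring

end Planes

/-! ### Globalization -/

namespace AlmostHermitianStructure

variable {V : Type*} [NormedAddCommGroup V] [NormedSpace ℝ V]
  {M : Type*} [TopologicalSpace M] [ChartedSpace V M] [IsManifold 𝓘(ℝ, V) ∞ M]
  (h : AlmostHermitianStructure V M)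

theorem sectionalCurvature_eq (p : M) (x y : TangentSpace 𝓘(ℝ, V) p) :
    h.sectionalCurvature p x y =
      h.curvatureAt p x y y x / constCurv (V := V) (h.metricAt p) x y y x := by
  have h1 := h.metricAt_apply p
  rw [sectionalCurvature, h.R_eq]
  simp only [constCurv]
  rw [h1, h1, h1, h1, h.g.symm p y x, pow_two]
  rfl

theorem linearIndependent_iff (p : M) (x y : TangentSpace 𝓘(ℝ, V) p) :
    LinearIndependent ℝ ![x, y] ↔ constCurv (V := V) (h.metricAt p) x y y x ≠ 0 :=
  (h.isHermitianPair_at p).linearIndependent_iff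

variable [FiniteDimensional ℝ V]

theorem isCurvatureLike_at (p : M) : IsCurvatureLike (h.curvatureAt p) := by
  obtain ⟨ε, hε, -, hM, -⟩ := h.exists_ball_chart p
  exact hM.isCurvatureLike (Metric.mem_ball_self hε)

omit [FiniteDimensional ℝ V] in
theorem IsAH3.curvatureAt_J (hAH3 : h.IsAH3) (p : M) (x y z u : V) :
    h.curvatureAt p (h.complexAt p x) (h.complexAt p y) (h.complexAt p z) (h.complexAt p u) =
      h.curvatureAt p x y z u := by
  have key : ∀ x y z u : TangentSpace 𝓘(ℝ, V) p, h.curvatureAt p (h.complexAt p x)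
      (h.complexAt p y) (h.complexAt p z) (h.complexAt p u) = h.curvatureAt p x y z u := by
    intro x y z u
    have h1 := (hAH3 p x y z u).symm
    have hJ := h.complexAt_apply p
    rw [← hJ, ← hJ, ← hJ, ← hJ] at h1
    exact ((h.R_eq p _ _ _ _).symm.trans h1).trans (h.R_eq p _ _ _ _)
  exact key x y z u

omit [FiniteDimensional ℝ V] in
theorem isAntiholomorphicPlane_span {p : M} {x z : TangentSpace 𝓘(ℝ, V) p}
    (hxz : h.g.inner p x (h.J p z) = 0) (hli : LinearIndependent ℝ ![x, z]) :
    h.IsAntiholomorphicPlane p (Submodule.span ℝ {x, z}) := by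
  have hl : ∀ a b : TangentSpace 𝓘(ℝ, V) p, h.g.inner p a (h.J p b) =
      -h.g.inner p b (h.J p a) := fun a b ↦ by
    rw [← h.g_J_J p a, h.J_J, map_neg, h.g.symm]
  have hs : ∀ a : TangentSpace 𝓘(ℝ, V) p, h.g.inner p a (h.J p a) = 0 := fun a ↦ by
    linarith [hl a a]
  refine ⟨?_, fun a ha b hb ↦ ?_⟩
  · have := finrank_span_eq_card hli
    rwa [Matrix.range_cons, Matrix.range_cons, Matrix.range_empty, Set.union_empty,
      Set.singleton_union] at this
  · obtain ⟨s, t, rfl⟩ := Submodule.mem_span_pair.mp ha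
    obtain ⟨s', t', rfl⟩ := Submodule.mem_span_pair.mp hb
    have hzx := hl z x
    rw [hxz, neg_zero] at hzx
    simp [hs, hxz, hzx]

theorem HasPointwiseConstantAntiholomorphicCurvature.exists_curvatureAt
    (hanti : h.HasPointwiseConstantAntiholomorphicCurvature) (p : M) :
    ∃ ν : ℝ, ∀ x z, h.metricAt p x (h.complexAt p z) = 0 →
      h.curvatureAt p x z z x = ν * constCurv (h.metricAt p) x z z x := by
  obtain ⟨ν, hν⟩ := hanti
  refine ⟨ν p, fun (x z : TangentSpace 𝓘(ℝ, V) p) hxz ↦ ?_⟩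
  by_cases h0 : constCurv (V := V) (h.metricAt p) x z z x = 0
  · rw [h0, mul_zero]
    exact (h.isCurvatureLike_at p).eq_zero_of_dependent (h.isHermitianPair_at p) h0
  · have hli := (h.linearIndependent_iff p x z).mpr h0
    have hxz' : h.g.inner p x (h.J p z) = 0 :=
      (h.metricAt_apply p x (h.J p z)).symm.trans
        ((congrArg (h.metricAt p x) (h.complexAt_apply p z)).symm.trans hxz)
    have h1 := hν p _ (h.isAntiholomorphicPlane_span hxz' hli) x
      (Submodule.subset_span (Set.mem_insert _ _)) z
      (Submodule.subset_span (Set.mem_insert_of_mem _ rfl)) hli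
    rw [h.sectionalCurvature_eq, div_eq_iff h0] at h1
    exact h1

theorem isAntiholomorphicModel_inChart (hAH3 : h.IsAH3)
    (hanti : h.HasPointwiseConstantAntiholomorphicCurvature) {p : M} {Ω : Set V}
    (hΩp : Ω ⊆ (extChartAt 𝓘(ℝ, V) p).target)
    (hΩ : LocalGeometry.IsMetricOn (h.metricInChart p) Ω)
    (hJ : ∀ y ∈ Ω, ContDiffAt ℝ 5 (h.complexInChart p) y) :
    LocalGeometry.IsAntiholomorphicModel (h.metricInChart p) (h.complexInChart p) Ω where
  metric := hΩ
  contDiffAt_J := hJ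
  herm y hy := h.isHermitianPair_inChart (hΩp hy)
  ah3 y hy x v z u := by
    have hq := (extChartAt 𝓘(ℝ, V) p).map_target (hΩp hy)
    have hy' := (extChartAt 𝓘(ℝ, V) p).right_inv (hΩp hy)
    have hR := h.curvatureForm_inChart_eq hΩ hq (by rwa [hy'])
    have hc := h.complexInChart_eq hq
    rw [hy'] at hR hc
    rw [hR, hR, hc, hc, hc, hc, hAH3.curvatureAt_J]
  anti y hy := by
    have hq := (extChartAt 𝓘(ℝ, V) p).map_target (hΩp hy)
    have hy' := (extChartAt 𝓘(ℝ, V) p).right_inv (hΩp hy)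
    have hR := h.curvatureForm_inChart_eq hΩ hq (by rwa [hy'])
    have hc := h.complexInChart_eq hq
    have hg := h.metricInChart_eq hq
    rw [hy'] at hR hc hg
    obtain ⟨ν, hν⟩ := hanti.exists_curvatureAt h ((extChartAt 𝓘(ℝ, V) p).symm y)
    refine ⟨ν, fun x z hxz ↦ ?_⟩
    rw [hg, hc] at hxz
    rw [hR, hν _ _ hxz]
    simp only [constCurv, hg]

/-- The curvature tensor at `p` is `ν π₁ + c ψ(F, F)`. -/
def HasConstantsAt (p : M) (ν c : ℝ) : Prop :=
  ∀ x y z u, h.curvatureAt p x y z u = ν * constCurv (h.metricAt p) x y z u +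
    c * twoFormCurv (fun a b ↦ fundForm (h.metricAt p) (h.complexAt p) a b)
      (fun a b ↦ fundForm (h.metricAt p) (h.complexAt p) a b) x y z u

omit [FiniteDimensional ℝ V] in
theorem HasConstantsAt.sectional {p : M} {ν c : ℝ} (hp : h.HasConstantsAt p ν c) (x y : V) :
    h.curvatureAt p x y y x = ν * constCurv (h.metricAt p) x y y x +
      c * (6 * h.metricAt p x (h.complexAt p y) ^ 2) := by
  rw [hp, twoFormCurv_fundForm_self _ _ (h.isHermitianPair_at p)]

omit [FiniteDimensional ℝ V] in
theorem HasConstantsAt.sectionalCurvature_eq {p : M} {ν c : ℝ} (hp : h.HasConstantsAt p ν c)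
    {x y : TangentSpace 𝓘(ℝ, V) p} (hli : LinearIndependent ℝ ![x, y]) :
    h.sectionalCurvature p x y = ν + c * (6 * (h.metricAt p x (h.complexAt p y) ^ 2
      / constCurv (V := V) (h.metricAt p) x y y x)) := by
  have key : ∀ x y : V, constCurv (h.metricAt p) x y y x ≠ 0 →
      h.curvatureAt p x y y x / constCurv (h.metricAt p) x y y x =
        ν + c * (6 * (h.metricAt p x (h.complexAt p y) ^ 2 / constCurv (h.metricAt p) x y y x)) := by
    intro x y h0
    rw [hp.sectional]
    field_simp
  exact (h.sectionalCurvature_eq p x y).trans (key x y ((h.linearIndependent_iff p x y).mp hli))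

/-- The constants are the antiholomorphic sectional curvature `ν` and a sixth of the difference of
the holomorphic one and `ν`. -/
theorem HasConstantsAt.unique {p : M} {ν c ν' c' : ℝ} (hdim : 4 < finrank ℝ V)
    (h1 : h.HasConstantsAt p ν c) (h2 : h.HasConstantsAt p ν' c') : ν = ν' ∧ c = c' := by
  have hg := h.isHermitianPair_at p
  obtain ⟨x, hx, -⟩ := hg.exists_unit_of_four_forms hdim 0 0 0 0
  obtain ⟨z, hz, hxz, hxJz, -⟩ := hg.exists_unit_of_four_forms hdim (h.metricAt p x)
    (fundForm (h.metricAt p) (h.complexAt p) x) 0 0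
  rw [fundForm_apply] at hxJz
  have e1 := h1.sectional h x z
  have e2 := h1.sectional h x (h.complexAt p x)
  rw [h2.sectional] at e1 e2
  simp only [constCurv, hx, hz, hxz, hxJz, hg.J_J, hg.g_J_J, hg.g_J_self, map_neg] at e1 e2
  constructor <;> linarith

/-- The local theorem, applied in the chart at `p`. -/
theorem exists_constants (hAH3 : h.IsAH3)
    (hanti : h.HasPointwiseConstantAntiholomorphicCurvature) {m : ℕ} (hm : 2 < m)
    (hdim : finrank ℝ V = 2 * m) (p : M) : ∃ ν c : ℝ, (∀ᶠ q in nhds p, h.HasConstantsAt q ν c) ∧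
      (c ≠ 0 → ∀ x y, h.nablaJ p x y = 0) := by
  obtain ⟨ε, hε, hεt, hM, hJ⟩ := h.exists_ball_chart p
  have hmodel := h.isAntiholomorphicModel_inChart hAH3 hanti hεt hM hJ
  obtain ⟨ν, c, hc⟩ := hmodel.exists_const hm hdim (convex_ball _ _).isPreconnected
  refine ⟨ν, c, ?_, (hc _ (Metric.mem_ball_self hε)).2⟩
  filter_upwards [extChartAt_source_mem_nhds (I := 𝓘(ℝ, V)) p,
    (continuousAt_extChartAt (I := 𝓘(ℝ, V)) p).eventually_mem
      (Metric.ball_mem_nhds _ hε)] with q hq hqb x y z u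
  obtain ⟨x, rfl⟩ := tangentCoordChange_surjective hq (mem_extChartAt_source q) x
  obtain ⟨y, rfl⟩ := tangentCoordChange_surjective hq (mem_extChartAt_source q) y
  obtain ⟨z, rfl⟩ := tangentCoordChange_surjective hq (mem_extChartAt_source q) z
  obtain ⟨u, rfl⟩ := tangentCoordChange_surjective hq (mem_extChartAt_source q) u
  have h1 := (hc _ hqb).1 x y z u
  rw [h.curvatureForm_inChart_eq hM hq hqb] at h1
  simp only [constCurv, twoFormCurv, fundForm_apply, h.metricInChart_eq hq,
    h.complexInChart_eq hq] at h1 ⊢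
  exact h1

end AlmostHermitianStructure

end

theorem mainTheorem1 {V : Type*} [NormedAddCommGroup V] [NormedSpace ℝ V] [FiniteDimensional ℝ V]
    {M : Type*} [TopologicalSpace M] [ChartedSpace V M] [IsManifold 𝓘(ℝ, V) ∞ M]
    [ConnectedSpace M] (m : ℕ) (hm : 2 < m) (hdim : finrank ℝ V = 2 * m)
    (h : AlmostHermitianStructure V M) (hAH3 : h.IsAH3)
    (hanti : h.HasPointwiseConstantAntiholomorphicCurvature) :
    h.IsRealSpaceForm ∨ h.IsComplexSpaceForm := by
  choose ν c hloc hJ using h.exists_constants hAH3 hanti hm hdim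
  -- the constants at a point are unique, hence locally constant
  have hconst : ∀ p q, ν p = ν q ∧ c p = c q := by
    have hlc : IsLocallyConstant fun p ↦ (ν p, c p) := by
      rw [IsLocallyConstant.iff_eventually_eq]
      intro p
      filter_upwards [hloc p] with q hq
      have := (hloc q).self_of_nhds.unique h (by omega) hq
      rw [this.1, this.2]
    intro p q
    simpa using hlc.apply_eq_of_preconnectedSpace p q
  obtain ⟨p₀⟩ := (inferInstance : Nonempty M)
  have hcurv : ∀ p, h.HasConstantsAt p (ν p₀) (c p₀) := fun p ↦ by
    rw [(hconst p₀ p).1, (hconst p₀ p).2]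
    exact (hloc p).self_of_nhds
  by_cases hc : c p₀ = 0
  · refine Or.inl ⟨ν p₀, fun p α _ x _ y _ hli ↦ ?_⟩
    rw [(hcurv p).sectionalCurvature_eq h hli, hc, zero_mul, add_zero]
  · refine Or.inr ⟨fun p ↦ hJ p ((hconst p₀ p).2 ▸ hc), ν p₀ + c p₀ * 6,
      fun p α hα x hx y hy hli ↦ ?_⟩
    -- `J x` lies in the plane spanned by `x` and `y`
    have hspan : Submodule.span ℝ {x, y} = α := by
      have : FiniteDimensional ℝ α := .of_finrank_pos (by rw [hα.1]; norm_num)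
      refine Submodule.eq_of_le_of_finrank_eq (Submodule.span_le.mpr ?_) ?_
      · rintro z (rfl | rfl)
        exacts [hx, hy]
      · have := finrank_span_eq_card hli
        rw [Matrix.range_cons, Matrix.range_cons, Matrix.range_empty, Set.union_empty,
          Set.singleton_union] at this
        rw [this, hα.1, Fintype.card_fin]
    have hJx : h.J p x ∈ Submodule.span ℝ {x, y} := by
      rw [hspan, ← hα.2]
      exact Submodule.mem_map_of_mem hx
    rw [← h.complexAt_apply] at hJx
    have hF := (h.isHermitianPair_at p).sq_fundForm_of_mem_span (x := x) (y := y) (hli.ne_zero 0)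
      hJx
    have h1 := (div_eq_one_iff_eq ((h.linearIndependent_iff p x y).mp hli)).mpr hF
    exact ((hcurv p).sectionalCurvature_eq h hli).trans
      ((congrArg (fun t ↦ ν p₀ + c p₀ * (6 * t)) h1).trans (by ring))
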